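/- Conventions. C*-algebras are complex and not necessarily unital or separable. For a C*-algebra $B$, let $\mathcal U(B)$ be the unitary group of $B$ if $B$ is unital, and the unitary group of $B+\mathbb C1$ otherwise; for $u\in\mathcal U(B)$ put $\mathrm{Ad}\,u(x)=uxu^*$ $(x\in B)$. A state of $B$ is a positive linear functional of norm one, and a pure state is an extreme point of the convex set of states. Two pure states $\omega_1,\omega_2$ are equivalent, $\omega_1\sim\omega_2$, if their GNS representations are unitarily equivalent. Let $\mathcal C$ be the class of all C*-algebras $A$ with the following property: for every finite subset $\mathcal F\subset A$ and every $\varepsilon>0$ there are a finite subset $\mathcal G\subset A$ and $\delta>0$ such that, whenever $B$ is a C*-algebra containing $A$ as a C*-subalgebra and $\omega_1,\omega_2$ are pure states of $B$ with $\omega_1\sim\omega_2$ and $|\omega_1(x)-\omega_2(x)|<\delta$ for all $x\in\mathcal G$, there is a norm-continuous path $(u_t)_{t\in[0,1]}$ in $\mathcal U(B)$ with $u_0=1$, $\omega_1=\omega_2\circ\mathrm{Ad}\,u_1$ and $\|\mathrm{Ad}\,u_t(x)-x\|<\varepsilon$ for all $x\in\mathcal F$ and $t\in[0,1]$. Proposition.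 The following statements hold. 1. If $A\in\mathcal C$ is non-unital, then $\tilde A\in\mathcal C$, where $\tilde A$ is the C*-algebra obtained by adjoining a unit to $A$. 2. If $A_1,A_2\in\mathcal C$ are unital, then $A_1\oplus A_2\in\mathcal C$. 3. If $A\in\mathcal C$ and $e\in A$ is a projection, then $eAe\in\mathcal C$. 4. If $A\in\mathcal C$ and $I$ is a closed two-sided ideal of $A$, then the quotient $A/I\in\mathcal C$. 5. If $A_1\to A_2\to A_3\to\cdots$ is an inductive system of C*-algebras $A_n\in\mathcal C$ with connecting $*$-homomorphisms (not necessarily injective), then the C*-algebra inductive limit $\varinjlim_n A_n$ belongs to $\mathcal C$. -/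

import Mathlib

open Filter Topology Set

universe u

/-! ### The unitary group and its inner action -/

section Basic

variable (B : Type u) [NonUnitalCStarAlgebra B]

/-- `B` is unital as a (possibly zero) C⋆-algebra: it has a two-sided identity element. -/
def HasIdentity : Prop :=
  ∃ e : B, ∀ x : B, e * x = x ∧ x * e = x

/-- The unitary group `𝒰(B)`: the unitary group of `B` if `B` is unital, and the unitary group of
`B + ℂ1` otherwise. In both cases it is realised inside `Unitization ℂ B = ℂ1 ⊕ B`.
If `B` is not unital this is the full unitary group of `Unitization ℂ B`. If `B` has an identity
element `e`, a unitary `v` of `B` is represented by `v + (1 - e)`, that is, the unitaries `u` of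
`Unitization ℂ B` with `u * (1 - e) = 1 - e` are taken; see `mem_unitaryGroupOf_iff`. -/
def unitaryGroupOf : Set (Unitization ℂ B) :=
  {u | u ∈ unitary (Unitization ℂ B) ∧
    ∀ e : B, (∀ x : B, e * x = x ∧ x * e = x) →
      u * (1 - (e : Unitization ℂ B)) = 1 - (e : Unitization ℂ B)}

variable {B}

/-- The inner action `Ad u (x) = u x u⋆` of an element `u` of the unitization on `B`. The product is
formed in the unitization, in which `B` is an ideal, and its `B`-component is returned. -/
def innerAd (u : Unitization ℂ B) (x : B) : B :=
  (u * (x : Unitization ℂ B) * star u).snd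

theorem coe_innerAd (u : Unitization ℂ B) (x : B) :
    (innerAd u x : Unitization ℂ B) = u * (x : Unitization ℂ B) * star u := by
  apply Unitization.ext <;> simp [innerAd]

/-- For unital `C`, `unitaryGroupOf C` is the copy `{v + (1 - 1_C)}` of the unitary group of `C`. -/
theorem mem_unitaryGroupOf_iff {C : Type u} [CStarAlgebra C] (w : Unitization ℂ C) :
    w ∈ unitaryGroupOf C ↔
      ∃ v ∈ unitary C, w = (v : Unitization ℂ C) + (1 - ((1 : C) : Unitization ℂ C)) := by
  constructor
  · rintro ⟨hw, h⟩
    have h1 : w.fst = 1 := by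
      have := congrArg (fun z : Unitization ℂ C => z.fst) (h 1 fun x => ⟨one_mul x, mul_one x⟩)
      simpa [sub_eq_add_neg] using this
    rw [Unitary.mem_iff] at hw
    have ha := congrArg (fun z : Unitization ℂ C => z.snd) hw.1
    have hb := congrArg (fun z : Unitization ℂ C => z.snd) hw.2
    simp only [Unitization.snd_mul, Unitization.fst_star, Unitization.snd_star, h1, star_one,
      one_smul, Unitization.snd_one] at ha hb
    refine ⟨w.snd + 1, ?_, ?_⟩
    · rw [Unitary.mem_iff, star_add, star_one]
      constructor
      · have h2 : (star w.snd + 1) * (w.snd + 1) =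
            (w.snd + star w.snd + star w.snd * w.snd) + 1 := by noncomm_ring
        rw [h2, ha, zero_add]
      · have h2 : (w.snd + 1) * (star w.snd + 1) =
            (star w.snd + w.snd + w.snd * star w.snd) + 1 := by noncomm_ring
        rw [h2, hb, zero_add]
    · apply Unitization.ext <;> simp [h1, sub_eq_add_neg]
  · rintro ⟨v, hv, rfl⟩
    rw [Unitary.mem_iff] at hv
    refine ⟨?_, ?_⟩
    · rw [Unitary.mem_iff]
      constructor <;> apply Unitization.ext <;>
        simp [add_mul, mul_add, hv.1, hv.2, sub_eq_add_neg]
    · intro e he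
      have : e = 1 := by simpa using (he 1).1
      subst this
      apply Unitization.ext
      · simp [sub_eq_add_neg]
      · simp [sub_eq_add_neg]
        abel

end Basic

/-! ### States, pure states, equivalence of GNS representations -/

section States

open scoped ComplexOrder

variable (B : Type u) [NonUnitalCStarAlgebra B]

/-- The states of `B`: positive linear functionals of norm one. -/
def stateSet : Set (B →L[ℂ] ℂ) :=
  {φ | (∀ a : B, 0 ≤ φ (star a * a)) ∧ ‖φ‖ = 1}

/-- The pure states of `B`: the extreme points of the convex set of states. -/
def pureStateSet : Set (B →L[ℂ] ℂ) :=
  Set.extremePoints ℝ (stateSet B)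

variable {B}

/-- A state as a bundled positive functional, for any order making `B` a star-ordered ring (there is
exactly one such order). -/
noncomputable def stateToPositive [PartialOrder B] [StarOrderedRing B] (φ : stateSet B) :
    B →ₚ[ℂ] ℂ :=
  PositiveLinearMap.mk₀ (φ.1 : B →ₗ[ℂ] ℂ) (by
    intro x hx
    obtain ⟨b, rfl⟩ := CStarAlgebra.nonneg_iff_eq_star_mul_self.mp hx
    exact φ.2.1 b)

/-- The GNS representations of `φ` and `ψ` are unitarily equivalent. -/
def GNSUnitarilyEquivalent [PartialOrder B] [StarOrderedRing B] (φ ψ : stateSet B) : Prop :=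
  ∃ U : (stateToPositive φ).GNS ≃ₗᵢ[ℂ] (stateToPositive ψ).GNS,
    ∀ (a : B) (ξ : (stateToPositive φ).GNS),
      U ((stateToPositive φ).gnsNonUnitalStarAlgHom a ξ) =
        (stateToPositive ψ).gnsNonUnitalStarAlgHom a (U ξ)

/-- Equivalence `φ ∼ ψ` of states: their GNS representations are unitarily equivalent. The canonical
order of the C⋆-algebra `B` is used. -/
def StatesEquivalent (φ ψ : stateSet B) : Prop :=
  letI : PartialOrder B := CStarAlgebra.spectralOrder B
  haveI : StarOrderedRing B := CStarAlgebra.spectralOrderedRing B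
  GNSUnitarilyEquivalent φ ψ

end States

/-! ### The property -/

/-- For every finite `F ⊆ A` and `ε > 0` there are a finite `G ⊆ A` and `δ > 0` such that, whenever
`B` is a C⋆-algebra containing `A` (via an injective ⋆-homomorphism `ι`) and `ω₁ ∼ ω₂` are
equivalent pure states of `B` which are `δ`-close on `G`, there is a norm-continuous path `(u_t)` in
`𝒰(B)` from `1` with `ω₁ = ω₂ ∘ Ad u_1` and `‖Ad u_t (x) - x‖ < ε` for `x ∈ F` and all `t`. -/
def PureStatePathProperty (A : Type u) [NonUnitalCStarAlgebra A] : Prop :=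
  ∀ (F : Finset A) (ε : ℝ), 0 < ε →
    ∃ (G : Finset A) (δ : ℝ), 0 < δ ∧
      ∀ (B : Type u) [NonUnitalCStarAlgebra B] (ι : A →⋆ₙₐ[ℂ] B), Function.Injective ι →
        ∀ ω₁ ω₂ : stateSet B, ω₁.1 ∈ pureStateSet B → ω₂.1 ∈ pureStateSet B →
          StatesEquivalent ω₁ ω₂ →
          (∀ x ∈ G, ‖ω₁.1 (ι x) - ω₂.1 (ι x)‖ < δ) →
          ∃ u : unitInterval → Unitization ℂ B,
            Continuous u ∧ (∀ t, u t ∈ unitaryGroupOf B) ∧ u 0 = 1 ∧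
            (∀ b : B, ω₁.1 b = ω₂.1 (innerAd (u 1) b)) ∧
            ∀ x ∈ F, ∀ t, ‖innerAd (u t) (ι x) - ι x‖ < ε

/-! ### Corners -/

section Corner

variable {A : Type u} [NonUnitalCStarAlgebra A]

/-- The corner `eAe` of a C⋆-algebra at a projection `e`. -/
def corner (e : A) (he : IsStarProjection e) : NonUnitalStarSubalgebra ℂ A where
  carrier := Set.range fun a : A => e * a * e
  add_mem' := by
    rintro _ _ ⟨a, rfl⟩ ⟨b, rfl⟩
    exact ⟨a + b, by simp [mul_add, add_mul]⟩
  zero_mem' := ⟨0, by simp⟩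
  mul_mem' := by
    rintro _ _ ⟨a, rfl⟩ ⟨b, rfl⟩
    exact ⟨a * e * (e * b), by simp [mul_assoc]⟩
  smul_mem' := by
    rintro c _ ⟨a, rfl⟩
    exact ⟨c • a, by simp [mul_smul_comm, smul_mul_assoc]⟩
  star_mem' := by
    rintro _ ⟨a, rfl⟩
    exact ⟨star a, by simp [he.isSelfAdjoint.star_eq, mul_assoc]⟩

theorem mem_corner_iff {e : A} (he : IsStarProjection e) {x : A} :
    x ∈ corner e he ↔ e * x * e = x := by
  constructor
  · rintro ⟨a, rfl⟩
    have h : e * e = e := he.isIdempotentElem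
    simp only [mul_assoc, h]
    simp only [← mul_assoc, h]
  · intro h
    exact ⟨x, h⟩

instance corner.isClosed (e : A) (he : IsStarProjection e) : IsClosed (corner e he : Set A) := by
  have : (corner e he : Set A) = {x | e * x * e = x} := by
    ext x
    exact mem_corner_iff he
  rw [this]
  exact isClosed_eq (by fun_prop) continuous_id

end Corner

/-! ### Quotients by closed two-sided ideals -/

/-- A closed two-sided ideal of a C⋆-algebra. -/
structure ClosedIdeal (A : Type u) [NonUnitalCStarAlgebra A] extends Submodule ℂ A where
  isClosed' : IsClosed carrier
  mul_left_mem' : ∀ (a : A) {x : A}, x ∈ carrier → a * x ∈ carrier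
  mul_right_mem' : ∀ (a : A) {x : A}, x ∈ carrier → x * a ∈ carrier

namespace ClosedIdeal

variable {A : Type u} [NonUnitalCStarAlgebra A] (I : ClosedIdeal A)

instance : IsClosed (I.toSubmodule : Set A) := I.isClosed'

theorem mul_left_mem (a : A) {x : A} (hx : x ∈ I.toSubmodule) : a * x ∈ I.toSubmodule :=
  I.mul_left_mem' a hx

theorem mul_right_mem (a : A) {x : A} (hx : x ∈ I.toSubmodule) : x * a ∈ I.toSubmodule :=
  I.mul_right_mem' a hx

/-- `I ∩ I⋆` as a C⋆-subalgebra (it turns out to be all of `I`). -/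
def selfAdjointPart : NonUnitalStarSubalgebra ℂ A where
  carrier := {x | x ∈ I.toSubmodule ∧ star x ∈ I.toSubmodule}
  add_mem' hx hy := ⟨add_mem hx.1 hy.1, by rw [star_add]; exact add_mem hx.2 hy.2⟩
  zero_mem' := ⟨zero_mem _, by rw [star_zero]; exact zero_mem _⟩
  mul_mem' {x y} hx hy := ⟨I.mul_left_mem x hy.1, by rw [star_mul]; exact I.mul_left_mem _ hx.2⟩
  smul_mem' c x hx := ⟨I.toSubmodule.smul_mem c hx.1, by
    rw [star_smul]; exact I.toSubmodule.smul_mem _ hx.2⟩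
  star_mem' {x} hx := ⟨hx.2, by rw [star_star]; exact hx.1⟩

instance : IsClosed (I.selfAdjointPart : Set A) := by
  have h : (I.selfAdjointPart : Set A) =
      (I.toSubmodule : Set A) ∩ star ⁻¹' (I.toSubmodule : Set A) := rfl
  rw [h]
  exact I.isClosed'.inter (I.isClosed'.preimage continuous_star)

/-- A closed two-sided ideal has an approximate unit of positive contractions. -/
theorem exists_approximateUnit :
    ∃ l : Filter A, l.NeBot ∧ (∀ᶠ e in l, e ∈ I.toSubmodule) ∧ (∀ᶠ e in l, star e = e) ∧
      (∀ᶠ e in l, ∀ z : A, ‖z - z * e‖ ≤ ‖z‖) ∧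
      ∀ x ∈ I.toSubmodule, Tendsto (fun e => ‖x - x * e‖) l (𝓝 0) := by
  let N := I.selfAdjointPart
  let _ : PartialOrder N := CStarAlgebra.spectralOrder N
  have _ : StarOrderedRing N := CStarAlgebra.spectralOrderedRing N
  have hu := CStarAlgebra.increasingApproximateUnit N
  have hnorm : ∀ᶠ e : N in CStarAlgebra.approximateUnit N, ∀ z : A, ‖z - z * (e : A)‖ ≤ ‖z‖ := by
    filter_upwards [hu.eventually_nonneg, hu.eventually_norm] with e he hn z
    let _ : PartialOrder A := CStarAlgebra.spectralOrder A
    have _ : StarOrderedRing A := CStarAlgebra.spectralOrderedRing A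
    let _ : PartialOrder (Unitization ℂ A) := CStarAlgebra.spectralOrder _
    have _ : StarOrderedRing (Unitization ℂ A) := CStarAlgebra.spectralOrderedRing _
    obtain ⟨b, hb⟩ := CStarAlgebra.nonneg_iff_eq_star_mul_self.mp he
    have h0 : (0 : Unitization ℂ A) ≤ ((e : A) : Unitization ℂ A) := by
      have : ((e : A) : Unitization ℂ A) =
          star ((b : A) : Unitization ℂ A) * ((b : A) : Unitization ℂ A) := by
        rw [hb]; simp
      rw [this]
      exact star_mul_self_nonneg _
    have h1 : ((e : A) : Unitization ℂ A) ≤ 1 := by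
      rw [← CStarAlgebra.norm_le_one_iff_of_nonneg _ h0, Unitization.norm_inr]
      exact hn
    have h2 : ‖(1 : Unitization ℂ A) - ((e : A) : Unitization ℂ A)‖ ≤ 1 := by
      rw [CStarAlgebra.norm_le_one_iff_of_nonneg _ (sub_nonneg.mpr h1)]
      simpa using h0
    calc ‖z - z * (e : A)‖ = ‖((z - z * (e : A) : A) : Unitization ℂ A)‖ :=
          (Unitization.norm_inr ..).symm
      _ = ‖(z : Unitization ℂ A) * (1 - ((e : A) : Unitization ℂ A))‖ := by
          congr 1
          rw [Unitization.inr_sub, Unitization.inr_mul, mul_sub, mul_one]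
      _ ≤ ‖(z : Unitization ℂ A)‖ * ‖1 - ((e : A) : Unitization ℂ A)‖ := norm_mul_le _ _
      _ ≤ ‖(z : Unitization ℂ A)‖ * 1 := by gcongr
      _ = ‖z‖ := by rw [mul_one, Unitization.norm_inr]
  have hN : ∀ n : N, Tendsto (fun e : N => ‖(n : A) - (n : A) * (e : A)‖)
      (CStarAlgebra.approximateUnit N) (𝓝 0) := by
    intro n
    have h := (tendsto_const_nhds (x := n)).sub (hu.tendsto_mul_left n)
    rw [sub_self] at h
    have h' := h.norm
    rw [norm_zero] at h'
    exact h'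
  refine ⟨(CStarAlgebra.approximateUnit N).map ((↑) : N → A), inferInstance, ?_, ?_, ?_, ?_⟩
  · rw [eventually_map]
    exact Eventually.of_forall fun e : N => e.2.1
  · rw [eventually_map]
    filter_upwards [hu.eventually_star_eq] with e he
    exact congrArg Subtype.val he
  · rw [eventually_map]
    exact hnorm
  · intro x hx
    rw [tendsto_map'_iff]
    have hxx : star x * x ∈ N := ⟨I.mul_left_mem _ hx, by
      rw [star_mul, star_star]; exact I.mul_left_mem _ hx⟩
    have h := ((hN ⟨star x * x, hxx⟩).const_mul 2).sqrt
    simp only [mul_zero, Real.sqrt_zero] at h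
    refine squeeze_zero' (Eventually.of_forall fun e => norm_nonneg _) ?_ h
    filter_upwards [hu.eventually_star_eq, hu.eventually_norm] with e he hn
    have he' : star (e : A) = e := congrArg Subtype.val he
    have hn' : ‖(e : A)‖ ≤ 1 := hn
    apply Real.le_sqrt_of_sq_le
    set y : A := star x * x - star x * x * e with hy
    calc ‖x - x * (e : A)‖ ^ 2 = ‖star (x - x * (e : A)) * (x - x * (e : A))‖ := by
          rw [CStarRing.norm_star_mul_self, sq]
      _ = ‖y - (e : A) * y‖ := by
          congr 1
          rw [hy, star_sub, star_mul, he']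
          noncomm_ring
      _ ≤ ‖y‖ + ‖(e : A)‖ * ‖y‖ := (norm_sub_le _ _).trans (by gcongr; exact norm_mul_le _ _)
      _ ≤ ‖y‖ + 1 * ‖y‖ := by gcongr
      _ = 2 * ‖y‖ := by ring

/-- A closed two-sided ideal is closed under the involution. -/
theorem star_mem {x : A} (hx : x ∈ I.toSubmodule) : star x ∈ I.toSubmodule := by
  obtain ⟨l, hl, hmem, hstar, -, hlim⟩ := I.exists_approximateUnit
  have h : Tendsto (fun e => e * star x) l (𝓝 (star x)) := by
    rw [tendsto_iff_norm_sub_tendsto_zero]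
    refine (hlim x hx).congr' ?_
    filter_upwards [hstar] with e he
    rw [← norm_star (x - x * e), star_sub, star_mul, he, norm_sub_rev]
  exact I.isClosed'.mem_of_tendsto h (hmem.mono fun e he => I.mul_right_mem _ he)

/-- The quotient `A / I`. -/
def Quotient : Type u := A ⧸ I.toSubmodule

namespace Quotient

noncomputable instance : NormedAddCommGroup I.Quotient :=
  inferInstanceAs (NormedAddCommGroup (A ⧸ I.toSubmodule))

noncomputable instance : NormedSpace ℂ I.Quotient :=
  inferInstanceAs (NormedSpace ℂ (A ⧸ I.toSubmodule))

instance : CompleteSpace I.Quotient :=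
  inferInstanceAs (CompleteSpace (A ⧸ I.toSubmodule))

/-- The quotient map as a linear map. -/
def mkLinear : A →ₗ[ℂ] I.Quotient := I.toSubmodule.mkQ

theorem mkLinear_surjective : Function.Surjective (mkLinear I) := I.toSubmodule.mkQ_surjective

theorem mkLinear_eq_iff {x y : A} : mkLinear I x = mkLinear I y ↔ x - y ∈ I.toSubmodule :=
  Submodule.Quotient.eq _

theorem norm_mkLinear_le (x : A) : ‖mkLinear I x‖ ≤ ‖x‖ := Submodule.Quotient.norm_mk_le _ x

theorem exists_norm_lt (q : I.Quotient) {ε : ℝ} (hε : 0 < ε) :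
    ∃ a : A, mkLinear I a = q ∧ ‖a‖ < ‖q‖ + ε :=
  Submodule.Quotient.norm_mk_lt (S := I.toSubmodule) q hε

/-- Multiplication on the quotient, `(x + I)(y + I) = xy + I`. -/
instance : Mul I.Quotient where
  mul := Quotient.map₂ (· * ·) (by
    intro a b hab c d hcd
    have hab' : a - b ∈ I.toSubmodule := (Submodule.quotientRel_def _).mp hab
    have hcd' : c - d ∈ I.toSubmodule := (Submodule.quotientRel_def _).mp hcd
    refine (Submodule.quotientRel_def _).mpr ?_
    have h : a * c - b * d = (a - b) * c + b * (c - d) := by noncomm_ring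
    rw [h]
    exact add_mem (I.mul_right_mem _ hab') (I.mul_left_mem _ hcd'))

/-- The involution on the quotient, `(x + I)⋆ = x⋆ + I`. -/
instance : Star I.Quotient where
  star := Quotient.map star (by
    intro a b hab
    have hab' : a - b ∈ I.toSubmodule := (Submodule.quotientRel_def _).mp hab
    refine (Submodule.quotientRel_def _).mpr ?_
    rw [← star_sub]
    exact I.star_mem hab')

theorem mkLinear_mul (x y : A) : mkLinear I (x * y) = mkLinear I x * mkLinear I y := rfl

theorem mkLinear_star (x : A) : mkLinear I (star x) = star (mkLinear I x) := rfl

theorem norm_mul_le' (p q : I.Quotient) : ‖p * q‖ ≤ ‖p‖ * ‖q‖ := by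
  have h : ∀ ε > (0 : ℝ), ‖p * q‖ ≤ (‖p‖ + ε) * (‖q‖ + ε) := by
    intro ε hε
    obtain ⟨a, rfl, ha⟩ := exists_norm_lt I p hε
    obtain ⟨b, rfl, hb⟩ := exists_norm_lt I q hε
    rw [← mkLinear_mul]
    calc _ ≤ ‖a * b‖ := norm_mkLinear_le I _
      _ ≤ ‖a‖ * ‖b‖ := norm_mul_le _ _
      _ ≤ _ := by gcongr
  have hc : Tendsto (fun ε : ℝ => (‖p‖ + ε) * (‖q‖ + ε)) (𝓝[>] 0) (𝓝 (‖p‖ * ‖q‖)) := by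
    have : Continuous fun ε : ℝ => (‖p‖ + ε) * (‖q‖ + ε) := by fun_prop
    simpa using (this.tendsto 0).mono_left nhdsWithin_le_nhds
  exact ge_of_tendsto hc (eventually_mem_nhdsWithin.mono h)

theorem norm_mul_self_le' (p : I.Quotient) : ‖p‖ * ‖p‖ ≤ ‖star p * p‖ := by
  refine le_of_forall_pos_le_add fun ε hε => ?_
  obtain ⟨x, rfl⟩ := mkLinear_surjective I p
  obtain ⟨y, hy, hyn⟩ := exists_norm_lt I (star (mkLinear I x) * mkLinear I x) (half_pos hε)
  rw [← mkLinear_star, ← mkLinear_mul, mkLinear_eq_iff] at hy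
  obtain ⟨l, hl, hmem, hstar, hcontr, hlim⟩ := I.exists_approximateUnit
  have h := (hlim _ (neg_mem hy)).eventually (gt_mem_nhds (half_pos hε))
  obtain ⟨e, he, hes, hec, hen⟩ := (hmem.and (hstar.and (hcontr.and h))).exists
  have h1 : mkLinear I x = mkLinear I (x - x * e) := by
    rw [mkLinear_eq_iff, sub_sub_cancel]
    exact I.mul_left_mem _ he
  have h2 : ‖star (x - x * e) * (x - x * e)‖ ≤ ‖star x * x - star x * x * e‖ := by
    have h3 : star (x - x * e) * (x - x * e) =
        star (star (star x * x - star x * x * e) - star (star x * x - star x * x * e) * e) := by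
      simp only [star_sub, star_mul, star_star, hes]
      noncomm_ring
    rw [h3, norm_star]
    exact (hec _).trans (norm_star _).le
  have h4 : star x * x - star x * x * e =
      (y - y * e) + (-(y - star x * x) - -(y - star x * x) * e) := by
    noncomm_ring
  calc ‖mkLinear I x‖ * ‖mkLinear I x‖ ≤ ‖x - x * e‖ * ‖x - x * e‖ := by
        rw [h1]
        gcongr <;> exact norm_mkLinear_le I _
    _ = ‖star (x - x * e) * (x - x * e)‖ := CStarRing.norm_star_mul_self.symm
    _ ≤ ‖star x * x - star x * x * e‖ := h2
    _ ≤ ‖y - y * e‖ + ‖-(y - star x * x) - -(y - star x * x) * e‖ := by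
        rw [h4]
        exact norm_add_le _ _
    _ ≤ ‖y‖ + ε / 2 := add_le_add (hec y) hen.le
    _ ≤ _ := by linarith

/-- The quotient of a C⋆-algebra by a closed two-sided ideal, with the quotient norm, is a
C⋆-algebra. -/
noncomputable instance : NonUnitalCStarAlgebra I.Quotient where
  __ := (inferInstance : NormedAddCommGroup I.Quotient)
  __ := (inferInstance : NormedSpace ℂ I.Quotient)
  __ := (inferInstance : CompleteSpace I.Quotient)
  mul := (· * ·)
  left_distrib := by
    intro p q r
    obtain ⟨a, rfl⟩ := mkLinear_surjective I p
    obtain ⟨b, rfl⟩ := mkLinear_surjective I q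
    obtain ⟨c, rfl⟩ := mkLinear_surjective I r
    exact congrArg (mkLinear I) (mul_add a b c)
  right_distrib := by
    intro p q r
    obtain ⟨a, rfl⟩ := mkLinear_surjective I p
    obtain ⟨b, rfl⟩ := mkLinear_surjective I q
    obtain ⟨c, rfl⟩ := mkLinear_surjective I r
    exact congrArg (mkLinear I) (add_mul a b c)
  zero_mul := by
    intro p
    obtain ⟨a, rfl⟩ := mkLinear_surjective I p
    exact congrArg (mkLinear I) (zero_mul a)
  mul_zero := by
    intro p
    obtain ⟨a, rfl⟩ := mkLinear_surjective I p
    exact congrArg (mkLinear I) (mul_zero a)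
  mul_assoc := by
    intro p q r
    obtain ⟨a, rfl⟩ := mkLinear_surjective I p
    obtain ⟨b, rfl⟩ := mkLinear_surjective I q
    obtain ⟨c, rfl⟩ := mkLinear_surjective I r
    exact congrArg (mkLinear I) (mul_assoc a b c)
  norm_mul_le := norm_mul_le' I
  star := star
  star_involutive := by
    intro p
    obtain ⟨a, rfl⟩ := mkLinear_surjective I p
    exact congrArg (mkLinear I) (star_star a)
  star_mul := by
    intro p q
    obtain ⟨a, rfl⟩ := mkLinear_surjective I p
    obtain ⟨b, rfl⟩ := mkLinear_surjective I q
    exact congrArg (mkLinear I) (star_mul a b)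
  star_add := by
    intro p q
    obtain ⟨a, rfl⟩ := mkLinear_surjective I p
    obtain ⟨b, rfl⟩ := mkLinear_surjective I q
    exact congrArg (mkLinear I) (star_add a b)
  norm_mul_self_le := norm_mul_self_le' I
  smul_assoc := by
    intro c p q
    obtain ⟨a, rfl⟩ := mkLinear_surjective I p
    obtain ⟨b, rfl⟩ := mkLinear_surjective I q
    exact congrArg (mkLinear I) (smul_mul_assoc c a b)
  smul_comm := by
    intro c p q
    obtain ⟨a, rfl⟩ := mkLinear_surjective I p
    obtain ⟨b, rfl⟩ := mkLinear_surjective I q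
    exact congrArg (mkLinear I) (mul_smul_comm c a b).symm
  star_smul := by
    intro c p
    obtain ⟨a, rfl⟩ := mkLinear_surjective I p
    exact congrArg (mkLinear I) (star_smul c a)

end Quotient

/-- The quotient map `A → A / I` as a ⋆-homomorphism. -/
noncomputable def quotientMap : A →⋆ₙₐ[ℂ] I.Quotient where
  toFun := Quotient.mkLinear I
  map_smul' c x := (Quotient.mkLinear I).map_smul c x
  map_zero' := (Quotient.mkLinear I).map_zero
  map_add' := (Quotient.mkLinear I).map_add
  map_mul' := Quotient.mkLinear_mul I
  map_star' := Quotient.mkLinear_star I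

theorem quotientMap_surjective : Function.Surjective I.quotientMap := Quotient.mkLinear_surjective I

theorem quotientMap_eq_zero_iff (x : A) : I.quotientMap x = 0 ↔ x ∈ I.toSubmodule :=
  Submodule.Quotient.mk_eq_zero _

end ClosedIdeal

/-! ### Inductive limits of sequences -/

section InductiveLimit

variable {A : ℕ → Type u} [∀ n, NonUnitalCStarAlgebra (A n)]

/-- The ideal `⨁ A n` of null sequences in the C⋆-algebra `∏ A n` of bounded sequences. -/
def nullSequences (A : ℕ → Type u) [∀ n, NonUnitalCStarAlgebra (A n)] : ClosedIdeal (lp A ⊤) where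
  carrier := {x | Tendsto (fun n => ‖x n‖) atTop (𝓝 0)}
  add_mem' := by
    intro x y hx hy
    have h := hx.add hy
    rw [add_zero] at h
    exact squeeze_zero (fun n => norm_nonneg _) (fun n => norm_add_le (x n) (y n)) h
  zero_mem' := by simp
  smul_mem' := by
    intro c x hx
    have h := hx.const_mul ‖c‖
    rw [mul_zero] at h
    exact squeeze_zero (fun n => norm_nonneg _) (fun n => (norm_smul c (x n)).le) h
  isClosed' := by
    refine isClosed_of_closure_subset fun x hx => ?_
    rw [Metric.mem_closure_iff] at hx
    change Tendsto (fun n => ‖x n‖) atTop (𝓝 0)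
    rw [Metric.tendsto_atTop]
    intro ε hε
    obtain ⟨y, hy, hxy⟩ := hx (ε / 2) (half_pos hε)
    obtain ⟨N, hN⟩ := Metric.tendsto_atTop.mp hy (ε / 2) (half_pos hε)
    refine ⟨N, fun n hn => ?_⟩
    have h1 := hN n hn
    have h2 : ‖x n - y n‖ ≤ ‖x - y‖ := lp.norm_apply_le_norm (by simp) (x - y) n
    rw [dist_eq_norm] at hxy
    simp only [dist_zero_right, norm_norm] at h1 ⊢
    have h3 : ‖x n‖ ≤ ‖x n - y n‖ + ‖y n‖ := by
      simpa using norm_add_le (x n - y n) (y n)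
    linarith
  mul_left_mem' := by
    intro a x hx
    have h := hx.const_mul ‖a‖
    rw [mul_zero] at h
    exact squeeze_zero (fun n => norm_nonneg _)
      (fun n => (norm_mul_le (a n) (x n)).trans
        (mul_le_mul_of_nonneg_right (lp.norm_apply_le_norm (by simp) a n) (norm_nonneg _))) h
  mul_right_mem' := by
    intro a x hx
    have h := hx.mul_const ‖a‖
    rw [zero_mul] at h
    exact squeeze_zero (fun n => norm_nonneg _)
      (fun n => (norm_mul_le (x n) (a n)).trans
        (mul_le_mul_of_nonneg_left (lp.norm_apply_le_norm (by simp) a n) (norm_nonneg _))) h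

/-- The ⋆-algebra of bounded sequences that eventually follow the connecting maps, that is,
sequences of the form `(x_0, …, x_{n-1}, a, φ_n a, φ_{n+1} (φ_n a), …)` with `a ∈ A n`. -/
def coherentSequences (φ : ∀ n, A n →⋆ₙₐ[ℂ] A (n + 1)) : NonUnitalStarSubalgebra ℂ (lp A ⊤) where
  carrier := {x | ∃ n, ∀ k ≥ n, x (k + 1) = φ k (x k)}
  add_mem' := by
    rintro x y ⟨n, hn⟩ ⟨m, hm⟩
    refine ⟨max n m, fun k hk => ?_⟩
    simp [hn k (le_of_max_le_left hk), hm k (le_of_max_le_right hk)]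
  zero_mem' := ⟨0, by simp⟩
  mul_mem' := by
    rintro x y ⟨n, hn⟩ ⟨m, hm⟩
    refine ⟨max n m, fun k hk => ?_⟩
    simp [hn k (le_of_max_le_left hk), hm k (le_of_max_le_right hk), lp.infty_coeFn_mul]
  smul_mem' := by
    rintro c x ⟨n, hn⟩
    exact ⟨n, fun k hk => by simp [hn k hk]⟩
  star_mem' := by
    rintro x ⟨n, hn⟩
    exact ⟨n, fun k hk => by simp [hn k hk, map_star]⟩

/-- The inductive limit of the sequence `A 0 → A 1 → A 2 → ⋯` of C⋆-algebras with connecting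
⋆-homomorphisms `φ n` (not assumed injective), in its standard realisation: the closure in
`∏ A n / ⨁ A n` of the classes of the sequences that eventually follow the connecting maps. -/
noncomputable def inductiveLimit (φ : ∀ n, A n →⋆ₙₐ[ℂ] A (n + 1)) :
    NonUnitalStarSubalgebra ℂ (nullSequences A).Quotient :=
  ((coherentSequences φ).map (nullSequences A).quotientMap).topologicalClosure

instance inductiveLimit.isClosed (φ : ∀ n, A n →⋆ₙₐ[ℂ] A (n + 1)) :
    IsClosed (inductiveLimit φ : Set (nullSequences A).Quotient) :=
  NonUnitalStarSubalgebra.isClosed_topologicalClosure _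

end InductiveLimit

/-! The property is first rewritten in terms of vectors. `VectorPathProperty` concerns a
representation `π` of `B` that is strongly dense in the bounded operators, unit vectors `ξ`, `η`,
and an arbitrary, not necessarily injective, homomorphism `ι : A → B`. It asks for a unitary path in
the unitization that starts at `1`, almost commutes with `ι(F)` and has `π(u₁)ξ = η`.

The two properties are equivalent. In one direction, `B` is replaced by `B × A` and `ι` by `(ι,
id)`, which is injective, while `π` factors through the first coordinate. In the other, equivalent
pure states are vector states of one dense GNS representation. The equivalence rests on three facts
proved below: pure states give dense representations, unit vectors of dense representations give
pure states, and equality of vector states determines the vector up to a phase.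

Once injectivity is dropped, quotients follow by composing with the quotient map, and inductive
limits by approximating a finite set from a single `A n`.

Unitizations and direct sums use the gluing theorem `VectorPathProperty.of_decomposition`. A
projection `e` of `A` splits the Hilbert space in two. The vectors are moved slightly until their
components have matching norms, each corner is treated separately, and the two corner paths are
added. The small moves come from a quantitative Kadison transitivity theorem: a self-adjoint `b`
with `π(b)ν = ζ` and `‖b‖ ≤ 6‖ζ‖/‖ν‖` has a Cayley transform that carries one prescribed unit vector
to another. Gluing with the zero algebra also reduces unital `A` to homomorphisms preserving the
identity, where adjoining scalars is harmless.

For a corner `eAe` and a unital `ι : eAe → B`, the algebra `B` has to be enlarged to a `D` that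
receives `A`. Compression by `e` is completely positive, so a representation of `B` dilates to a
representation of `A` on a larger space. This gives a `D` with `B = eDe` and a dense representation
of `D` extending `π` (`exists_corner_amalgam`). The property of `A` yields a path in the unitization
of `D` almost commuting with `e`. Its compression to `B` is almost unitary, and it is repaired by
polar decomposition and a short path at the endpoint. -/

set_option linter.unusedSectionVars false

/-! ### Strongly dense representations and the density theorem. -/

section DenseRepresentations

open scoped InnerProductSpace

variable {B : Type u} [NonUnitalCStarAlgebra B]
variable {H : Type u} [NormedAddCommGroup H] [InnerProductSpace ℂ H] [CompleteSpace H]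

/-- A representation whose image is strongly dense in the bounded operators. -/
def IsDenseRep (π : B →⋆ₙₐ[ℂ] (H →L[ℂ] H)) : Prop :=
  ∀ (s : Finset H) (T : H →L[ℂ] H) (ε : ℝ), 0 < ε → ∃ b, ∀ v ∈ s, ‖π b v - T v‖ < ε

theorem inner_rep_left (π : B →⋆ₙₐ[ℂ] (H →L[ℂ] H)) (b : B) (x y : H) :
    ⟪π b x, y⟫_ℂ = ⟪x, π (star b) y⟫_ℂ := by
  rw [map_star, ContinuousLinearMap.star_eq_adjoint, ContinuousLinearMap.adjoint_inner_right]

theorem inner_rep_right (π : B →⋆ₙₐ[ℂ] (H →L[ℂ] H)) (b : B) (x y : H) :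
    ⟪x, π b y⟫_ℂ = ⟪π (star b) x, y⟫_ℂ := by
  rw [inner_rep_left, star_star]

/-- The diagonal operator on a finite power of a Hilbert space. -/
noncomputable def diagonalOp (ι : Type*) [Fintype ι] (T : H →L[ℂ] H) :
    PiLp 2 (fun _ : ι => H) →L[ℂ] PiLp 2 (fun _ : ι => H) :=
  ((PiLp.continuousLinearEquiv 2 ℂ (fun _ : ι => H)).symm : (ι → H) →L[ℂ] _) ∘L
    (ContinuousLinearMap.pi fun i => T ∘L ContinuousLinearMap.proj i) ∘L
      ((PiLp.continuousLinearEquiv 2 ℂ (fun _ : ι => H)) : _ →L[ℂ] (ι → H))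

@[simp]
theorem diagonalOp_apply {ι : Type*} [Fintype ι] (T : H →L[ℂ] H) (x : PiLp 2 (fun _ : ι => H))
    (i : ι) : diagonalOp ι T x i = T (x i) := rfl

/-- The `j`-th coordinate inclusion into a finite power of a Hilbert space. -/
noncomputable def coordInclusion (ι : Type*) [Fintype ι] [DecidableEq ι] (j : ι) :
    H →L[ℂ] PiLp 2 (fun _ : ι => H) :=
  ((PiLp.continuousLinearEquiv 2 ℂ (fun _ : ι => H)).symm : (ι → H) →L[ℂ] _) ∘L
    ContinuousLinearMap.single ℂ (fun _ : ι => H) j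

theorem sum_coordInclusion {ι : Type*} [Fintype ι] [DecidableEq ι]
    (x : PiLp 2 (fun _ : ι => H)) : x = ∑ j, coordInclusion ι j (x j) := by
  ext i
  simp [coordInclusion, Pi.single_apply]

/-- A projection commuting with all diagonal operators from a representation with scalar commutant
commutes with all diagonal operators. -/
theorem commute_diagonalOp_of_commutant {π : B →⋆ₙₐ[ℂ] (H →L[ℂ] H)}
    (hcomm : ∀ T : H →L[ℂ] H, (∀ b, T ∘L π b = π b ∘L T) → ∃ c : ℂ, ∀ v, T v = c • v)
    {ι : Type*} [Fintype ι] (P : PiLp 2 (fun _ : ι => H) →L[ℂ] PiLp 2 (fun _ : ι => H))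
    (hP : ∀ b x, P (diagonalOp ι (π b) x) = diagonalOp ι (π b) (P x)) (T : H →L[ℂ] H)
    (x : PiLp 2 (fun _ : ι => H)) : P (diagonalOp ι T x) = diagonalOp ι T (P x) := by
  classical
  have hsingle : ∀ (S : H →L[ℂ] H) (j : ι) (v : H),
      diagonalOp ι S (coordInclusion ι j v) = coordInclusion ι j (S v) := by
    intro S j v
    ext i
    by_cases h : i = j
    · subst h; simp [coordInclusion]
    · simp [coordInclusion, h]
  -- The matrix entries of `P` lie in the commutant of `π`, so they are scalars, and a scalar matrix
  -- commutes with every diagonal operator.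
  have hc : ∀ i j, ∃ c : ℂ, ∀ v : H, P (coordInclusion ι j v) i = c • v := by
    intro i j
    refine hcomm ((ContinuousLinearMap.proj i ∘L
      ((PiLp.continuousLinearEquiv 2 ℂ (fun _ : ι => H)) : _ →L[ℂ] (ι → H))) ∘L P ∘L
        coordInclusion ι j) fun b => ?_
    ext v
    have h := congrArg (fun z : PiLp 2 (fun _ : ι => H) => z i) (hP b (coordInclusion ι j v))
    rw [hsingle] at h
    simpa using h
  choose c hc using hc
  rw [sum_coordInclusion x]
  simp only [map_sum]
  refine Finset.sum_congr rfl fun j _ => ?_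
  ext i
  rw [hsingle, diagonalOp_apply, hc, hc, map_smul]

/-- The density theorem: a nondegenerate representation with scalar commutant is dense. -/
theorem isDenseRep_of_commutant {π : B →⋆ₙₐ[ℂ] (H →L[ℂ] H)}
    (hcomm : ∀ T : H →L[ℂ] H, (∀ b, T ∘L π b = π b ∘L T) → ∃ c : ℂ, ∀ v, T v = c • v)
    (hnd : ∀ v, (∀ b, π b v = 0) → v = 0) : IsDenseRep π := by
  classical
  intro s T ε hε
  let E := PiLp 2 (fun _ : s => H)
  let v : E := WithLp.toLp 2 fun i => (i : H)
  let L : B →ₗ[ℂ] E :=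
    { toFun := fun b => diagonalOp s (π b) v
      map_add' := fun a b => by ext i; simp; rfl
      map_smul' := fun c b => by ext i; simp; rfl }
  -- The closed orbit of the tuple `v`. Its projection commutes with the diagonal copy of `π`, hence
  -- with that of `T`; since `v ∈ M` by nondegeneracy, `T v ∈ M`.
  let M : Submodule ℂ E := (LinearMap.range L).topologicalClosure
  have hMc : IsClosed (M : Set E) := Submodule.isClosed_topologicalClosure _
  have : CompleteSpace M := hMc.completeSpace_coe
  let P : E →L[ℂ] E := M.starProjection
  have hLM : ∀ b, L b ∈ M := fun b => Submodule.le_topologicalClosure _ ⟨b, rfl⟩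
  have hinv : ∀ b, ∀ x ∈ M, diagonalOp s (π b) x ∈ M := by
    intro b x hx
    have h1 : MapsTo (diagonalOp s (π b)) (LinearMap.range L : Set E) (LinearMap.range L) := by
      rintro _ ⟨c, rfl⟩
      refine ⟨b * c, ?_⟩
      ext i
      simp [L]
    exact h1.closure (diagonalOp s (π b)).continuous hx
  have hinner : ∀ b (x y : E),
      ⟪diagonalOp s (π b) x, y⟫_ℂ = ⟪x, diagonalOp s (π (star b)) y⟫_ℂ := by
    intro b x y
    simp only [PiLp.inner_apply, diagonalOp_apply]
    exact Finset.sum_congr rfl fun i _ => inner_rep_left π b _ _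
  have hP : ∀ b x, P (diagonalOp s (π b) x) = diagonalOp s (π b) (P x) := by
    intro b x
    refine Submodule.eq_starProjection_of_mem_of_inner_eq_zero (hinv b _ (M.starProjection_apply_mem x)) ?_ 
    intro w hw
    rw [← map_sub, hinner]
    exact M.starProjection_inner_eq_zero x _ (hinv _ _ hw)
  have hv : P v = v := by
    have hw : v - P v = 0 := by
      ext i
      refine hnd _ fun b => ?_
      have h1 : diagonalOp s (π b) (v - P v) = 0 := by
        rw [map_sub, ← hP, sub_eq_zero]
        exact (Submodule.starProjection_eq_self_iff.mpr (hLM b)).symm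
      exact congrArg (fun z : E => z i) h1
    exact (sub_eq_zero.mp hw).symm
  have hT : diagonalOp s T v ∈ M := by
    rw [← hv, ← commute_diagonalOp_of_commutant hcomm P hP]
    exact M.starProjection_apply_mem _
  obtain ⟨_, ⟨b, rfl⟩, hb⟩ := Metric.mem_closure_iff.mp hT ε hε
  refine ⟨b, fun w hw => ?_⟩
  have h2 := PiLp.norm_apply_le (diagonalOp s T v - L b) ⟨w, hw⟩
  rw [dist_eq_norm] at hb
  rw [norm_sub_rev]
  exact lt_of_le_of_lt h2 hb

/-- A vector lies in the closure of a real subspace of a complex Hilbert space if it is real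
orthogonal to every vector that is real orthogonal to the subspace. -/
theorem exists_norm_sub_lt_of_re_inner {G E : Type*} [AddCommGroup G] [Module ℝ G]
    [NormedAddCommGroup E] [InnerProductSpace ℂ E] [CompleteSpace E] (f : G → E)
    (hadd : ∀ a b, f (a + b) = f a + f b) (hsmul : ∀ (c : ℝ) a, f (c • a) = (c : ℂ) • f a) (y : E)
    (h : ∀ x, (∀ g, (⟪x, f g⟫_ℂ).re = 0) → (⟪x, y⟫_ℂ).re = 0) {ε : ℝ} (hε : 0 < ε) :
    ∃ g, ‖f g - y‖ < ε := by
  let L : G →ₗ[ℝ] E :=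
    { toFun := f
      map_add' := hadd
      map_smul' := fun c a => by rw [hsmul, Complex.coe_smul]; rfl }
  have hy : y ∈ (LinearMap.range L).topologicalClosure := by
    let _ : InnerProductSpace ℝ E := InnerProductSpace.complexToReal
    refine (Submodule.orthogonal_orthogonal_eq_closure (LinearMap.range L)).le ?_
    rw [Submodule.mem_orthogonal]
    intro x hx
    rw [Submodule.mem_orthogonal] at hx
    rw [real_inner_eq_re_inner ℂ]
    refine h x fun g => ?_
    have := hx (L g) ⟨g, rfl⟩
    rw [real_inner_comm, real_inner_eq_re_inner ℂ] at this
    exact this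
  obtain ⟨_, ⟨g, rfl⟩, hg⟩ := Metric.mem_closure_iff.mp hy ε hε
  refine ⟨g, ?_⟩
  rwa [dist_comm, dist_eq_norm] at hg

/-- Self-adjoint operators are strongly approximated by self-adjoint elements. -/
theorem IsDenseRep.exists_isSelfAdjoint {π : B →⋆ₙₐ[ℂ] (H →L[ℂ] H)} (hπ : IsDenseRep π)
    (s : Finset H) {T : H →L[ℂ] H} (hT : ∀ x y, ⟪T x, y⟫_ℂ = ⟪x, T y⟫_ℂ) {ε : ℝ} (hε : 0 < ε) :
    ∃ b, IsSelfAdjoint b ∧ ∀ v ∈ s, ‖π b v - T v‖ < ε := by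
  classical
  let E := PiLp 2 (fun _ : s => H)
  let v : E := WithLp.toLp 2 fun i => (i : H)
  obtain ⟨b, hb⟩ := exists_norm_sub_lt_of_re_inner
    (fun b : selfAdjoint B => (diagonalOp s (π b) v : E)) (fun a b => by ext i; simp)
    (fun c b => by
      ext i
      simp only [selfAdjoint.val_smul, diagonalOp_apply]
      rw [← Complex.coe_smul, map_smul]
      simp) (diagonalOp s T v) (by
    intro x hx
    -- If `b` approximates `T` at the coordinates of both `v` and `x`, symmetry of `T` makes `b +
    -- b⋆` act like `2T` in the real pairing of `x` with `v`, and that pairing vanishes for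
    -- self-adjoint elements.
    have key : ∀ δ > (0 : ℝ), |(⟪x, diagonalOp s T v⟫_ℂ).re| ≤ δ := by
      intro δ hδ
      let K : ℝ := ∑ i : s, (‖x i‖ + ‖v i‖) + 1
      have hK : 0 < K := by positivity
      obtain ⟨b, hb⟩ := hπ (s ∪ Finset.univ.image fun i : s => x i) T (δ / K) (by positivity)
      have hsum : (⟪x, diagonalOp s (π (b + star b)) v⟫_ℂ).re = 0 := by
        exact hx ⟨b + star b, IsSelfAdjoint.add_star_self b⟩
      have h1 : 2 * (⟪x, diagonalOp s T v⟫_ℂ).re =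
          ∑ i : s, ((⟪x i, T (v i) - π b (v i)⟫_ℂ).re + (⟪T (x i) - π b (x i), v i⟫_ℂ).re) := by
        have h2 : ∑ i : s, ((⟪x i, π b (v i)⟫_ℂ).re + (⟪π b (x i), v i⟫_ℂ).re) = 0 := by
          rw [← hsum, PiLp.inner_apply, Complex.re_sum]
          refine Finset.sum_congr rfl fun i _ => ?_
          rw [diagonalOp_apply, map_add, add_apply, inner_add_right,
            Complex.add_re, inner_rep_left]
        rw [PiLp.inner_apply, Complex.re_sum, Finset.mul_sum, ← sub_eq_zero]
        rw [← h2, ← Finset.sum_sub_distrib]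
        refine Finset.sum_congr rfl fun i _ => ?_
        simp only [diagonalOp_apply, inner_sub_left, inner_sub_right, Complex.sub_re, hT]
        ring
      have h3 : |2 * (⟪x, diagonalOp s T v⟫_ℂ).re| ≤ (δ / K) * K := by
        rw [h1]
        refine (Finset.abs_sum_le_sum_abs _ _).trans ?_
        have : ∀ i : s, |(⟪x i, T (v i) - π b (v i)⟫_ℂ).re + (⟪T (x i) - π b (x i), v i⟫_ℂ).re|
            ≤ (δ / K) * (‖x i‖ + ‖v i‖) := by
          intro i
          have e1 := hb (v i) (Finset.mem_union_left _ i.2)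
          have e2 := hb (x i) (Finset.mem_union_right _ (Finset.mem_image_of_mem _ (Finset.mem_univ i)))
          rw [norm_sub_rev] at e1 e2
          calc _ ≤ |(⟪x i, T (v i) - π b (v i)⟫_ℂ).re| + |(⟪T (x i) - π b (x i), v i⟫_ℂ).re| :=
                abs_add_le _ _
            _ ≤ ‖x i‖ * ‖T (v i) - π b (v i)‖ + ‖T (x i) - π b (x i)‖ * ‖v i‖ :=
                add_le_add ((Complex.abs_re_le_norm _).trans (norm_inner_le_norm _ _))
                  ((Complex.abs_re_le_norm _).trans (norm_inner_le_norm _ _))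
            _ ≤ ‖x i‖ * (δ / K) + (δ / K) * ‖v i‖ := by gcongr
            _ = _ := by ring
        refine (Finset.sum_le_sum fun i _ => this i).trans ?_
        rw [← Finset.mul_sum]
        gcongr
        simp [K]
      rw [div_mul_cancel₀ _ hK.ne', abs_mul, abs_two] at h3
      have := abs_nonneg ((⟪x, diagonalOp s T v⟫_ℂ).re)
      linarith
    have := le_of_forall_gt_imp_ge_of_dense fun δ hδ => key δ hδ
    exact abs_eq_zero.mp (le_antisymm this (abs_nonneg _))) hε
  refine ⟨b, b.2, fun w hw => ?_⟩
  exact lt_of_le_of_lt (PiLp.norm_apply_le (diagonalOp s (π b) v - diagonalOp s T v) ⟨w, hw⟩) hb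

end DenseRepresentations

/-! ### Kadison transitivity for one vector, with a norm bound. -/

section Transitivity

open scoped InnerProductSpace CStarAlgebra

variable {B : Type u} [NonUnitalCStarAlgebra B]
variable {H : Type u} [NormedAddCommGroup H] [InnerProductSpace ℂ H] [CompleteSpace H]

/-- The rank-two operator `⟪ζ, ·⟫ν + ⟪ν, ·⟫ζ` works, or the identity if the vectors coincide. Its
symmetry allows approximation by self-adjoint elements. -/
theorem exists_symmetric_swap {ν ζ : H} (hν : ‖ν‖ = 1) (hζ : ‖ζ‖ = 1)
    (h : ζ = ν ∨ ⟪ν, ζ⟫_ℂ = 0) :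
    ∃ T : H →L[ℂ] H, (∀ x y, ⟪T x, y⟫_ℂ = ⟪x, T y⟫_ℂ) ∧ T ν = ζ ∧ T ζ = ν := by
  rcases h with rfl | h
  · exact ⟨1, fun x y => rfl, rfl, rfl⟩
  · refine ⟨(innerSL ℂ ζ).smulRight ν + (innerSL ℂ ν).smulRight ζ, fun x y => ?_, ?_, ?_⟩
    · simp
      ring
    · simp [inner_eq_zero_symm.mp h, hν]
    · simp [h, hζ]

/-- The bounded transform `2 g (1 + g²)⁻¹` of a self-adjoint element. -/
theorem exists_bounded_transform {g : B} (hg : IsSelfAdjoint g) :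
    ∃ h : B, IsSelfAdjoint h ∧ ‖h‖ ≤ 1 ∧ h + g * (g * h) = (2 : ℝ) • g := by
  let f : ℝ → ℝ := fun t => 2 * t / (1 + t ^ 2)
  have hpos : ∀ t : ℝ, 1 + t ^ 2 ≠ 0 := fun t => by positivity
  have hf : Continuous f := by
    apply Continuous.div <;> first | fun_prop | exact hpos
  have hf0 : f 0 = 0 := by simp [f]
  refine ⟨cfcₙ f g, cfcₙ_predicate f g, ?_, ?_⟩
  · refine norm_cfcₙ_le fun x _ => ?_
    rw [Real.norm_eq_abs, abs_div, div_le_one (by positivity), abs_of_pos (by positivity : 0 < 1 + x ^ 2)]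
    rw [abs_le]
    constructor <;> nlinarith [sq_nonneg (x - 1), sq_nonneg (x + 1)]
  · have h1 : g * (g * cfcₙ f g) = cfcₙ (fun t : ℝ => t * (t * f t)) g := by
      have hid : cfcₙ (fun t : ℝ => t) g = g := cfcₙ_id' ℝ g
      rw [cfcₙ_mul (fun t : ℝ => t) (fun t => t * f t) g (by fun_prop) rfl
        (by fun_prop) (by simp), cfcₙ_mul (fun t : ℝ => t) f g (by fun_prop) rfl
        (by fun_prop) hf0, hid]
    rw [h1, ← cfcₙ_add (R := ℝ) (a := g) f (fun t : ℝ => t * (t * f t)) (by fun_prop) hf0 (by fun_prop)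
      (by simp)]
    have h2 : (2 : ℝ) • g = cfcₙ (fun t : ℝ => (2 : ℝ) • t) g := by
      rw [cfcₙ_smul (2 : ℝ) (fun t : ℝ => t) g (by fun_prop) rfl, cfcₙ_id' ℝ g]
    rw [h2]
    congr 1
    ext t
    have := hpos t
    simp only [f, smul_eq_mul]
    field_simp

/-- A weak form of Kaplansky density for two vectors exchanged by a symmetry. -/
theorem IsDenseRep.exists_contraction {π : B →⋆ₙₐ[ℂ] (H →L[ℂ] H)} (hπ : IsDenseRep π) {ν ζ : H}
    (hν : ‖ν‖ = 1) (hζ : ‖ζ‖ = 1) (h : ζ = ν ∨ ⟪ν, ζ⟫_ℂ = 0) {ε : ℝ} (hε : 0 < ε) :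
    ∃ b, IsSelfAdjoint b ∧ ‖b‖ ≤ 1 ∧ ‖π b ν - ζ‖ < ε := by
  classical
  obtain ⟨T, hT, hTν, hTζ⟩ := exists_symmetric_swap hν hζ h
  obtain ⟨g, hg, hgs⟩ := hπ.exists_isSelfAdjoint {ν, ζ} hT (half_pos hε)
  have h1 := hgs ν (by simp)
  have h2 := hgs ζ (by simp)
  rw [hTν] at h1
  rw [hTζ] at h2
  obtain ⟨b, hb, hbn, hbg⟩ := exists_bounded_transform hg
  refine ⟨b, hb, hbn, ?_⟩
  set y := π b ν - ζ with hy
  set G := π g with hG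
  set d₁ := G ν - ζ with hd₁
  set d₂ := G ζ - ν with hd₂
  have hsymm : ∀ x y, ⟪x, G y⟫_ℂ = ⟪G x, y⟫_ℂ := fun x y => by
    rw [hG, inner_rep_right, hg.star_eq]
  -- Pairing `(1 + G²)y` with `y` bounds `y` by `d₁` and `d₂` alone, although nothing is known about
  -- the norm of `G`.
  have hyG : y + G (G y) = d₁ - G d₂ := by
    have h3 : π b ν + G (G (π b ν)) = (2 : ℂ) • G ν := by
      have h4 := congrArg (fun a => π a ν) hbg
      have h5 : (2 : ℝ) • g = (2 : ℂ) • g := by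
        rw [← Complex.coe_smul]; norm_num
      simp only [h5, map_add, map_mul, map_smul] at h4
      exact h4
    rw [hy, map_sub, map_sub]
    have h6 : π b ν - ζ + (G (G (π b ν)) - G (G ζ)) =
        (π b ν + G (G (π b ν))) - ζ - G (G ζ) := by abel
    rw [h6, h3, hd₁, hd₂, map_sub, two_smul]
    abel
  have hkey : ‖y‖ ^ 2 + ‖G y‖ ^ 2 ≤ ‖y‖ * ‖d₁‖ + ‖G y‖ * ‖d₂‖ := by
    have e1 : ⟪y, y + G (G y)⟫_ℂ = ((‖y‖ ^ 2 + ‖G y‖ ^ 2 : ℝ) : ℂ) := by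
      rw [inner_add_right, hsymm, inner_self_eq_norm_sq_to_K, inner_self_eq_norm_sq_to_K]
      simp
    have e2 : ⟪y, d₁ - G d₂⟫_ℂ = ⟪y, d₁⟫_ℂ - ⟪G y, d₂⟫_ℂ := by rw [inner_sub_right, hsymm]
    rw [hyG, e2] at e1
    calc ‖y‖ ^ 2 + ‖G y‖ ^ 2 = ‖((‖y‖ ^ 2 + ‖G y‖ ^ 2 : ℝ) : ℂ)‖ := by
          rw [Complex.norm_real, Real.norm_of_nonneg (by positivity)]
      _ = ‖⟪y, d₁⟫_ℂ - ⟪G y, d₂⟫_ℂ‖ := by rw [e1]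
      _ ≤ _ := (norm_sub_le _ _).trans
          (add_le_add (norm_inner_le_norm _ _) (norm_inner_le_norm _ _))
  have h7 : ‖y‖ ^ 2 ≤ ‖d₁‖ ^ 2 + ‖d₂‖ ^ 2 := by
    nlinarith [sq_nonneg (‖y‖ - ‖d₁‖), sq_nonneg (‖G y‖ - ‖d₂‖)]
  have h8 : ‖y‖ ^ 2 < ε ^ 2 := by
    nlinarith [norm_nonneg d₁, norm_nonneg d₂]
  exact lt_of_pow_lt_pow_left₀ 2 hε.le h8

/-- One step of successive approximation. Split `ζ = αν + ζ'` with `ζ' ⊥ ν`; here `α` is real by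
hypothesis, so both terms are approached from `ν` by real multiples of self-adjoint contractions. -/
theorem IsDenseRep.exists_approx {π : B →⋆ₙₐ[ℂ] (H →L[ℂ] H)} (hπ : IsDenseRep π) {ν ζ : H}
    (hν : ‖ν‖ = 1) (hζ : (⟪ν, ζ⟫_ℂ).im = 0) :
    ∃ b, IsSelfAdjoint b ∧ ‖b‖ ≤ 3 * ‖ζ‖ ∧ ‖ζ - π b ν‖ ≤ 2⁻¹ * ‖ζ‖ := by
  by_cases h0 : ζ = 0
  · subst h0
    exact ⟨0, by simp, by simp, by simp⟩
  have hζ0 : 0 < ‖ζ‖ := norm_pos_iff.mpr h0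
  set α : ℝ := (⟪ν, ζ⟫_ℂ).re with hα
  have hαc : ⟪ν, ζ⟫_ℂ = α := Complex.ext rfl (by simpa using hζ)
  have hαn : |α| ≤ ‖ζ‖ := by
    refine (Complex.abs_re_le_norm _).trans ((norm_inner_le_norm _ _).trans ?_)
    rw [hν, one_mul]
  set ζ' : H := ζ - (α : ℂ) • ν with hζ'
  have hn' : ‖ζ'‖ ≤ 2 * ‖ζ‖ := by
    refine (norm_sub_le _ _).trans ?_
    rw [norm_smul, hν, Complex.norm_real, Real.norm_eq_abs]
    linarith
  have horth : ⟪ν, ζ'⟫_ℂ = 0 := by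
    rw [hζ', inner_sub_right, inner_smul_right, hαc, inner_self_eq_norm_sq_to_K, hν]
    simp
  -- With precision `1/6` the total error is at most `|α|/6 + ‖ζ'‖/6 ≤ ‖ζ‖/6 + 2‖ζ‖/6 = ‖ζ‖/2`.
  obtain ⟨b₁, hb₁, hn₁, he₁⟩ := hπ.exists_contraction hν hν (Or.inl rfl)
    (show (0 : ℝ) < 1 / 6 by norm_num)
  obtain ⟨b₂, hb₂, hn₂, he₂⟩ : ∃ b, IsSelfAdjoint b ∧ ‖b‖ ≤ ‖ζ'‖ ∧
      ‖π b ν - ζ'‖ ≤ ‖ζ'‖ * (1 / 6) := by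
    by_cases h1 : ζ' = 0
    · exact ⟨0, by simp, by simp, by simp [h1]⟩
    have h1' : ‖ζ'‖ ≠ 0 := norm_ne_zero_iff.mpr h1
    obtain ⟨b, hb, hbn, hbe⟩ := hπ.exists_contraction (ζ := ((‖ζ'‖⁻¹ : ℝ) : ℂ) • ζ') hν
      (by rw [norm_smul, Complex.norm_real, norm_inv, norm_norm, inv_mul_cancel₀ h1'])
      (Or.inr (by rw [inner_smul_right, horth, mul_zero])) (show (0 : ℝ) < 1 / 6 by norm_num)
    refine ⟨‖ζ'‖ • b, IsSelfAdjoint.smul (.all _) hb, ?_, ?_⟩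
    · rw [norm_smul, norm_norm]
      exact mul_le_of_le_one_right (norm_nonneg _) hbn
    · have : π (‖ζ'‖ • b) ν - ζ' = (‖ζ'‖ : ℂ) • (π b ν - ((‖ζ'‖⁻¹ : ℝ) : ℂ) • ζ') := by
        rw [← Complex.coe_smul, map_smul, smul_sub, smul_smul, ← Complex.ofReal_mul,
          mul_inv_cancel₀ h1']
        simp
      rw [this, norm_smul, Complex.norm_real, norm_norm]
      gcongr
  refine ⟨α • b₁ + b₂, (IsSelfAdjoint.smul (.all _) hb₁).add hb₂, ?_, ?_⟩
  · refine (norm_add_le _ _).trans ?_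
    rw [norm_smul, Real.norm_eq_abs]
    have := mul_le_of_le_one_right (abs_nonneg α) hn₁
    linarith
  · have h2 : ζ - π (α • b₁ + b₂) ν = -((α : ℂ) • (π b₁ ν - ν)) - (π b₂ ν - ζ') := by
      rw [map_add, ← Complex.coe_smul, map_smul, hζ', add_apply, smul_apply, smul_sub]
      abel
    rw [h2]
    refine (norm_sub_le _ _).trans ?_
    rw [norm_neg, norm_smul, Complex.norm_real, Real.norm_eq_abs]
    have h3 : |α| * ‖π b₁ ν - ν‖ ≤ ‖ζ‖ * (1 / 6) :=
      mul_le_mul hαn he₁.le (norm_nonneg _) (norm_nonneg _)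
    linarith

theorem inner_rep_self_im {π : B →⋆ₙₐ[ℂ] (H →L[ℂ] H)} {b : B} (hb : IsSelfAdjoint b) (ν : H) :
    (⟪ν, π b ν⟫_ℂ).im = 0 := by
  have h : (starRingEnd ℂ) ⟪ν, π b ν⟫_ℂ = ⟪ν, π b ν⟫_ℂ := by
    rw [inner_conj_symm, inner_rep_left, hb.star_eq]
  exact Complex.conj_eq_iff_im.mp h

/-- Kadison transitivity for one vector and self-adjoint elements, with a norm bound. -/
theorem IsDenseRep.exists_isSelfAdjoint_apply_eq {π : B →⋆ₙₐ[ℂ] (H →L[ℂ] H)} (hπ : IsDenseRep π)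
    {ν ζ : H} (hν : ν ≠ 0) (hζ : (⟪ν, ζ⟫_ℂ).im = 0) :
    ∃ b, IsSelfAdjoint b ∧ ‖b‖ ≤ 6 * (‖ζ‖ / ‖ν‖) ∧ π b ν = ζ := by
  wlog h1 : ‖ν‖ = 1 generalizing ν ζ
  · have h0 : ‖ν‖ ≠ 0 := norm_ne_zero_iff.mpr hν
    have h0' : ((‖ν‖⁻¹ : ℝ) : ℂ) ≠ 0 := by simpa using h0
    obtain ⟨b, hb, hbn, hbe⟩ := this (ν := ((‖ν‖⁻¹ : ℝ) : ℂ) • ν) (ζ := ((‖ν‖⁻¹ : ℝ) : ℂ) • ζ)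
      (smul_ne_zero h0' hν)
      (by
        rw [inner_smul_left, inner_smul_right, Complex.conj_ofReal, Complex.im_ofReal_mul,
          Complex.im_ofReal_mul, hζ, mul_zero, mul_zero])
      (by rw [norm_smul, Complex.norm_real, norm_inv, norm_norm, inv_mul_cancel₀ h0])
    refine ⟨b, hb, ?_, ?_⟩
    · rw [norm_smul, norm_smul, mul_div_mul_left _ _ (norm_ne_zero_iff.mpr h0')] at hbn
      exact hbn
    · rw [map_smul] at hbe
      exact smul_right_injective H h0' hbe
  have hstep : ∀ z : {z : H // (⟪ν, z⟫_ℂ).im = 0}, ∃ b, IsSelfAdjoint b ∧ ‖b‖ ≤ 3 * ‖z.1‖ ∧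
      ‖z.1 - π b ν‖ ≤ 2⁻¹ * ‖z.1‖ := fun z => hπ.exists_approx h1 z.2
  choose f hf hfn hfe using hstep
  -- The residuals. They keep a real inner product with `ν` because `⟪ν, π b ν⟫` is real for
  -- self-adjoint `b`. They halve at each step, so the corrections sum to norm at most `3‖ζ‖ · 2`.
  let z : ℕ → {z : H // (⟪ν, z⟫_ℂ).im = 0} := fun n => Nat.rec ⟨ζ, hζ⟩
    (fun _ z => ⟨z.1 - π (f z) ν, by
      rw [inner_sub_right, Complex.sub_im, z.2, inner_rep_self_im (hf z), sub_zero]⟩) n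
  have hz : ∀ n, (z (n + 1)).1 = (z n).1 - π (f (z n)) ν := fun n => rfl
  have hzn : ∀ n, ‖(z n).1‖ ≤ (2⁻¹ : ℝ) ^ n * ‖ζ‖ := by
    intro n
    induction n with
    | zero => simp [z]
    | succ n ih =>
      rw [hz, pow_succ']
      refine (hfe _).trans ?_
      rw [mul_assoc]
      gcongr
  have hbound : ∀ n, ‖f (z n)‖ ≤ (3 * ‖ζ‖) * (2⁻¹ : ℝ) ^ n := fun n => by
    have := hfn (z n)
    have := hzn n
    nlinarith
  have hgeo : HasSum (fun n : ℕ => (3 * ‖ζ‖) * (2⁻¹ : ℝ) ^ n) (6 * ‖ζ‖) := by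
    have := (hasSum_geometric_of_lt_one (r := (2⁻¹ : ℝ)) (by norm_num) (by norm_num)).mul_left
      (3 * ‖ζ‖)
    rwa [show (3 * ‖ζ‖) * (1 - (2 : ℝ)⁻¹)⁻¹ = 6 * ‖ζ‖ by
      rw [show (1 - (2 : ℝ)⁻¹)⁻¹ = 2 by norm_num]; ring] at this
  have hsum : Summable fun n => f (z n) := Summable.of_norm_bounded hgeo.summable hbound
  refine ⟨∑' n, f (z n), ?_, ?_, ?_⟩
  · rw [IsSelfAdjoint, tsum_star]
    exact tsum_congr fun n => hf (z n)
  · rw [h1, div_one]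
    exact tsum_of_norm_bounded hgeo hbound
  · have hcont : Continuous fun b => π b ν :=
      (ContinuousLinearMap.apply ℂ H ν).continuous.comp (map_continuous π)
    have hpart : ∀ n, π (∑ k ∈ Finset.range n, f (z k)) ν = ζ - (z n).1 := by
      intro n
      induction n with
      | zero => simp [z]
      | succ n ih => rw [Finset.sum_range_succ, map_add, add_apply, ih, hz]; abel
    have hlim := (hcont.tendsto _).comp hsum.hasSum.tendsto_sum_nat
    refine tendsto_nhds_unique hlim ?_
    have hz0 : Tendsto (fun n => (z n).1) atTop (𝓝 0) := by
      refine squeeze_zero_norm hzn ?_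
      simpa using (tendsto_pow_atTop_nhds_zero_of_lt_one (r := (2⁻¹ : ℝ)) (by norm_num)
        (by norm_num)).mul_const ‖ζ‖
    have := hz0.const_sub ζ
    rw [sub_zero] at this
    exact this.congr fun n => (hpart n).symm

end Transitivity

/-! ### Unitary paths between vectors, by Cayley transforms. -/

section UnitaryPaths

open scoped InnerProductSpace CStarAlgebra

/-- A norm-continuous path of unitaries starting at `1`. -/
structure IsUnitaryPath {C : Type*} [CStarAlgebra C] (u : unitInterval → C) : Prop where
  continuous : Continuous u
  mem_unitary : ∀ t, u t ∈ unitary C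
  map_zero : u 0 = 1

namespace IsUnitaryPath

variable {C : Type*} [CStarAlgebra C] {u v : unitInterval → C}

theorem mul (hu : IsUnitaryPath u) (hv : IsUnitaryPath v) : IsUnitaryPath fun t => u t * v t :=
  ⟨hu.continuous.mul hv.continuous, fun t => mul_mem (hu.mem_unitary t) (hv.mem_unitary t), by
    rw [hu.map_zero, hv.map_zero, one_mul]⟩

theorem map {D : Type*} [CStarAlgebra D] (f : C →⋆ₐ[ℂ] D) (hu : IsUnitaryPath u) :
    IsUnitaryPath fun t => f (u t) :=
  ⟨(map_continuous f).comp hu.continuous, fun t => Unitary.map_mem f (hu.mem_unitary t), by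
    rw [hu.map_zero, map_one]⟩

/-- The scalar path `t ↦ exp (i θ t)`. -/
theorem exp_scalar (θ : ℝ) : IsUnitaryPath fun t : unitInterval =>
    Complex.exp ((t : ℝ) * θ * Complex.I) • (1 : C) := by
  refine ⟨by fun_prop, fun t => ?_, by simp⟩
  have h : (starRingEnd ℂ) (Complex.exp ((t : ℝ) * θ * Complex.I)) *
      Complex.exp ((t : ℝ) * θ * Complex.I) = 1 := by
    rw [← Complex.exp_conj, ← Complex.exp_add]
    simp
  rw [Unitary.mem_iff]
  simp [star_smul, smul_smul, h, mul_comm _ ((starRingEnd ℂ) _)]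

end IsUnitaryPath

theorem norm_le_one_of_mem_unitary {C : Type*} [CStarAlgebra C] {w : C} (hw : w ∈ unitary C) :
    ‖w‖ ≤ 1 := by
  nontriviality C
  exact (CStarRing.norm_of_mem_unitary hw).le

theorem norm_commutator_mul_le {C : Type*} [CStarAlgebra C] {w z x : C} (hw : w ∈ unitary C)
    (hz : z ∈ unitary C) :
    ‖w * z * x - x * (w * z)‖ ≤ ‖w * x - x * w‖ + ‖z * x - x * z‖ := by
  have h : w * z * x - x * (w * z) = w * (z * x - x * z) + (w * x - x * w) * z := by noncomm_ring
  rw [h, add_comm]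
  refine (norm_add_le _ _).trans (add_le_add ?_ ?_) <;> refine (norm_mul_le _ _).trans ?_
  · exact mul_le_of_le_one_right (norm_nonneg _) (norm_le_one_of_mem_unitary hz)
  · exact mul_le_of_le_one_left (norm_nonneg _) (norm_le_one_of_mem_unitary hw)

theorem norm_commutator_le {C : Type*} [NormedRing C] (w x : C) :
    ‖w * x - x * w‖ ≤ 2 * ‖w - 1‖ * ‖x‖ := by
  have h : w * x - x * w = (w - 1) * x - x * (w - 1) := by noncomm_ring
  rw [h]
  refine (norm_sub_le _ _).trans ?_
  have h1 := norm_mul_le (w - 1) x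
  have h2 := norm_mul_le x (w - 1)
  linarith

theorem IsSelfAdjoint.isUnit_one_sub_I_smul {C : Type*} [CStarAlgebra C] {h : C}
    (hh : IsSelfAdjoint h) : IsUnit (1 - Complex.I • h) := by
  have h1 : -Complex.I ∉ spectrum ℂ h := fun hmem => by
    have := hh.im_eq_zero_of_mem_spectrum hmem
    simp at this
  rw [spectrum.notMem_iff] at h1
  have h2 : (1 : C) - Complex.I • h = Complex.I • (algebraMap ℂ C (-Complex.I) - h) := by
    rw [smul_sub, Algebra.algebraMap_eq_smul_one, smul_smul]
    simp
  rw [h2]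
  exact (h1.smul (Units.mk0 Complex.I Complex.I_ne_zero) :)

/-- The path of Cayley transforms of a self-adjoint element. -/
theorem exists_cayley_path {C : Type*} [CStarAlgebra C] {h : C} (hh : IsSelfAdjoint h) :
    ∃ u : unitInterval → C, IsUnitaryPath u ∧ (∀ t, ‖u t - 1‖ ≤ 2 * ‖h‖) ∧
      u 1 * (1 - Complex.I • h) = 1 + Complex.I • h := by
  have hsa : ∀ t : unitInterval, IsSelfAdjoint ((t : ℝ) • h) := fun t =>
    IsSelfAdjoint.smul (.all _) hh
  let a : unitInterval → C := fun t => 1 - Complex.I • ((t : ℝ) • h)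
  have ha : ∀ t, IsUnit (a t) := fun t => (hsa t).isUnit_one_sub_I_smul
  have hstar : ∀ t, star (a t) = 1 + Complex.I • ((t : ℝ) • h) := fun t => by
    simp [a, (hsa t).star_eq, star_smul]
  have hac : Continuous a := by fun_prop
  let u : unitInterval → C := fun t => star (a t) * Ring.inverse (a t)
  have hu : ∀ t, u t * a t = star (a t) := fun t => by
    simp only [u]
    rw [mul_assoc, Ring.inverse_mul_cancel _ (ha t), mul_one]
  have hcomm : ∀ t, star (a t) * a t = a t * star (a t) := fun t => by
    rw [hstar]
    simp only [a]
    generalize Complex.I • ((t : ℝ) • h) = k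
    noncomm_ring
  have hmem : ∀ t, u t ∈ unitary C := by
    intro t
    obtain ⟨x, hx⟩ := ha t
    have hux : u t = star (x : C) * ((x⁻¹ : Cˣ) : C) := by
      simp only [u]
      rw [← hx, Ring.inverse_unit]
    have hc := hcomm t
    rw [← hx] at hc
    have e1 : star ((x⁻¹ : Cˣ) : C) * star (x : C) = 1 := by
      rw [← star_mul, Units.mul_inv, star_one]
    have e2 : star (x : C) * star ((x⁻¹ : Cˣ) : C) = 1 := by
      rw [← star_mul, Units.inv_mul, star_one]
    have e3 : ((x⁻¹ : Cˣ) : C) * star (x : C) = star (x : C) * ((x⁻¹ : Cˣ) : C) := by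
      rw [Units.inv_mul_eq_iff_eq_mul, ← mul_assoc, ← hc, mul_assoc, Units.mul_inv, mul_one]
    rw [Unitary.mem_iff, hux]
    constructor
    · rw [star_mul, star_star, mul_assoc, ← mul_assoc (x : C), ← hc, mul_assoc, Units.mul_inv,
        mul_one, e1]
    · rw [star_mul, star_star, ← e3, mul_assoc, ← mul_assoc (star _), e2, one_mul, Units.inv_mul]
  refine ⟨u, ⟨?_, hmem, ?_⟩, fun t => ?_, ?_⟩
  · refine (continuous_star.comp hac).mul ?_
    rw [continuous_iff_continuousAt]
    intro t
    obtain ⟨x, hx⟩ := ha t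
    have := NormedRing.inverse_continuousAt x
    rw [hx] at this
    exact this.comp hac.continuousAt
  · simp [u, a]
  · have h1 : u t - 1 = (2 * Complex.I) • (((t : ℝ) • h) * Ring.inverse (a t)) := by
      have : u t - 1 = (star (a t) - a t) * Ring.inverse (a t) := by
        rw [sub_mul, Ring.mul_inverse_cancel _ (ha t)]
      rw [this, hstar, ← smul_mul_assoc]
      congr 1
      simp only [a]
      rw [mul_smul, two_smul]
      abel
    -- As `u t` is unitary, this bounds the inverse by `1`, and the formula for `u t - 1` then gives
    -- `2‖h‖`.
    have h2 : (2 : ℂ) • Ring.inverse (a t) = u t + 1 := by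
      have : u t + 1 = (star (a t) + a t) * Ring.inverse (a t) := by
        rw [add_mul, Ring.mul_inverse_cancel _ (ha t)]
      rw [this, hstar]
      simp only [a]
      rw [add_add_sub_cancel, ← two_smul ℂ (1 : C), smul_mul_assoc, one_mul]
    have h3 : ‖Ring.inverse (a t)‖ ≤ 1 := by
      have e1 : ‖u t + 1‖ ≤ 2 := (norm_add_le _ _).trans (by
        have := norm_le_one_of_mem_unitary (hmem t)
        have := norm_le_one_of_mem_unitary (one_mem (unitary C))
        linarith)
      rw [← h2, norm_smul] at e1
      norm_num at e1
      linarith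
    rw [h1, norm_smul]
    have h4 : ‖((t : ℝ) • h) * Ring.inverse (a t)‖ ≤ ‖h‖ := by
      refine (norm_mul_le _ _).trans (mul_le_of_le_one_right (norm_nonneg _) h3 |>.trans ?_)
      rw [norm_smul]
      refine mul_le_of_le_one_left (norm_nonneg _) ?_
      rw [Real.norm_of_nonneg t.2.1]
      exact t.2.2
    have h5 : ‖(2 * Complex.I : ℂ)‖ = 2 := by simp
    rw [h5]
    gcongr
  · have := hu 1
    rw [hstar] at this
    simpa [a] using this

variable {B : Type u} [NonUnitalCStarAlgebra B]
variable {H : Type u} [NormedAddCommGroup H] [InnerProductSpace ℂ H] [CompleteSpace H]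

/-- The extension of a representation to the unitization. -/
noncomputable abbrev unitizationRep (π : B →⋆ₙₐ[ℂ] (H →L[ℂ] H)) :
    Unitization ℂ B →⋆ₐ[ℂ] (H →L[ℂ] H) :=
  Unitization.starLift π

theorem unitizationRep_inr (π : B →⋆ₙₐ[ℂ] (H →L[ℂ] H)) (b : B) :
    unitizationRep π (b : Unitization ℂ B) = π b := by
  exact DFunLike.congr_fun (Unitization.starLift.symm_apply_apply π) b

/-- Two unit vectors that are not opposite are joined by a path of unitaries that is controlled by
their distance. -/
theorem IsDenseRep.exists_path_of_ne_neg {π : B →⋆ₙₐ[ℂ] (H →L[ℂ] H)} (hπ : IsDenseRep π) {ξ η : H}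
    (hξ : ‖ξ‖ = 1) (hη : ‖η‖ = 1) (hne : ξ + η ≠ 0) :
    ∃ u : unitInterval → Unitization ℂ B, IsUnitaryPath u ∧ unitizationRep π (u 1) ξ = η ∧
      ∀ t, ‖u t - 1‖ ≤ 12 * (‖ξ - η‖ / ‖ξ + η‖) := by
  -- If `bν = ζ`, then `(1 - ib)ν = ξ` and `(1 + ib)ν = η`, so the Cayley transform of `b` sends `ξ`
  -- to `η`. The inner product `⟪ν, ζ⟫` is real because `ξ` and `η` have equal norms.
  let ν : H := (2⁻¹ : ℂ) • (ξ + η)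
  let ζ : H := (-(2⁻¹ : ℂ) * Complex.I) • (η - ξ)
  have hν : ν ≠ 0 := smul_ne_zero (by norm_num) hne
  have him : (⟪ν, ζ⟫_ℂ).im = 0 := by
    have h1 : ⟪ν, ζ⟫_ℂ = (-(1 / 4) * Complex.I) * (⟪ξ, η⟫_ℂ - ⟪η, ξ⟫_ℂ) := by
      simp only [ν, ζ, inner_smul_left, inner_smul_right, inner_add_left, inner_sub_right,
        inner_self_eq_norm_sq_to_K, hξ, hη]
      simp [map_ofNat]
      ring
    have h2 : (⟪ξ, η⟫_ℂ).re = (⟪η, ξ⟫_ℂ).re := inner_re_symm (𝕜 := ℂ) ξ η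
    rw [h1]
    simp [h2]
  obtain ⟨b, hb, hbn, hbe⟩ := hπ.exists_isSelfAdjoint_apply_eq hν him
  obtain ⟨u, hu, hun, hu1⟩ := exists_cayley_path (C := Unitization ℂ B) (h := (b : Unitization ℂ B))
    (by rw [IsSelfAdjoint, ← Unitization.inr_star, hb.star_eq])
  refine ⟨u, hu, ?_, fun t => (hun t).trans ?_⟩
  · have h2 := congrArg (fun z => unitizationRep π z ν) hu1
    simp only [map_mul, map_sub, map_add, map_one, map_smul, unitizationRep_inr] at h2
    have hIζ : Complex.I • ζ = (2⁻¹ : ℂ) • (η - ξ) := by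
      simp only [ζ, smul_smul]
      congr 1
      linear_combination (-(2⁻¹ : ℂ)) * Complex.I_mul_I
    have h3 : (1 - Complex.I • π b) ν = ξ := by
      simp only [sub_apply, one_apply_eq_self, smul_apply, hbe, hIζ]
      simp only [ν]
      module
    have h4 : (1 + Complex.I • π b) ν = η := by
      simp only [add_apply, one_apply_eq_self, smul_apply, hbe, hIζ]
      simp only [ν]
      module
    rw [h4] at h2
    rw [← h2]
    conv_lhs => rw [← h3]
    rfl
  · rw [Unitization.norm_inr]
    have h5 : ‖ζ‖ / ‖ν‖ = ‖ξ - η‖ / ‖ξ + η‖ := by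
      simp only [ζ, ν, norm_smul]
      rw [norm_sub_rev η ξ, mul_div_mul_comm]
      simp
    rw [h5] at hbn
    linarith

/-- Any two unit vectors are joined by a path of unitaries. -/
theorem IsDenseRep.exists_path {π : B →⋆ₙₐ[ℂ] (H →L[ℂ] H)} (hπ : IsDenseRep π) {ξ η : H}
    (hξ : ‖ξ‖ = 1) (hη : ‖η‖ = 1) :
    ∃ u : unitInterval → Unitization ℂ B, IsUnitaryPath u ∧ unitizationRep π (u 1) ξ = η := by
  by_cases hne : ξ + η = 0
  -- For opposite vectors the midpoint vanishes; a scalar path from `1` to `-1` replaces the Cayley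
  -- path.
  · refine ⟨_, IsUnitaryPath.exp_scalar Real.pi, ?_⟩
    rw [eq_neg_of_add_eq_zero_right hne]
    simp
  · obtain ⟨u, hu, hu1, -⟩ := hπ.exists_path_of_ne_neg hξ hη hne
    exact ⟨u, hu, hu1⟩

/-- Close unit vectors are joined by a path of unitaries near `1`. -/
theorem IsDenseRep.exists_path_of_norm_sub_le {π : B →⋆ₙₐ[ℂ] (H →L[ℂ] H)} (hπ : IsDenseRep π)
    {ξ η : H} (hξ : ‖ξ‖ = 1) (hη : ‖η‖ = 1) (hd : ‖ξ - η‖ ≤ 1) :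
    ∃ u : unitInterval → Unitization ℂ B, IsUnitaryPath u ∧ unitizationRep π (u 1) ξ = η ∧
      ∀ t, ‖u t - 1‖ ≤ 12 * ‖ξ - η‖ := by
  have h1 : 1 ≤ ‖ξ + η‖ := by
    have h2 : (2 : ℂ) • ξ = (ξ + η) + (ξ - η) := by module
    have h3 : ‖(2 : ℂ) • ξ‖ = 2 := by rw [norm_smul, hξ]; norm_num
    have h4 := norm_add_le (ξ + η) (ξ - η)
    rw [← h2, h3] at h4
    linarith
  obtain ⟨u, hu, hu1, hun⟩ := hπ.exists_path_of_ne_neg hξ hη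
    (norm_pos_iff.mp (lt_of_lt_of_le one_pos h1))
  refine ⟨u, hu, hu1, fun t => (hun t).trans ?_⟩
  gcongr
  exact div_le_self (norm_nonneg _) h1

end UnitaryPaths

/-! ### Pure states have dense cyclic representations. -/

section VectorStates

open scoped InnerProductSpace CStarAlgebra ComplexOrder

variable {B : Type u} [NonUnitalCStarAlgebra B]
variable {H : Type u} [NormedAddCommGroup H] [InnerProductSpace ℂ H] [CompleteSpace H]

/-- The functional `b ↦ ⟪ξ, π b ξ⟫`. -/
noncomputable def vectorFunctional (π : B →⋆ₙₐ[ℂ] (H →L[ℂ] H)) (ξ : H) : B →L[ℂ] ℂ :=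
  LinearMap.mkContinuous
    { toFun := fun b => ⟪ξ, π b ξ⟫_ℂ
      map_add' := fun a b => by rw [map_add, add_apply, inner_add_right]
      map_smul' := fun c b => by rw [map_smul, smul_apply, inner_smul_right]; rfl } (‖ξ‖ ^ 2)
    fun b => by
      refine (norm_inner_le_norm _ _).trans ?_
      have h1 := (π b).le_of_opNorm_le (NonUnitalStarAlgHom.norm_apply_le π b) ξ
      calc ‖ξ‖ * ‖π b ξ‖ ≤ ‖ξ‖ * (‖b‖ * ‖ξ‖) := by gcongr
        _ = ‖ξ‖ ^ 2 * ‖b‖ := by ring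

@[simp]
theorem vectorFunctional_apply (π : B →⋆ₙₐ[ℂ] (H →L[ℂ] H)) (ξ : H) (b : B) :
    vectorFunctional π ξ b = ⟪ξ, π b ξ⟫_ℂ := rfl

theorem norm_vectorFunctional_le (π : B →⋆ₙₐ[ℂ] (H →L[ℂ] H)) (ξ : H) :
    ‖vectorFunctional π ξ‖ ≤ ‖ξ‖ ^ 2 :=
  LinearMap.mkContinuous_norm_le _ (by positivity) _

theorem inner_rep_star_mul_self (π : B →⋆ₙₐ[ℂ] (H →L[ℂ] H)) (ξ : H) (b : B) :
    ⟪ξ, π (star b * b) ξ⟫_ℂ = ((‖π b ξ‖ ^ 2 : ℝ) : ℂ) := by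
  rw [map_mul, FunLike.coe_mul_eq_comp, Function.comp_apply, ← inner_rep_left, inner_self_eq_norm_sq_to_K]
  simp

theorem vectorFunctional_nonneg (π : B →⋆ₙₐ[ℂ] (H →L[ℂ] H)) (ξ : H) (b : B) :
    0 ≤ vectorFunctional π ξ (star b * b) := by
  rw [vectorFunctional_apply, inner_rep_star_mul_self]
  exact Complex.zero_le_real.mpr (sq_nonneg _)

/-- A self-adjoint element is an affine function of the square of an element of its bicommutant. -/
theorem IsSelfAdjoint.exists_square_decomposition {C : Type*} [CStarAlgebra C] {S : C}
    (hS : IsSelfAdjoint S) : ∃ (R Q : C) (n : ℝ), IsSelfAdjoint R ∧ IsSelfAdjoint Q ∧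
      R * R + Q * Q = 1 ∧ S = n • (R * R - Q * Q) ∧
      ∀ x, Commute S x → Commute R x ∧ Commute Q x := by
  set n : ℝ := ‖S‖ + 1 with hn
  have hn0 : 0 < n := by positivity
  have hspec : ∀ t ∈ spectrum ℝ S, |t| ≤ n := by
    intro t ht
    rcases subsingleton_or_nontrivial C with hC | hC
    · simp [spectrum.of_subsingleton] at ht
    have := spectrum.norm_le_norm_of_mem ht
    rw [Real.norm_eq_abs] at this
    linarith
  -- On `[-n, n]`, which contains the spectrum, `f² + g² = 1` and `n(f² - g²) = t`.
  let f : ℝ → ℝ := fun t => √((n + t) / (2 * n))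
  let g : ℝ → ℝ := fun t => √((n - t) / (2 * n))
  have hf : Continuous f := by fun_prop
  have hg : Continuous g := by fun_prop
  have hff : cfc f S * cfc f S = cfc (fun t => (n + t) / (2 * n)) S := by
    rw [← cfc_mul f f S]
    refine cfc_congr fun t ht => Real.mul_self_sqrt (div_nonneg ?_ (by positivity))
    linarith [neg_le_of_abs_le (hspec t ht)]
  have hgg : cfc g S * cfc g S = cfc (fun t => (n - t) / (2 * n)) S := by
    rw [← cfc_mul g g S]
    refine cfc_congr fun t ht => Real.mul_self_sqrt (div_nonneg ?_ (by positivity))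
    linarith [le_of_abs_le (hspec t ht)]
  refine ⟨cfc f S, cfc g S, n, cfc_predicate f S, cfc_predicate g S, ?_, ?_, fun x hx =>
    ⟨hx.cfc_real f, hx.cfc_real g⟩⟩
  · rw [hff, hgg, ← cfc_add (a := S) (fun t => (n + t) / (2 * n)) (fun t => (n - t) / (2 * n))
      (by fun_prop) (by fun_prop), ← cfc_const_one ℝ S]
    congr 1
    ext t
    field_simp
    ring
  · rw [hff, hgg, ← cfc_sub (a := S) (fun t => (n + t) / (2 * n)) (fun t => (n - t) / (2 * n))
      (by fun_prop) (by fun_prop), ← cfc_smul n _ S (by fun_prop)]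
    conv_lhs => rw [← cfc_id' ℝ S]
    congr 1
    ext t
    simp only [smul_eq_mul]
    field_simp
    ring

/-- A representation with a cyclic vector inducing a pure state is dense. -/
theorem isDenseRep_of_pure {π : B →⋆ₙₐ[ℂ] (H →L[ℂ] H)} {ξ : H} (hξ : ‖ξ‖ = 1)
    (hcyc : DenseRange fun b => π b ξ) (hpure : vectorFunctional π ξ ∈ pureStateSet B) :
    IsDenseRep π := by
  have hext : ∀ S T : H →L[ℂ] H, (∀ b, S ∘L π b = π b ∘L S) → (∀ b, T ∘L π b = π b ∘L T) →
      S ξ = T ξ → S = T := by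
    intro S T hS hT h
    ext x
    refine hcyc.induction_on x (isClosed_eq S.continuous T.continuous) fun b => ?_
    have h1 := congrArg (fun L => L ξ) (hS b)
    have h2 := congrArg (fun L => L ξ) (hT b)
    simp only [ContinuousLinearMap.comp_apply] at h1 h2
    rw [h1, h2, h]
  have hscal : ∀ (c : ℂ) (b : B), (c • (1 : H →L[ℂ] H)) ∘L π b = π b ∘L (c • (1 : H →L[ℂ] H)) := by
    intro c b
    ext x
    simp
  have hsa : ∀ S : H →L[ℂ] H, IsSelfAdjoint S → (∀ b, S ∘L π b = π b ∘L S) →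
      ∃ c : ℂ, S = c • (1 : H →L[ℂ] H) := by
    intro S hS hcomm
    obtain ⟨R, Q, n, hR, hQ, hRQ, hSn, hbi⟩ := hS.exists_square_decomposition
    have hRc : ∀ b, R * π b = π b * R := fun b => (hbi (π b) (hcomm b)).1
    have hQc : ∀ b, Q * π b = π b * Q := fun b => (hbi (π b) (hcomm b)).2
    suffices h : ∃ c : ℂ, (R * R : H →L[ℂ] H) = c • (1 : H →L[ℂ] H) by
      obtain ⟨c, hc⟩ := h
      refine ⟨n * (2 * c - 1), ?_⟩
      rw [hSn, eq_sub_of_add_eq' hRQ, hc, ← Complex.coe_smul]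
      module
    have hR2 : ∀ b, (R * R) ∘L π b = π b ∘L (R * R) := fun b => by
      change R * R * π b = π b * (R * R)
      rw [mul_assoc, hRc, ← mul_assoc, hRc, mul_assoc]
    have hQ2 : ∀ b, (Q * Q) ∘L π b = π b ∘L (Q * Q) := fun b => by
      change Q * Q * π b = π b * (Q * Q)
      rw [mul_assoc, hQc, ← mul_assoc, hQc, mul_assoc]
    have hsymm : ∀ {X : H →L[ℂ] H}, IsSelfAdjoint X → ∀ x y, ⟪X x, y⟫_ℂ = ⟪x, X y⟫_ℂ := by
      intro X hX x y
      conv_lhs => rw [← hX.star_eq]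
      rw [ContinuousLinearMap.star_eq_adjoint, ContinuousLinearMap.adjoint_inner_left]
    have hvec : ∀ {X : H →L[ℂ] H}, IsSelfAdjoint X → (∀ b, X * π b = π b * X) → ∀ b,
        ⟪X ξ, π b (X ξ)⟫_ℂ = ⟪ξ, (X * X) (π b ξ)⟫_ℂ := by
      intro X hX hXc b
      have h1 : π b (X ξ) = X (π b ξ) := (congrArg (fun L => L ξ) (hXc b)).symm
      rw [h1, hsymm hX]
      rfl
    -- `R` and `Q` lie in the commutant and `R² + Q² = 1`, so the pure state splits into two
    -- positive functionals.
    have hsum : vectorFunctional π ξ = vectorFunctional π (R ξ) + vectorFunctional π (Q ξ) := by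
      ext b
      rw [add_apply, vectorFunctional_apply, vectorFunctional_apply,
        vectorFunctional_apply, hvec hR hRc, hvec hQ hQc, ← inner_add_right, ← add_apply, hRQ]
      rfl
    have hnorm : ‖R ξ‖ ^ 2 + ‖Q ξ‖ ^ 2 = 1 := by
      have h1 : ⟪ξ, (R * R + Q * Q) ξ⟫_ℂ = ((‖R ξ‖ ^ 2 + ‖Q ξ‖ ^ 2 : ℝ) : ℂ) := by
        have h2 : (R * R + Q * Q) ξ = R (R ξ) + Q (Q ξ) := rfl
        rw [h2, inner_add_right, ← hsymm hR, ← hsymm hQ, inner_self_eq_norm_sq_to_K,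
          inner_self_eq_norm_sq_to_K]
        simp
      rw [hRQ, one_apply_eq_self, inner_self_eq_norm_sq_to_K, hξ] at h1
      refine Complex.ofReal_injective ?_
      rw [← h1]
      simp
    by_cases hR0 : R ξ = 0
    · refine ⟨0, hext _ _ hR2 (hscal 0) ?_⟩
      change R (R ξ) = _
      simp [hR0]
    by_cases hQ0 : Q ξ = 0
    · refine ⟨1, hext _ _ hR2 (hscal 1) ?_⟩
      rw [eq_sub_of_add_eq hRQ]
      change ξ - Q (Q ξ) = _
      simp [hQ0]
    have hRp : 0 < ‖R ξ‖ ^ 2 := by positivity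
    have hQp : 0 < ‖Q ξ‖ ^ 2 := by positivity
    -- The two norms sum to at least `1`, and they are bounded by `‖Rξ‖²` and `‖Qξ‖²`, which sum to
    -- `1`. Both bounds are therefore attained, and the normalised functionals are states without
    -- any appeal to a unit.
    have hle : ‖vectorFunctional π ξ‖ ≤ ‖vectorFunctional π (R ξ)‖ + ‖vectorFunctional π (Q ξ)‖ := by
      rw [hsum]; exact norm_add_le _ _
    have h1 : ‖vectorFunctional π ξ‖ = 1 := hpure.1.2
    have hle1 := norm_vectorFunctional_le π (R ξ)
    have hle2 := norm_vectorFunctional_le π (Q ξ)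
    have hstate : ∀ {x : H}, 0 < ‖x‖ ^ 2 → ‖vectorFunctional π x‖ = ‖x‖ ^ 2 →
        (‖x‖ ^ 2)⁻¹ • vectorFunctional π x ∈ stateSet B := by
      intro x hx hxn
      refine ⟨fun a => ?_, ?_⟩
      · rw [smul_apply]
        exact smul_nonneg (inv_nonneg.mpr hx.le) (vectorFunctional_nonneg π x a)
      · rw [norm_smul, hxn, Real.norm_of_nonneg (inv_nonneg.mpr hx.le), inv_mul_cancel₀ hx.ne']
    have heq := (mem_extremePoints.mp hpure).2 _ (hstate hRp (by linarith)) _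
      (hstate hQp (by linarith)) ⟨‖R ξ‖ ^ 2, ‖Q ξ‖ ^ 2, hRp, hQp, hnorm, by
        rw [smul_smul, smul_smul, mul_inv_cancel₀ hRp.ne', mul_inv_cancel₀ hQp.ne', one_smul,
          one_smul, ← hsum]⟩
    refine ⟨((‖R ξ‖ ^ 2 : ℝ) : ℂ), hext _ _ hR2 (hscal _) ?_⟩
    have h3 : ∀ b, ⟪(R * R) ξ - ((‖R ξ‖ ^ 2 : ℝ) : ℂ) • ξ, π b ξ⟫_ℂ = 0 := by
      intro b
      have h4 := congrArg (fun f => f b) heq.1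
      simp only [smul_apply, vectorFunctional_apply] at h4
      rw [hvec hR hRc, inv_smul_eq_iff₀ hRp.ne'] at h4
      have h5 : ⟪(R * R) ξ, π b ξ⟫_ℂ = ⟪ξ, (R * R) (π b ξ)⟫_ℂ := by
        change ⟪R (R ξ), π b ξ⟫_ℂ = ⟪ξ, R (R (π b ξ))⟫_ℂ
        rw [hsymm hR, hsymm hR]
      rw [inner_sub_left, h5, h4, inner_smul_left, Complex.conj_ofReal, Complex.real_smul, sub_self]
    have h6 : (R * R) ξ - ((‖R ξ‖ ^ 2 : ℝ) : ℂ) • ξ = 0 := by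
      refine hcyc.eq_zero_of_inner_left ℂ ?_
      exact h3
    rw [sub_eq_zero.mp h6]
    rfl
  refine isDenseRep_of_commutant (fun T hT => ?_) fun v hv => ?_
  · have hT' : ∀ b, star T ∘L π b = π b ∘L star T := by
      intro b
      have h := congrArg star (hT (star b))
      change star (T * π (star b)) = star (π (star b) * T) at h
      rw [star_mul, star_mul, ← map_star, star_star] at h
      exact h.symm
    obtain ⟨c, hc⟩ := hsa (T + star T) (IsSelfAdjoint.add_star_self T) fun b => by
      rw [ContinuousLinearMap.add_comp, ContinuousLinearMap.comp_add, hT, hT']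
    obtain ⟨d, hd⟩ := hsa (Complex.I • (T - star T)) (by
      rw [IsSelfAdjoint, star_smul, star_sub, star_star, ← neg_sub T, smul_neg, ← neg_smul]
      simp) fun b => by
      rw [ContinuousLinearMap.smul_comp, ContinuousLinearMap.comp_smul, ContinuousLinearMap.sub_comp,
        ContinuousLinearMap.comp_sub, hT, hT']
    refine ⟨2⁻¹ * (c - Complex.I * d), fun v => ?_⟩
    have h1 : T = (2⁻¹ : ℂ) • ((T + star T) - Complex.I • (Complex.I • (T - star T))) := by
      rw [smul_smul, Complex.I_mul_I]
      module
    rw [h1, hc, hd]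
    simp only [sub_apply, smul_apply, one_apply_eq_self]
    module
  · refine hcyc.eq_zero_of_inner_left ℂ ?_
    intro b
    change ⟪v, π b ξ⟫_ℂ = 0
    rw [inner_rep_right, hv, inner_zero_left]

end VectorStates

/-! ### GNS vectors, purity, phases and equivalence of vector states. -/

section GNSVectors

open scoped InnerProductSpace CStarAlgebra ComplexOrder

variable {B : Type u} [NonUnitalCStarAlgebra B]

section Ordered

variable [PartialOrder B] [StarOrderedRing B]

theorem norm_state_star_mul_le (ω : stateSet B) (a b : B) :
    ‖ω.1 (star a * b)‖ ≤ ‖(stateToPositive ω).toPreGNS a‖ * ‖(stateToPositive ω).toPreGNS b‖ :=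
  norm_inner_le_norm (𝕜 := ℂ) ((stateToPositive ω).toPreGNS a) ((stateToPositive ω).toPreGNS b)

theorem norm_toPreGNS_sq (ω : stateSet B) (a : B) :
    ((‖(stateToPositive ω).toPreGNS a‖ ^ 2 : ℝ) : ℂ) = ω.1 (star a * a) := by
  rw [Complex.ofReal_pow, PositiveLinearMap.preGNS_norm_sq]
  rfl

theorem norm_toPreGNS_le (ω : stateSet B) (a : B) :
    ‖(stateToPositive ω).toPreGNS a‖ ≤ ‖a‖ := by
  have h := norm_toPreGNS_sq ω a
  have h1 : ‖(stateToPositive ω).toPreGNS a‖ ^ 2 ≤ ‖a‖ ^ 2 := by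
    calc ‖(stateToPositive ω).toPreGNS a‖ ^ 2
        = ‖((‖(stateToPositive ω).toPreGNS a‖ ^ 2 : ℝ) : ℂ)‖ := by
          rw [Complex.norm_real, Real.norm_of_nonneg (by positivity)]
      _ = ‖ω.1 (star a * a)‖ := by rw [h]
      _ ≤ ‖ω.1‖ * ‖star a * a‖ := ω.1.le_opNorm _
      _ = ‖a‖ ^ 2 := by rw [ω.2.2, one_mul, CStarRing.norm_star_mul_self, sq]
  exact (sq_le_sq₀ (norm_nonneg _) (norm_nonneg _)).mp h1

/-- The Cauchy–Schwarz inequality against the (approximate) unit. -/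
theorem norm_state_le (ω : stateSet B) (b : B) :
    ‖ω.1 b‖ ≤ ‖(stateToPositive ω).toPreGNS b‖ := by
  have hu := CStarAlgebra.increasingApproximateUnit B
  have hlim : Tendsto (fun e => ‖ω.1 (e * b)‖) (CStarAlgebra.approximateUnit B) (𝓝 ‖ω.1 b‖) :=
    ((ω.1.continuous.tendsto b).comp (hu.tendsto_mul_right b)).norm
  refine le_of_tendsto hlim ?_
  filter_upwards [hu.eventually_star_eq, hu.eventually_norm] with e he hn
  have h := norm_state_star_mul_le ω e b
  rw [he] at h
  refine h.trans (mul_le_of_le_one_left (norm_nonneg _) ((norm_toPreGNS_le ω e).trans hn))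

/-- The GNS space of a state contains a cyclic unit vector inducing the state. -/
theorem exists_gns_vector (ω : stateSet B) :
    ∃ ξ : (stateToPositive ω).GNS, ‖ξ‖ = 1 ∧
      vectorFunctional (stateToPositive ω).gnsNonUnitalStarAlgHom ξ = ω.1 ∧
      DenseRange fun b => (stateToPositive ω).gnsNonUnitalStarAlgHom b ξ := by
  set f := stateToPositive ω with hf
  let e : B →ₗ[ℂ] f.GNS := (UniformSpace.Completion.toComplL : f.PreGNS →L[ℂ] f.GNS).toLinearMap ∘ₗ
    f.toPreGNS.toLinearMap
  have he : ∀ b, e b = ((f.toPreGNS b : f.PreGNS) : f.GNS) := fun b => rfl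
  have hed : DenseRange e := UniformSpace.Completion.denseRange_coe.comp
    f.toPreGNS.surjective.denseRange (UniformSpace.Completion.continuous_coe _)
  have hnorm : ∀ b, ‖(ω.1 : B →ₗ[ℂ] ℂ) b‖ ≤ 1 * ‖e b‖ := fun b => by
    rw [one_mul, he, UniformSpace.Completion.norm_coe]
    exact norm_state_le ω b
  -- `B` may have no unit whose class could serve as cyclic vector. By `norm_state_le` the state is
  -- bounded in the GNS norm, and the Riesz vector of its extension is used instead.
  let ℓ : f.GNS →L[ℂ] ℂ := (ω.1 : B →ₗ[ℂ] ℂ).extendOfNorm e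
  have hℓ : ∀ b, ℓ (e b) = ω.1 b := fun b => LinearMap.extendOfNorm_eq hed ⟨1, hnorm⟩ b
  have hℓn : ‖ℓ‖ ≤ 1 := LinearMap.opNorm_extendOfNorm_le hed zero_le_one hnorm
  let ξ : f.GNS := (InnerProductSpace.toDual ℂ f.GNS).symm ℓ
  have hξ : ∀ x, ⟪ξ, x⟫_ℂ = ℓ x := fun x => InnerProductSpace.toDual_symm_apply
  have hπe : ∀ b c, f.gnsNonUnitalStarAlgHom b (e c) = e (b * c) := fun b c => by
    rw [he, PositiveLinearMap.gnsNonUnitalStarAlgHom_apply_coe]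
    rfl
  have hee : ∀ b c, ⟪e b, e c⟫_ℂ = ω.1 (star b * c) := fun b c => by
    rw [he, he, UniformSpace.Completion.inner_coe]
    rfl
  have hπξ : ∀ b, f.gnsNonUnitalStarAlgHom b ξ = e b := fun b => by
    refine hed.eq_of_inner_left ℂ fun c => ?_
    rw [inner_rep_left, hπe, hξ, hℓ, hee]
  have hfun : vectorFunctional f.gnsNonUnitalStarAlgHom ξ = ω.1 := by
    ext b
    rw [vectorFunctional_apply, hπξ, hξ, hℓ]
  refine ⟨ξ, le_antisymm ?_ ?_, hfun, ?_⟩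
  · rw [LinearIsometryEquiv.norm_map]
    exact hℓn
  · have h := norm_vectorFunctional_le f.gnsNonUnitalStarAlgHom ξ
    rw [hfun, ω.2.2] at h
    exact (one_le_sq_iff₀ (norm_nonneg _)).mp h
  · simpa only [hπξ] using hed

end Ordered

/-- The Cauchy–Schwarz inequality for states. -/
theorem norm_state_sq_le {φ : B →L[ℂ] ℂ} (hφ : φ ∈ stateSet B) (b : B) :
    ‖φ b‖ ^ 2 ≤ ‖φ (star b * b)‖ := by
  let _ : PartialOrder B := CStarAlgebra.spectralOrder B
  have _ : StarOrderedRing B := CStarAlgebra.spectralOrderedRing B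
  have h := norm_state_le ⟨φ, hφ⟩ b
  have h1 := norm_toPreGNS_sq ⟨φ, hφ⟩ b
  simp only at h h1
  rw [← h1, Complex.norm_real, Real.norm_of_nonneg (by positivity)]
  gcongr

/-- States are hermitian. -/
theorem state_star {φ : B →L[ℂ] ℂ} (hφ : φ ∈ stateSet B) (b : B) :
    φ (star b) = (starRingEnd ℂ) (φ b) := by
  let _ : PartialOrder B := CStarAlgebra.spectralOrder B
  have _ : StarOrderedRing B := CStarAlgebra.spectralOrderedRing B
  exact map_star (stateToPositive ⟨φ, hφ⟩) b

variable {H : Type u} [NormedAddCommGroup H] [InnerProductSpace ℂ H] [CompleteSpace H]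

/-- Unit vectors of a dense representation induce states. -/
theorem IsDenseRep.vectorFunctional_mem_stateSet {π : B →⋆ₙₐ[ℂ] (H →L[ℂ] H)} (hπ : IsDenseRep π)
    {ξ : H} (hξ : ‖ξ‖ = 1) : vectorFunctional π ξ ∈ stateSet B := by
  refine ⟨vectorFunctional_nonneg π ξ, le_antisymm ?_ ?_⟩
  · simpa [hξ] using norm_vectorFunctional_le π ξ
  · refine le_of_forall_pos_sub_le fun ε hε => ?_
    obtain ⟨b, -, hbn, hb⟩ := hπ.exists_contraction hξ hξ (Or.inl rfl) hε
    have h1 : ‖vectorFunctional π ξ b‖ ≤ ‖vectorFunctional π ξ‖ :=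
      ((vectorFunctional π ξ).le_opNorm b).trans (mul_le_of_le_one_right (norm_nonneg _) hbn)
    have h2 : (1 : ℂ) = ⟪ξ, π b ξ⟫_ℂ - ⟪ξ, π b ξ - ξ⟫_ℂ := by
      rw [inner_sub_right, inner_self_eq_norm_sq_to_K, hξ]
      simp
    have h3 : (1 : ℝ) ≤ ‖⟪ξ, π b ξ⟫_ℂ‖ + ‖⟪ξ, π b ξ - ξ⟫_ℂ‖ := by
      have := norm_sub_le ⟪ξ, π b ξ⟫_ℂ ⟪ξ, π b ξ - ξ⟫_ℂ
      rw [← h2] at this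
      simpa using this
    have h4 : ‖⟪ξ, π b ξ - ξ⟫_ℂ‖ ≤ ‖ξ‖ * ‖π b ξ - ξ‖ := norm_inner_le_norm _ _
    rw [hξ, one_mul] at h4
    rw [vectorFunctional_apply] at h1
    linarith

/-- A state dominated by a vector state of a dense representation equals it. -/
theorem IsDenseRep.eq_vectorFunctional_of_bound {π : B →⋆ₙₐ[ℂ] (H →L[ℂ] H)} (hπ : IsDenseRep π)
    {ξ : H} (hξ : ‖ξ‖ = 1) {φ : B →L[ℂ] ℂ} (hφ : φ ∈ stateSet B) {C : ℝ}
    (hC : ∀ b, ‖φ b‖ ≤ C * ‖π b ξ‖) : φ = vectorFunctional π ξ := by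
  classical
  have hC0 : 0 ≤ C := by
    by_contra! h
    have h1 : φ = 0 := by
      ext b
      have := hC b
      have h2 := mul_nonpos_of_nonpos_of_nonneg h.le (norm_nonneg (π b ξ))
      exact norm_le_zero_iff.mp (this.trans h2)
    have := hφ.2
    rw [h1, norm_zero] at this
    exact zero_ne_one this
  have hξ0 : ξ ≠ 0 := by
    rintro rfl
    simp at hξ
  obtain ⟨e, he, -, heξ⟩ := hπ.exists_isSelfAdjoint_apply_eq (ν := ξ) (ζ := ξ) hξ0 (by
    rw [inner_self_eq_norm_sq_to_K, hξ]; simp)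
  -- The bound makes `φ` depend only on the vector `π b ξ`. If `g` approximates the projection onto
  -- `ξ`, then `φ(b) ≈ φ(gb) ≈ ⟪ξ, π b ξ⟫ φ(e)`.
  have hprop : ∀ b, φ b = ⟪ξ, π b ξ⟫_ℂ * φ e := by
    intro b
    set c := ⟪ξ, π b ξ⟫_ℂ with hc
    set η' := π b ξ - c • ξ with hη'
    have horth : ⟪ξ, η'⟫_ℂ = 0 := by
      rw [hη', inner_sub_right, inner_smul_right, ← hc, inner_self_eq_norm_sq_to_K, hξ]
      simp
    let T : H →L[ℂ] H := (innerSL ℂ ξ).smulRight ξ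
    have hT : ∀ x y, ⟪T x, y⟫_ℂ = ⟪x, T y⟫_ℂ := fun x y => by simp [T]
    have hTξ : T ξ = ξ := by simp [T, hξ]
    have hTη : T η' = 0 := by simp [T, horth]
    have hbound : ∀ ε > (0 : ℝ), ‖φ b - c * φ e‖ ≤ ε := by
      intro ε hε
      set K : ℝ := C * (‖b‖ + ‖c‖ + 1) + 1 with hK
      have hK0 : 0 < K := by positivity
      obtain ⟨g, hg, hgs⟩ := hπ.exists_isSelfAdjoint {ξ, η'} hT (div_pos hε hK0)
      have h1 := hgs ξ (by simp)
      have h2 := hgs η' (by simp)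
      rw [hTξ] at h1
      rw [hTη, sub_zero] at h2
      set δ := ε / K with hδ
      have e1 : ‖φ (b - g * b)‖ ≤ C * (‖b‖ * δ) := by
        -- Taking adjoints puts `g` on the right, where it acts directly on `ξ`.
        have h3 : ‖φ (b - g * b)‖ = ‖φ (star (b - g * b))‖ := by
          rw [state_star hφ, RCLike.norm_conj]
        rw [h3]
        refine (hC _).trans ?_
        have h4 : π (star (b - g * b)) ξ = -(π (star b) (π g ξ - ξ)) := by
          rw [star_sub, star_mul, hg.star_eq, map_sub, map_mul, map_sub]
          simp
        rw [h4, norm_neg]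
        gcongr
        calc ‖π (star b) (π g ξ - ξ)‖ ≤ ‖b‖ * ‖π g ξ - ξ‖ :=
              (π (star b)).le_of_opNorm_le
                ((NonUnitalStarAlgHom.norm_apply_le π _).trans (norm_star b).le) _
          _ ≤ ‖b‖ * δ := by gcongr
      have e2 : ‖φ (g * b - c • e)‖ ≤ C * (‖c‖ * δ + δ) := by
        refine (hC _).trans ?_
        have h4 : π (g * b - c • e) ξ = c • (π g ξ - ξ) + π g η' := by
          rw [map_sub, map_mul, map_smul, sub_apply, smul_apply, heξ, hη', map_sub, map_smul]
          change π g (π b ξ) - c • ξ = _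
          module
        rw [h4]
        gcongr
        refine (norm_add_le _ _).trans ?_
        rw [norm_smul]
        gcongr
      have h5 : φ b - c * φ e = φ (b - g * b) + φ (g * b - c • e) := by
        rw [← map_add, sub_add_sub_cancel, map_sub, map_smul, smul_eq_mul]
      rw [h5]
      refine (norm_add_le _ _).trans ((add_le_add e1 e2).trans ?_)
      have hδ0 : 0 < δ := div_pos hε hK0
      have : K * δ = ε := by rw [hδ]; field_simp
      rw [← this, hK]
      nlinarith
    have := le_of_forall_gt_imp_ge_of_dense hbound
    exact sub_eq_zero.mp (norm_le_zero_iff.mp this)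
  have hst := hπ.vectorFunctional_mem_stateSet hξ
  have hnorm : ‖φ e‖ = 1 := by
    have h1 : φ = φ e • vectorFunctional π ξ := by
      ext b
      rw [hprop b, smul_apply, vectorFunctional_apply, smul_eq_mul, mul_comm]
    have h2 := congrArg norm h1
    rw [norm_smul, hφ.2, hst.2, mul_one] at h2
    exact h2.symm
  have hpos : 0 ≤ φ e := by
    have h1 := hφ.1 e
    rw [hprop, inner_rep_star_mul_self, heξ, hξ] at h1
    simpa using h1
  have hone : φ e = 1 := by
    rw [← Complex.norm_of_nonneg' hpos, hnorm]
    simp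
  ext b
  rw [hprop b, hone, mul_one, vectorFunctional_apply]

/-- Unit vectors of a dense representation induce pure states. -/
theorem IsDenseRep.vectorFunctional_mem_pureStateSet {π : B →⋆ₙₐ[ℂ] (H →L[ℂ] H)}
    (hπ : IsDenseRep π) {ξ : H} (hξ : ‖ξ‖ = 1) : vectorFunctional π ξ ∈ pureStateSet B := by
  refine mem_extremePoints_iff_left.mpr ⟨hπ.vectorFunctional_mem_stateSet hξ, ?_⟩
  rintro φ hφ ψ hψ ⟨a, b, ha, hb, hab, hsum⟩
  -- Cauchy–Schwarz and `aφ ≤ ω` on squares, with `ω` the vector state, give `|φ(x)|² ≤ φ(x⋆x) ≤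
  -- a⁻¹‖π(x)ξ‖²`.
  refine hπ.eq_vectorFunctional_of_bound hξ hφ (C := √(a⁻¹)) fun x => ?_
  have h1 : a * ‖φ (star x * x)‖ ≤ ‖π x ξ‖ ^ 2 := by
    have h2 := congrArg (fun f => f (star x * x)) hsum
    simp only [add_apply, smul_apply, vectorFunctional_apply, inner_rep_star_mul_self] at h2
    have h3 := hφ.1 x
    have h4 := hψ.1 x
    have h5 : a * (φ (star x * x)).re + b * (ψ (star x * x)).re = ‖π x ξ‖ ^ 2 := by
      have := congrArg Complex.re h2
      rw [Complex.ofReal_re] at this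
      simpa using this
    have h6 : ‖φ (star x * x)‖ = (φ (star x * x)).re := by
      have := Complex.norm_of_nonneg' h3
      have := congrArg Complex.re this
      simpa using this
    rw [h6]
    have : 0 ≤ (ψ (star x * x)).re := (Complex.nonneg_iff.mp h4).1
    nlinarith
  have h2 := norm_state_sq_le hφ x
  refine (sq_le_sq₀ (norm_nonneg _) (by positivity)).mp ?_
  rw [mul_pow, Real.sq_sqrt (by positivity), inv_mul_eq_div, le_div_iff₀ ha]
  nlinarith

theorem IsDenseRep.denseRange_apply {π : B →⋆ₙₐ[ℂ] (H →L[ℂ] H)} (hπ : IsDenseRep π) {ξ : H}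
    (hξ : ‖ξ‖ = 1) : DenseRange fun b => π b ξ := by
  intro x
  rw [Metric.mem_closure_iff]
  intro ε hε
  obtain ⟨b, hb⟩ := hπ {ξ} ((innerSL ℂ ξ).smulRight x) ε hε
  refine ⟨π b ξ, ⟨b, rfl⟩, ?_⟩
  have := hb ξ (by simp)
  rw [dist_comm, dist_eq_norm]
  simpa [hξ] using this

/-- Unit vectors inducing the same state of a dense representation differ by a phase. -/
theorem IsDenseRep.exists_phase {π : B →⋆ₙₐ[ℂ] (H →L[ℂ] H)} (hπ : IsDenseRep π) {ξ η : H}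
    (hξ : ‖ξ‖ = 1) (hη : ‖η‖ = 1) (h : ∀ b, ⟪ξ, π b ξ⟫_ℂ = ⟪η, π b η⟫_ℂ) :
    ∃ c : ℂ, ‖c‖ = 1 ∧ η = c • ξ := by
  classical
  -- If `b` approximates the projection onto `ξ`, then `⟪ξ, π b ξ⟫ ≈ 1` and `⟪η, π b η⟫ ≈ |⟪ξ,
  -- η⟫|²`. Equality of the states thus forces equality in the Cauchy–Schwarz inequality.
  let T : H →L[ℂ] H := (innerSL ℂ ξ).smulRight ξ
  have hTξ : T ξ = ξ := by simp [T, hξ]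
  have hTη : T η = ⟪ξ, η⟫_ℂ • ξ := by simp [T]
  have hbound : ∀ ε > (0 : ℝ), ‖1 - ⟪ξ, η⟫_ℂ * ⟪η, ξ⟫_ℂ‖ ≤ ε := by
    intro ε hε
    obtain ⟨b, hb⟩ := hπ {ξ, η} T (ε / 2) (half_pos hε)
    have h1 := hb ξ (by simp)
    have h2 := hb η (by simp)
    rw [hTξ] at h1
    rw [hTη] at h2
    have h3 : 1 - ⟪ξ, η⟫_ℂ * ⟪η, ξ⟫_ℂ =
        ⟪η, π b η - ⟪ξ, η⟫_ℂ • ξ⟫_ℂ - ⟪ξ, π b ξ - ξ⟫_ℂ := by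
      rw [inner_sub_right, inner_sub_right, inner_smul_right, h b, inner_self_eq_norm_sq_to_K, hξ]
      simp
    rw [h3]
    refine (norm_sub_le _ _).trans ?_
    have e1 : ‖⟪η, π b η - ⟪ξ, η⟫_ℂ • ξ⟫_ℂ‖ ≤ ‖η‖ * ‖π b η - ⟪ξ, η⟫_ℂ • ξ‖ := norm_inner_le_norm _ _
    have e2 : ‖⟪ξ, π b ξ - ξ⟫_ℂ‖ ≤ ‖ξ‖ * ‖π b ξ - ξ‖ := norm_inner_le_norm _ _
    rw [hη, one_mul] at e1
    rw [hξ, one_mul] at e2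
    linarith
  have h0 : ⟪ξ, η⟫_ℂ * ⟪η, ξ⟫_ℂ = 1 := by
    have := le_of_forall_gt_imp_ge_of_dense hbound
    exact (sub_eq_zero.mp (norm_le_zero_iff.mp this)).symm
  refine ⟨⟪ξ, η⟫_ℂ, ?_, ?_⟩
  · have h1 := congrArg norm h0
    rw [norm_mul, norm_inner_symm η ξ, norm_one] at h1
    nlinarith [norm_nonneg ⟪ξ, η⟫_ℂ]
  · have h1 : ⟪η - ⟪ξ, η⟫_ℂ • ξ, η - ⟪ξ, η⟫_ℂ • ξ⟫_ℂ = 0 := by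
      have hξξ : ⟪ξ, ξ⟫_ℂ = 1 := by rw [inner_self_eq_norm_sq_to_K, hξ]; simp
      have hηη : ⟪η, η⟫_ℂ = 1 := by rw [inner_self_eq_norm_sq_to_K, hη]; simp
      simp only [inner_sub_left, inner_sub_right, inner_smul_left, inner_smul_right,
        inner_conj_symm, hξξ, hηη]
      linear_combination -h0
    exact sub_eq_zero.mp (inner_self_eq_zero.mp h1)

/-- Two vector states of a dense representation are equivalent. -/
theorem IsDenseRep.statesEquivalent {π : B →⋆ₙₐ[ℂ] (H →L[ℂ] H)} (hπ : IsDenseRep π) {ξ η : H}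
    (hξ : ‖ξ‖ = 1) (hη : ‖η‖ = 1) :
    StatesEquivalent ⟨vectorFunctional π ξ, hπ.vectorFunctional_mem_stateSet hξ⟩
      ⟨vectorFunctional π η, hπ.vectorFunctional_mem_stateSet hη⟩ := by
  let _ : PartialOrder B := CStarAlgebra.spectralOrder B
  have _ : StarOrderedRing B := CStarAlgebra.spectralOrderedRing B
  -- The GNS representation of any vector state is `π` itself, through `ρ(b)ζ ↦ π(b)x`, where `ζ` is
  -- the GNS vector.
  have key : ∀ {x : H} (hx : ‖x‖ = 1), ∃ U : (stateToPositive
      ⟨vectorFunctional π x, hπ.vectorFunctional_mem_stateSet hx⟩).GNS ≃ₗᵢ[ℂ] H,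
      ∀ a ζ, U ((stateToPositive ⟨vectorFunctional π x,
        hπ.vectorFunctional_mem_stateSet hx⟩).gnsNonUnitalStarAlgHom a ζ) = π a (U ζ) := by
    intro x hx
    set ω : stateSet B := ⟨vectorFunctional π x, hπ.vectorFunctional_mem_stateSet hx⟩ with hω
    obtain ⟨ζ, hζ, hfun, hdense⟩ := exists_gns_vector ω
    set ρ := (stateToPositive ω).gnsNonUnitalStarAlgHom with hρ
    let e₁ : B →ₗ[ℂ] (stateToPositive ω).GNS :=
      { toFun := fun b => ρ b ζ
        map_add' := fun a b => by rw [map_add, add_apply]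
        map_smul' := fun c b => by rw [map_smul, smul_apply]; rfl }
    let e₂ : B →ₗ[ℂ] H :=
      { toFun := fun b => π b x
        map_add' := fun a b => by rw [map_add, add_apply]
        map_smul' := fun c b => by rw [map_smul, smul_apply]; rfl }
    have hd₂ : DenseRange e₂ := hπ.denseRange_apply hx
    have hnorm : ∀ b, ‖e₂ (LinearEquiv.refl ℂ B b)‖ = ‖e₁ b‖ := by
      intro b
      have h1 := inner_rep_star_mul_self π x b
      have h2 := inner_rep_star_mul_self ρ ζ b
      rw [← vectorFunctional_apply, hfun] at h2
      have h3 := h1.symm.trans h2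
      have h4 : ‖π b x‖ ^ 2 = ‖ρ b ζ‖ ^ 2 := by exact_mod_cast h3
      exact (sq_eq_sq₀ (norm_nonneg _) (norm_nonneg _)).mp h4
    refine ⟨(LinearEquiv.refl ℂ B).extendOfIsometry e₁ e₂ hdense hd₂ hnorm, fun a z => ?_⟩
    set U := (LinearEquiv.refl ℂ B).extendOfIsometry e₁ e₂ hdense hd₂ hnorm with hU
    have hUe : ∀ b, U (e₁ b) = e₂ b := fun b =>
      LinearEquiv.extendOfIsometry_eq (LinearEquiv.refl ℂ B) e₁ e₂ hdense hd₂ hnorm b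
    refine hdense.induction_on z (isClosed_eq (U.continuous.comp (ρ a).continuous)
      ((π a).continuous.comp U.continuous)) fun b => ?_
    have h1 : ρ a (ρ b ζ) = e₁ (a * b) := by
      change _ = ρ (a * b) ζ
      rw [map_mul]
      rfl
    have h2 : π a (e₂ b) = e₂ (a * b) := by
      change _ = π (a * b) x
      rw [map_mul]
      rfl
    change U (ρ a (ρ b ζ)) = π a (U (e₁ b))
    rw [h1, hUe, hUe, h2]
  obtain ⟨U, hU⟩ := key hξ
  obtain ⟨V, hV⟩ := key hη
  refine ⟨U.trans V.symm, fun a ζ => ?_⟩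
  rw [LinearIsometryEquiv.trans_apply, LinearIsometryEquiv.trans_apply, hU,
    LinearIsometryEquiv.symm_apply_eq, hV, LinearIsometryEquiv.apply_symm_apply]

/-- Equivalent pure states are vector states of one dense representation. -/
theorem exists_isDenseRep_of_statesEquivalent {ω₁ ω₂ : stateSet B} (h₁ : ω₁.1 ∈ pureStateSet B)
    (h : StatesEquivalent ω₁ ω₂) :
    ∃ (K : Type u) (_ : NormedAddCommGroup K) (_ : InnerProductSpace ℂ K) (_ : CompleteSpace K)
      (π : B →⋆ₙₐ[ℂ] (K →L[ℂ] K)) (ξ η : K), IsDenseRep π ∧ ‖ξ‖ = 1 ∧ ‖η‖ = 1 ∧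
      (∀ b, ω₁.1 b = ⟪ξ, π b ξ⟫_ℂ) ∧ ∀ b, ω₂.1 b = ⟪η, π b η⟫_ℂ := by
  let _ : PartialOrder B := CStarAlgebra.spectralOrder B
  have _ : StarOrderedRing B := CStarAlgebra.spectralOrderedRing B
  obtain ⟨U, hU⟩ := h
  obtain ⟨ξ, hξ, hξf, hξd⟩ := exists_gns_vector ω₁
  obtain ⟨η, hη, hηf, -⟩ := exists_gns_vector ω₂
  refine ⟨(stateToPositive ω₁).GNS, inferInstance, inferInstance, inferInstance,
    (stateToPositive ω₁).gnsNonUnitalStarAlgHom, ξ, U.symm η,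
    isDenseRep_of_pure hξ hξd (by rw [hξf]; exact h₁), hξ, by rw [LinearIsometryEquiv.norm_map, hη],
    fun b => by rw [← hξf]; rfl, fun b => ?_⟩
  rw [← hηf, vectorFunctional_apply, ← U.inner_map_map, hU, U.apply_symm_apply]

end GNSVectors

/-! ### Equivalence of the state and vector forms of the property; quotients. -/

section VectorPaths

open scoped InnerProductSpace CStarAlgebra ComplexOrder

/-- The path property for unit vectors of dense representations and arbitrary homomorphisms. -/
def VectorPathProperty (A : Type u) [NonUnitalCStarAlgebra A] : Prop :=
  ∀ (F : Finset A) (ε : ℝ), 0 < ε → ∃ (G : Finset A) (δ : ℝ), 0 < δ ∧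
    ∀ (B : Type u) [NonUnitalCStarAlgebra B] (ι : A →⋆ₙₐ[ℂ] B)
      (H : Type u) [NormedAddCommGroup H] [InnerProductSpace ℂ H] [CompleteSpace H]
      (π : B →⋆ₙₐ[ℂ] (H →L[ℂ] H)), IsDenseRep π → ∀ ξ η : H, ‖ξ‖ = 1 → ‖η‖ = 1 →
        (∀ x ∈ G, ‖⟪ξ, π (ι x) ξ⟫_ℂ - ⟪η, π (ι x) η⟫_ℂ‖ < δ) →
        ∃ u : unitInterval → Unitization ℂ B, IsUnitaryPath u ∧ unitizationRep π (u 1) ξ = η ∧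
          ∀ x ∈ F, ∀ t, ‖u t * (ι x : Unitization ℂ B) - (ι x : Unitization ℂ B) * u t‖ < ε

variable {B : Type u} [NonUnitalCStarAlgebra B]
variable {H : Type u} [NormedAddCommGroup H] [InnerProductSpace ℂ H] [CompleteSpace H]

theorem unitizationRep_starMap {C : Type u} [NonUnitalCStarAlgebra C] (π : B →⋆ₙₐ[ℂ] (H →L[ℂ] H))
    (f : C →⋆ₙₐ[ℂ] B) (w : Unitization ℂ C) :
    unitizationRep π (Unitization.starMap f w) = unitizationRep (π.comp f) w := by
  induction w with
  | inl_add_inr r c =>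
    rw [map_add, map_add, map_add, Unitization.starMap_inr, unitizationRep_inr, unitizationRep_inr,
      Unitization.starMap_inl]
    congr 1
    exact (AlgHomClass.commutes (unitizationRep π) r).trans
      (AlgHomClass.commutes (unitizationRep (π.comp f)) r).symm

theorem inr_innerAd (w : Unitization ℂ B) (x : B) :
    ((innerAd w x : B) : Unitization ℂ B) = w * (x : Unitization ℂ B) * star w := by
  apply Unitization.ext <;> simp [innerAd]

theorem inner_star_unitizationRep_left (π : B →⋆ₙₐ[ℂ] (H →L[ℂ] H)) (w : Unitization ℂ B) (x y : H) :
    ⟪unitizationRep π w x, y⟫_ℂ = ⟪x, unitizationRep π (star w) y⟫_ℂ := by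
  rw [map_star, ContinuousLinearMap.star_eq_adjoint, ContinuousLinearMap.adjoint_inner_right]

theorem unitizationRep_star_mul_self {π : B →⋆ₙₐ[ℂ] (H →L[ℂ] H)} {w : Unitization ℂ B}
    (hw : w ∈ unitary (Unitization ℂ B)) (x : H) :
    unitizationRep π (star w) (unitizationRep π w x) = x := by
  have h := congrArg (fun z => unitizationRep π z x) (Unitary.star_mul_self_of_mem hw)
  simpa using h

theorem norm_unitizationRep_of_mem_unitary {π : B →⋆ₙₐ[ℂ] (H →L[ℂ] H)} {w : Unitization ℂ B}
    (hw : w ∈ unitary (Unitization ℂ B)) (x : H) : ‖unitizationRep π w x‖ = ‖x‖ := by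
  rw [← sq_eq_sq₀ (norm_nonneg _) (norm_nonneg _), ← inner_self_eq_norm_sq (𝕜 := ℂ),
    inner_star_unitizationRep_left, unitizationRep_star_mul_self hw, inner_self_eq_norm_sq]

theorem norm_innerAd_sub {w : Unitization ℂ B} (hw : w ∈ unitary (Unitization ℂ B)) (x : B) :
    ‖innerAd w x - x‖ = ‖w * (x : Unitization ℂ B) - (x : Unitization ℂ B) * w‖ := by
  rw [← Unitization.norm_inr (𝕜 := ℂ), Unitization.inr_sub, inr_innerAd]
  have h1 : w * (x : Unitization ℂ B) * star w - (x : Unitization ℂ B) =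
      (w * (x : Unitization ℂ B) - (x : Unitization ℂ B) * w) * star w := by
    rw [sub_mul, mul_assoc (x : Unitization ℂ B), Unitary.mul_star_self_of_mem hw, mul_one]
  rw [h1, CStarRing.norm_mul_mem_unitary _ (Unitary.star_mem hw)]

theorem inner_rep_innerAd (π : B →⋆ₙₐ[ℂ] (H →L[ℂ] H)) (w : Unitization ℂ B) (b : B) (η : H) :
    ⟪η, π (innerAd w b) η⟫_ℂ =
      ⟪unitizationRep π (star w) η, π b (unitizationRep π (star w) η)⟫_ℂ := by
  rw [← unitizationRep_inr π (innerAd w b), inr_innerAd, map_mul, map_mul, unitizationRep_inr,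
    inner_star_unitizationRep_left, star_star]
  rfl

/-- The pair `(ι, id)` embeds `A` in `B × A`, and composing `π` with the first projection changes
neither density nor the vector states. The path obtained there is pushed down to `B`. The states fix
its endpoint only up to a phase, which a scalar path removes at no cost in commutators. -/
theorem PureStatePathProperty.vectorPathProperty {A : Type u} [NonUnitalCStarAlgebra A]
    (hA : PureStatePathProperty A) : VectorPathProperty A := by
  intro F ε hε
  obtain ⟨G, δ, hδ, h⟩ := hA F ε hε
  refine ⟨G, δ, hδ, ?_⟩
  intro B _ ι H _ _ _ π hπ ξ η hξ hη hG
  let p : B × A →⋆ₙₐ[ℂ] B := NonUnitalStarAlgHom.fst ℂ B A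
  let ι' : A →⋆ₙₐ[ℂ] B × A := ι.prod (NonUnitalStarAlgHom.id ℂ A)
  have hι' : Function.Injective ι' := fun x y hxy => congrArg Prod.snd hxy
  have hπ' : IsDenseRep (π.comp p) := by
    intro s T r hr
    obtain ⟨b, hb⟩ := hπ s T r hr
    exact ⟨(b, 0), hb⟩
  obtain ⟨u, huc, hum, hu0, hu1, huF⟩ := h (B × A) ι' hι' _ _
    (hπ'.vectorFunctional_mem_pureStateSet hξ) (hπ'.vectorFunctional_mem_pureStateSet hη)
    (hπ'.statesEquivalent hξ hη) hG
  have hu : IsUnitaryPath u := ⟨huc, fun t => (hum t).1, hu0⟩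
  have hv := hu.map (Unitization.starMap p)
  have hW : ∀ x, unitizationRep π (Unitization.starMap p (u 1)) x =
      unitizationRep (π.comp p) (u 1) x := fun x => by rw [unitizationRep_starMap]
  obtain ⟨c, hc, hcη⟩ := hπ'.exists_phase hξ
    (η := unitizationRep (π.comp p) (star (u 1)) η)
    (by rw [norm_unitizationRep_of_mem_unitary (Unitary.star_mem (hu.mem_unitary 1)), hη])
    (fun b => by rw [← inner_rep_innerAd]; exact hu1 b)
  have hηc : η = c • unitizationRep π (Unitization.starMap p (u 1)) ξ := by
    rw [hW, ← map_smul, ← hcη]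
    have := unitizationRep_star_mul_self (π := π.comp p) (Unitary.star_mem (hu.mem_unitary 1)) η
    rw [star_star] at this
    exact this.symm
  have hs := IsUnitaryPath.exp_scalar (C := Unitization ℂ B) c.arg
  refine ⟨_, hs.mul hv, ?_, fun x hx t => ?_⟩
  · have h1 : Complex.exp (((1 : unitInterval) : ℝ) * c.arg * Complex.I) = c := by
      have := Complex.norm_mul_exp_arg_mul_I c
      rw [hc] at this
      simpa using this
    rw [h1, smul_one_mul, map_smul, smul_apply, ← hηc]
  · refine lt_of_le_of_lt (norm_commutator_mul_le (hs.mem_unitary t) (hv.mem_unitary t)) ?_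
    have h2 : Complex.exp ((t : ℝ) * c.arg * Complex.I) • (1 : Unitization ℂ B) * (ι x) -
        (ι x) * Complex.exp ((t : ℝ) * c.arg * Complex.I) • (1 : Unitization ℂ B) = 0 := by simp
    rw [h2, norm_zero, zero_add]
    have h3 := huF x hx t
    rw [norm_innerAd_sub (hu.mem_unitary t)] at h3
    refine lt_of_le_of_lt ?_ h3
    have h4 : Unitization.starMap p (u t) * (ι x : Unitization ℂ B) -
        (ι x : Unitization ℂ B) * Unitization.starMap p (u t) =
        Unitization.starMap p (u t * (ι' x : Unitization ℂ (B × A)) -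
          (ι' x : Unitization ℂ (B × A)) * u t) := by
      rw [map_sub, map_mul, map_mul, Unitization.starMap_inr]
      rfl
    rw [h4]
    exact NonUnitalStarAlgHom.norm_apply_le _ _

theorem mul_inr_eq_inr_mul_of_identity {p : B} (hp : ∀ x : B, p * x = x ∧ x * p = x)
    (w : Unitization ℂ B) : w * (p : Unitization ℂ B) = (p : Unitization ℂ B) * w := by
  induction w with
  | inl_add_inr r c =>
    rw [add_mul, mul_add, ← Unitization.inr_mul, ← Unitization.inr_mul, (hp c).1, (hp c).2]
    congr 1
    exact Algebra.commutes r (p : Unitization ℂ B)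

/-- An identity `p` of `B` is a central projection of the unitization, so `up + (1 - p)` is unitary
and acts on `B` as `u` does. Without an identity, `u` itself is admissible. -/
theorem exists_mem_unitaryGroupOf {u : unitInterval → Unitization ℂ B} (hu : IsUnitaryPath u) :
    ∃ v : unitInterval → Unitization ℂ B, Continuous v ∧ (∀ t, v t ∈ unitaryGroupOf B) ∧ v 0 = 1 ∧
      ∀ t b, innerAd (v t) b = innerAd (u t) b := by
  by_cases hB : HasIdentity B
  · obtain ⟨p, hp⟩ := hB
    obtain ⟨P, hP⟩ : ∃ P : Unitization ℂ B, P = (p : B) := ⟨_, rfl⟩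
    have hpp : p * p = p := (hp p).1
    have hps : star p = p := by
      have h1 := congrArg star (hp (star p)).1
      rw [star_mul, star_star] at h1
      exact (hp (star p)).1.symm.trans h1
    have hPb : ∀ b : B, P * (b : Unitization ℂ B) = b := fun b => by
      rw [hP, ← Unitization.inr_mul, (hp b).1]
    have hbP : ∀ b : B, (b : Unitization ℂ B) * P = b := fun b => by
      rw [hP, ← Unitization.inr_mul, (hp b).2]
    have hcentral : ∀ w, w * P = P * w := fun w => by
      rw [hP, mul_inr_eq_inr_mul_of_identity hp]
    have hPP : P * P = P := by rw [hP, ← Unitization.inr_mul, hpp]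
    have hPs : star P = P := by rw [hP, ← Unitization.inr_star, hps]
    refine ⟨fun t => u t * P + (1 - P), ?_, fun t => ⟨?_, ?_⟩, ?_, fun t b => ?_⟩
    · have := hu.continuous
      fun_prop
    · have hmem := Unitary.mem_iff.mp (hu.mem_unitary t)
      have hc := hcentral (u t)
      have hc' := hcentral (star (u t))
      have e : star (u t * P + (1 - P)) = star (u t) * P + (1 - P) := by
        rw [star_add, star_mul, star_sub, star_one, hPs, hc']
      have key : ∀ x y : Unitization ℂ B, x * y = 1 →
          (x * P + (1 - P)) * (y * P + (1 - P)) = 1 := by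
        intro x y hxy
        have hyP := hcentral y
        have e1 : x * P * (y * P) = P := by
          rw [hyP, mul_assoc, ← mul_assoc P P, hPP, ← hyP, ← mul_assoc, hxy, one_mul]
        have e2 : x * P * (1 - P) = 0 := by rw [mul_assoc, mul_sub, hPP, mul_one, sub_self, mul_zero]
        have e3 : (1 - P) * (y * P) = 0 := by
          rw [hyP, ← mul_assoc, sub_mul, hPP, one_mul, sub_self, zero_mul]
        have e4 : (1 - P) * (1 - P) = 1 - P := by
          rw [mul_sub, sub_mul, sub_mul, hPP, one_mul, mul_one, one_mul, sub_self, sub_zero]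
        rw [add_mul, mul_add, mul_add, e1, e2, e3, e4]
        abel
      rw [Unitary.mem_iff, e]
      exact ⟨key _ _ hmem.1, key _ _ hmem.2⟩
    · intro q hq
      have hqp : q = p := by rw [← (hp q).1, (hq p).2]
      rw [hqp, ← hP, add_mul, mul_assoc, mul_sub, hPP, mul_one, sub_self, mul_zero, zero_add,
        mul_sub, mul_one, sub_mul, hPP, one_mul, sub_self, sub_zero]
    · simp only [hu.map_zero, one_mul]
      abel
    · apply Unitization.inr_injective (R := ℂ)
      rw [inr_innerAd, inr_innerAd, star_add, star_mul, star_sub, star_one, hPs, add_mul,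
        mul_assoc (u t) P, hPb, sub_mul, hPb, one_mul, sub_self, add_zero, mul_add, mul_assoc (u t),
        ← mul_assoc _ P, hbP, mul_assoc (u t) _ (1 - P), mul_sub, mul_one, hbP, sub_self, mul_zero,
        add_zero, mul_assoc]
  · exact ⟨u, hu.continuous, fun t => ⟨hu.mem_unitary t, fun e he => absurd ⟨e, he⟩ hB⟩,
      hu.map_zero, fun _ _ => rfl⟩

/-- Both states are vector states of one dense representation, and `π(u)ξ = η` gives `⟪η, π(ubu⋆)η⟫
= ⟪ξ, π(b)ξ⟫`. -/
theorem VectorPathProperty.pureStatePathProperty {A : Type u} [NonUnitalCStarAlgebra A]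
    (hA : VectorPathProperty A) : PureStatePathProperty A := by
  intro F ε hε
  obtain ⟨G, δ, hδ, h⟩ := hA F ε hε
  refine ⟨G, δ, hδ, ?_⟩
  intro B _ ι _ ω₁ ω₂ h₁ _ heq hG
  obtain ⟨K, _, _, _, π, ξ, η, hπ, hξ, hη, hω₁, hω₂⟩ := exists_isDenseRep_of_statesEquivalent h₁ heq
  obtain ⟨u, hu, hu1, huF⟩ := h B ι K π hπ ξ η hξ hη fun x hx => by
    rw [← hω₁, ← hω₂]
    exact hG x hx
  obtain ⟨v, hvc, hvm, hv0, hvu⟩ := exists_mem_unitaryGroupOf hu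
  refine ⟨v, hvc, hvm, hv0, fun b => ?_, fun x hx t => ?_⟩
  · rw [hvu, hω₁, hω₂, inner_rep_innerAd, ← hu1, unitizationRep_star_mul_self (hu.mem_unitary 1)]
  · rw [hvu, norm_innerAd_sub (hu.mem_unitary t)]
    exact huF x hx t

/-- Any homomorphism out of the quotient is a homomorphism out of `A` after composition with the
quotient map. Only `F` has to be lifted. -/
theorem VectorPathProperty.quotient {A : Type u} [NonUnitalCStarAlgebra A]
    (hA : VectorPathProperty A) (I : ClosedIdeal A) : VectorPathProperty I.Quotient := by
  classical
  intro F ε hε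
  obtain ⟨G, δ, hδ, h⟩ := hA (F.image (Function.surjInv I.quotientMap_surjective)) ε hε
  refine ⟨G.image I.quotientMap, δ, hδ, ?_⟩
  intro B _ ι H _ _ _ π hπ ξ η hξ hη hG
  obtain ⟨u, hu, hu1, huF⟩ := h B (ι.comp I.quotientMap) H π hπ ξ η hξ hη fun x hx =>
    hG _ (Finset.mem_image_of_mem _ hx)
  refine ⟨u, hu, hu1, fun x hx t => ?_⟩
  have := huF _ (Finset.mem_image_of_mem _ hx) t
  rwa [NonUnitalStarAlgHom.comp_apply, Function.surjInv_eq I.quotientMap_surjective x] at this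

end VectorPaths

/-! ### Approximation by homomorphic images, and inductive limits. -/

section Limits

open scoped InnerProductSpace CStarAlgebra ComplexOrder

/-- Commutators with a unitary are stable under small changes of `x`: replacing `f y` by `x` costs
at most `2 · ε/4`, in addition to the `ε/2` from `A'`. -/
theorem VectorPathProperty.of_approx {A : Type u} [NonUnitalCStarAlgebra A]
    (h : ∀ (F : Finset A) (ε : ℝ), 0 < ε → ∃ (A' : Type u) (_ : NonUnitalCStarAlgebra A')
      (f : A' →⋆ₙₐ[ℂ] A), VectorPathProperty A' ∧ ∀ x ∈ F, ∃ y, ‖f y - x‖ < ε) :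
    VectorPathProperty A := by
  classical
  intro F ε hε
  obtain ⟨A', _, f, hA', hf⟩ := h F (ε / 4) (by positivity)
  choose! y hy using hf
  obtain ⟨G, δ, hδ, hG⟩ := hA' (F.image y) (ε / 2) (by positivity)
  refine ⟨G.image f, δ, hδ, ?_⟩
  intro B _ ι H _ _ _ π hπ ξ η hξ hη hclose
  obtain ⟨u, hu, hu1, huF⟩ := hG B (ι.comp f) H π hπ ξ η hξ hη fun x hx =>
    hclose _ (Finset.mem_image_of_mem _ hx)
  refine ⟨u, hu, hu1, fun x hx t => ?_⟩
  have h1 := huF _ (Finset.mem_image_of_mem _ hx) t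
  rw [NonUnitalStarAlgHom.comp_apply] at h1
  set d : Unitization ℂ B := ((ι (f (y x) - x) : B) : Unitization ℂ B) with hd
  have hdn : ‖d‖ ≤ ε / 4 := by
    rw [hd, Unitization.norm_inr]
    exact (NonUnitalStarAlgHom.norm_apply_le _ _).trans (hy x hx).le
  have hun := norm_le_one_of_mem_unitary (hu.mem_unitary t)
  have e : u t * (ι x : Unitization ℂ B) - (ι x : Unitization ℂ B) * u t =
      (u t * (ι (f (y x)) : Unitization ℂ B) - (ι (f (y x)) : Unitization ℂ B) * u t) -
        (u t * d - d * u t) := by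
    rw [hd, map_sub, Unitization.inr_sub]
    noncomm_ring
  have h2 : ‖u t * d‖ ≤ ε / 4 :=
    (norm_mul_le _ _).trans ((mul_le_of_le_one_left (norm_nonneg _) hun).trans hdn)
  have h3 : ‖d * u t‖ ≤ ε / 4 :=
    (norm_mul_le _ _).trans ((mul_le_of_le_one_right (norm_nonneg _) hun).trans hdn)
  rw [e]
  calc _ ≤ _ := norm_sub_le _ _
    _ < ε / 2 + ‖u t * d - d * u t‖ := by gcongr
    _ ≤ ε / 2 + (ε / 4 + ε / 4) := by
      gcongr
      exact (norm_sub_le _ _).trans (add_le_add h2 h3)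
    _ = ε := by ring

/-- A family of ⋆-homomorphisms as a ⋆-homomorphism into the algebra of bounded families. -/
noncomputable def starHomLpLift {ι : Type*} {A : Type*} [NonUnitalCStarAlgebra A] {E : ι → Type*}
    [∀ i, NonUnitalCStarAlgebra (E i)] (f : ∀ i, A →⋆ₙₐ[ℂ] E i) : A →⋆ₙₐ[ℂ] lp E ⊤ where
  toFun a := ⟨fun i => f i a, memℓp_infty ⟨‖a‖, by
    rintro _ ⟨i, rfl⟩
    exact NonUnitalStarAlgHom.norm_apply_le _ _⟩⟩
  map_smul' c a := by ext i; exact map_smul (f i) c a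
  map_zero' := by ext i; exact map_zero (f i)
  map_add' a b := by ext i; exact map_add (f i) a b
  map_mul' a b := by ext i; exact map_mul (f i) a b
  map_star' a := by ext i; exact map_star (f i) a

@[simp]
theorem starHomLpLift_apply {ι : Type*} {A : Type*} [NonUnitalCStarAlgebra A] {E : ι → Type*}
    [∀ i, NonUnitalCStarAlgebra (E i)] (f : ∀ i, A →⋆ₙₐ[ℂ] E i) (a : A) (i : ι) :
    starHomLpLift f a i = f i a := rfl

variable {A : ℕ → Type u} [∀ n, NonUnitalCStarAlgebra (A n)] (φ : ∀ n, A n →⋆ₙₐ[ℂ] A (n + 1))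

/-- The iterated connecting map `A n → A k` of an inductive system, and zero when `k < n`. -/
def connectingMap (n : ℕ) : ∀ k, A n →⋆ₙₐ[ℂ] A k
  | 0 => if h : n = 0 then h ▸ NonUnitalStarAlgHom.id ℂ (A n) else 0
  | k + 1 => if h : n = k + 1 then h ▸ NonUnitalStarAlgHom.id ℂ (A n) else
      (φ k).comp (connectingMap n k)

theorem connectingMap_self (n : ℕ) (a : A n) : connectingMap φ n n a = a := by
  cases n <;> simp [connectingMap]

theorem connectingMap_succ {n k : ℕ} (h : n ≤ k) (a : A n) :
    connectingMap φ n (k + 1) a = φ k (connectingMap φ n k a) := by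
  rw [connectingMap, dif_neg (by omega)]
  rfl

theorem starHomLpLift_connectingMap_mem (n : ℕ) (a : A n) :
    starHomLpLift (connectingMap φ n) a ∈ coherentSequences φ :=
  ⟨n, fun _ hk => connectingMap_succ φ hk a⟩

/-- The canonical map of the `n`-th algebra of an inductive system into the inductive limit. -/
noncomputable def toInductiveLimit (n : ℕ) : A n →⋆ₙₐ[ℂ] inductiveLimit φ :=
  NonUnitalStarAlgHom.codRestrict
    ((nullSequences A).quotientMap.comp (starHomLpLift (connectingMap φ n))) _ fun a =>
    NonUnitalStarSubalgebra.le_topologicalClosure _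
      ⟨_, starHomLpLift_connectingMap_mem φ n a, rfl⟩

theorem coe_toInductiveLimit_apply_eq {s : lp A ⊤} {n : ℕ} (hs : ∀ k ≥ n, s (k + 1) = φ k (s k)) :
    (toInductiveLimit φ n (s n) : (nullSequences A).Quotient) = (nullSequences A).quotientMap s := by
  have h : ∀ k ≥ n, connectingMap φ n k (s n) = s k := by
    intro k hk
    induction k, hk using Nat.le_induction with
    | base => exact connectingMap_self φ n _
    | succ k hk ih => rw [connectingMap_succ φ hk, ih, hs k hk]
  change (nullSequences A).quotientMap (starHomLpLift (connectingMap φ n) (s n)) = _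
  rw [← sub_eq_zero, ← map_sub, ClosedIdeal.quotientMap_eq_zero_iff]
  change Tendsto (fun k => ‖(starHomLpLift (connectingMap φ n) (s n) - s) k‖) atTop (𝓝 0)
  -- The sequences agree from index `n` on, so the zero entries of `connectingMap` below `n`
  -- disappear in the quotient.
  refine tendsto_const_nhds.congr' ?_
  filter_upwards [eventually_ge_atTop n] with k hk
  simp [h k hk]

/-- Each element of the limit is approximated from all sufficiently late stages, so a finite set is
approximated from a common one. -/
theorem VectorPathProperty.inductiveLimit (h : ∀ n, VectorPathProperty (A n)) :
    VectorPathProperty (inductiveLimit φ) := by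
  refine .of_approx fun F ε hε => ?_
  have key : ∀ x : _root_.inductiveLimit φ, ∃ n, ∀ m ≥ n, ∃ y, ‖toInductiveLimit φ m y - x‖ < ε := by
    intro x
    have hx : (x : (nullSequences A).Quotient) ∈
        closure (((coherentSequences φ).map (nullSequences A).quotientMap :
          NonUnitalStarSubalgebra ℂ _) : Set (nullSequences A).Quotient) := x.2
    obtain ⟨_, ⟨s, ⟨n, hs⟩, rfl⟩, hsx⟩ := Metric.mem_closure_iff.mp hx ε hε
    refine ⟨n, fun m hm => ⟨s m, ?_⟩⟩
    change ‖(toInductiveLimit φ m (s m) : (nullSequences A).Quotient) - x‖ < ε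
    rw [coe_toInductiveLimit_apply_eq φ fun k hk => hs k (hm.trans hk), ← dist_eq_norm, dist_comm]
    exact hsx
  choose n hn using key
  exact ⟨A (F.sup n), inferInstance, toInductiveLimit φ _, h _, fun x hx =>
    hn x _ (Finset.le_sup hx)⟩

end Limits

/-! ### Corners at a projection of the unitization, and paths in them. -/

section Gluing

open scoped InnerProductSpace CStarAlgebra ComplexOrder

/-- The vector path property for homomorphisms mapping every element of `S` to an identity. -/
def RelativeVectorPathProperty (A : Type u) [NonUnitalCStarAlgebra A] (S : Set A) : Prop :=
  ∀ (F : Finset A) (ε : ℝ), 0 < ε → ∃ (G : Finset A) (δ : ℝ), 0 < δ ∧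
    ∀ (B : Type u) [NonUnitalCStarAlgebra B] (ι : A →⋆ₙₐ[ℂ] B),
      (∀ s ∈ S, ∀ b : B, ι s * b = b ∧ b * ι s = b) →
      ∀ (H : Type u) [NormedAddCommGroup H] [InnerProductSpace ℂ H] [CompleteSpace H]
      (π : B →⋆ₙₐ[ℂ] (H →L[ℂ] H)), IsDenseRep π → ∀ ξ η : H, ‖ξ‖ = 1 → ‖η‖ = 1 →
        (∀ x ∈ G, ‖⟪ξ, π (ι x) ξ⟫_ℂ - ⟪η, π (ι x) η⟫_ℂ‖ < δ) →
        ∃ u : unitInterval → Unitization ℂ B, IsUnitaryPath u ∧ unitizationRep π (u 1) ξ = η ∧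
          ∀ x ∈ F, ∀ t, ‖u t * (ι x : Unitization ℂ B) - (ι x : Unitization ℂ B) * u t‖ < ε

theorem VectorPathProperty.relative {A : Type u} [NonUnitalCStarAlgebra A]
    (hA : VectorPathProperty A) (S : Set A) : RelativeVectorPathProperty A S := by
  intro F ε hε
  obtain ⟨G, δ, hδ, h⟩ := hA F ε hε
  exact ⟨G, δ, hδ, fun B _ ι _ => h B ι⟩

variable {B : Type u} [NonUnitalCStarAlgebra B]
variable {H : Type u} [NormedAddCommGroup H] [InnerProductSpace ℂ H] [CompleteSpace H]

/-- The corner of `B` at a projection of its unitization. -/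
def unitizationCorner (P : Unitization ℂ B) (hP : IsStarProjection P) :
    NonUnitalStarSubalgebra ℂ B where
  carrier := {b | P * (b : Unitization ℂ B) = b ∧ (b : Unitization ℂ B) * P = b}
  add_mem' := by
    rintro a b ⟨ha, ha'⟩ ⟨hb, hb'⟩
    simp [mul_add, add_mul, ha, ha', hb, hb']
  zero_mem' := by simp
  mul_mem' := by
    rintro a b ⟨ha, _⟩ ⟨_, hb⟩
    constructor
    · rw [Unitization.inr_mul, ← mul_assoc, ha]
    · rw [Unitization.inr_mul, mul_assoc, hb]
  smul_mem' := by
    rintro c a ⟨ha, ha'⟩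
    constructor
    · rw [Unitization.inr_smul, mul_smul_comm, ha]
    · rw [Unitization.inr_smul, smul_mul_assoc, ha']
  star_mem' := by
    rintro a ⟨ha, ha'⟩
    constructor
    · have := congrArg star ha'
      rwa [star_mul, hP.isSelfAdjoint.star_eq, ← Unitization.inr_star] at this
    · have := congrArg star ha
      rwa [star_mul, hP.isSelfAdjoint.star_eq, ← Unitization.inr_star] at this

instance unitizationCorner.isClosed (P : Unitization ℂ B) (hP : IsStarProjection P) :
    IsClosed (unitizationCorner P hP : Set B) := by
  have h : Continuous (fun b : B => (b : Unitization ℂ B)) :=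
    (Unitization.isometry_inr (𝕜 := ℂ)).continuous
  exact (isClosed_eq (continuous_const.mul h) h).inter (isClosed_eq (h.mul continuous_const) h)

/-- The map `c + b ↦ c P + b` from the unitization of the corner at `P`. -/
def unitizationCornerMap (P : Unitization ℂ B) (hP : IsStarProjection P) :
    Unitization ℂ (unitizationCorner P hP) →⋆ₙₐ[ℂ] Unitization ℂ B where
  toFun w := w.fst • P + ((w.snd : B) : Unitization ℂ B)
  map_smul' c w := by simp [smul_smul]
  map_zero' := by simp
  map_add' v w := by
    simp [add_smul]
    abel
  map_mul' v w := by
    have h1 := v.snd.2.2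
    have h2 := w.snd.2.1
    have h3 : P * P = P := hP.isIdempotentElem
    simp only [Unitization.fst_mul, Unitization.snd_mul, add_mul, mul_add, smul_mul_assoc,
      mul_smul_comm, h1, h2, h3]
    simp [smul_smul, mul_comm]
    abel
  map_star' w := by
    simp [hP.isSelfAdjoint.star_eq]

theorem unitizationCornerMap_inr (P : Unitization ℂ B) (hP : IsStarProjection P)
    (b : unitizationCorner P hP) :
    unitizationCornerMap P hP (b : Unitization ℂ (unitizationCorner P hP)) = ((b : B) : _) := by
  change (0 : ℂ) • P + _ = _
  rw [zero_smul, zero_add]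
  rfl

theorem unitizationCornerMap_one (P : Unitization ℂ B) (hP : IsStarProjection P) :
    unitizationCornerMap P hP 1 = P := by
  change (1 : ℂ) • P + ((0 : B) : Unitization ℂ B) = P
  simp

/-- The range of the image of a projection. -/
def repRange (π : B →⋆ₙₐ[ℂ] (H →L[ℂ] H)) (P : Unitization ℂ B) : Submodule ℂ H where
  carrier := {v | unitizationRep π P v = v}
  add_mem' {v w} hv hw := by
    change unitizationRep π P (v + w) = v + w
    rw [map_add, hv, hw]
  zero_mem' := map_zero (unitizationRep π P)
  smul_mem' c v hv := by
    change unitizationRep π P (c • v) = c • v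
    rw [map_smul, hv]

theorem mem_repRange {π : B →⋆ₙₐ[ℂ] (H →L[ℂ] H)} {P : Unitization ℂ B} {v : H} :
    v ∈ repRange π P ↔ unitizationRep π P v = v := Iff.rfl

instance (π : B →⋆ₙₐ[ℂ] (H →L[ℂ] H)) (P : Unitization ℂ B) : CompleteSpace (repRange π P) :=
  IsClosed.completeSpace_coe (s := (repRange π P : Set H))
    (hs := isClosed_eq (unitizationRep π P).continuous continuous_id)

theorem unitizationRep_mul_apply (π : B →⋆ₙₐ[ℂ] (H →L[ℂ] H)) (v w : Unitization ℂ B) (x : H) :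
    unitizationRep π (v * w) x = unitizationRep π v (unitizationRep π w x) := by
  rw [map_mul]
  rfl

theorem rep_mem_repRange {π : B →⋆ₙₐ[ℂ] (H →L[ℂ] H)} {P : Unitization ℂ B} {b : B}
    (hb : P * (b : Unitization ℂ B) = b) (v : H) : π b v ∈ repRange π P := by
  rw [mem_repRange, ← unitizationRep_inr π b, ← unitizationRep_mul_apply, hb]

/-- The representation of a corner on the range of the projection. -/
noncomputable def cornerRep (π : B →⋆ₙₐ[ℂ] (H →L[ℂ] H)) (P : Unitization ℂ B) (hP : IsStarProjection P) :
    unitizationCorner P hP →⋆ₙₐ[ℂ] (repRange π P →L[ℂ] repRange π P) where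
  toFun b := ((π b).comp (repRange π P).subtypeL).codRestrict _ fun v => rep_mem_repRange b.2.1 _
  map_smul' c b := by
    ext v
    exact congrArg (fun T => T (v : H)) (map_smul π c (b : B))
  map_zero' := by
    ext v
    exact congrArg (fun T => T (v : H)) (map_zero π)
  map_add' a b := by
    ext v
    exact congrArg (fun T => T (v : H)) (map_add π (a : B) b)
  map_mul' a b := by
    ext v
    exact congrArg (fun T => T (v : H)) (map_mul π (a : B) b)
  map_star' b := by
    rw [ContinuousLinearMap.star_eq_adjoint, ContinuousLinearMap.eq_adjoint_iff]
    intro v w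
    exact (inner_rep_right π (b : B) (v : H) (w : H)).symm

theorem coe_cornerRep_apply (π : B →⋆ₙₐ[ℂ] (H →L[ℂ] H)) (P : Unitization ℂ B)
    (hP : IsStarProjection P) (b : unitizationCorner P hP) (v : repRange π P) :
    (cornerRep π P hP b v : H) = π b v := rfl

theorem coe_unitizationRep_cornerRep (π : B →⋆ₙₐ[ℂ] (H →L[ℂ] H)) (P : Unitization ℂ B)
    (hP : IsStarProjection P) (w : Unitization ℂ (unitizationCorner P hP)) (v : repRange π P) :
    (unitizationRep (cornerRep π P hP) w v : H) =
      unitizationRep π (unitizationCornerMap P hP w) v := by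
  induction w with
  | inl_add_inr r c =>
    rw [map_add, map_add, map_add, unitizationCornerMap_inr, unitizationRep_inr, unitizationRep_inr]
    have h1 : unitizationRep (cornerRep π P hP) (Unitization.inl r) = r • 1 :=
      (AlgHomClass.commutes (unitizationRep (cornerRep π P hP)) r).trans
        (Algebra.algebraMap_eq_smul_one r)
    have h2 : unitizationCornerMap P hP (Unitization.inl r) = r • P := by
      change r • P + ((0 : B) : Unitization ℂ B) = r • P
      simp
    rw [h1, h2, map_smul]
    rw [add_apply, add_apply, smul_apply, smul_apply, Submodule.coe_add, Submodule.coe_smul,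
      mem_repRange.mp v.2, coe_cornerRep_apply]
    rfl

theorem exists_inr_eq_mul_mul (P : Unitization ℂ B) (b : B) :
    ∃ c : B, (c : Unitization ℂ B) = P * (b : Unitization ℂ B) * P := by
  refine ⟨(P * (b : Unitization ℂ B) * P).snd, ?_⟩
  apply Unitization.ext <;> simp

/-- Extend the operator by zero off the range of `P`, approximate it by some `b`, and compress `b`
to `PbP`. -/
theorem IsDenseRep.cornerRep {π : B →⋆ₙₐ[ℂ] (H →L[ℂ] H)} (hπ : IsDenseRep π)
    (P : Unitization ℂ B) (hP : IsStarProjection P) : IsDenseRep (cornerRep π P hP) := by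
  classical
  intro s T ε hε
  have hc : ∀ v, unitizationRep π P v ∈ repRange π P := fun v => by
    rw [mem_repRange, ← unitizationRep_mul_apply, hP.isIdempotentElem.eq]
  let T' : H →L[ℂ] H := (repRange π P).subtypeL.comp
    (T.comp ((unitizationRep π P).codRestrict _ hc))
  obtain ⟨b, hb⟩ := hπ (s.image (↑)) T' (ε / (‖unitizationRep π P‖ + 1)) (by positivity)
  obtain ⟨c, hcb⟩ := exists_inr_eq_mul_mul P b
  have hPP := hP.isIdempotentElem.eq
  have hcm : c ∈ unitizationCorner P hP := by
    constructor
    · rw [hcb, ← mul_assoc, ← mul_assoc, hPP]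
    · rw [hcb, mul_assoc, hPP]
  refine ⟨⟨c, hcm⟩, fun v hv => ?_⟩
  have h1 := hb v (Finset.mem_image_of_mem _ hv)
  have hv' := mem_repRange.mp v.2
  have h2 : T' v = T v := by
    change ((T ⟨unitizationRep π P v, _⟩ : repRange π P) : H) = T v
    congr 2
    exact Subtype.ext hv'
  have h3 : ((_root_.cornerRep π P hP ⟨c, hcm⟩ v - T v : repRange π P) : H) =
      unitizationRep π P (π b v - T' v) := by
    rw [h2, map_sub, mem_repRange.mp (T v).2, Submodule.coe_sub, coe_cornerRep_apply,
      ← unitizationRep_inr π c, hcb, unitizationRep_mul_apply, unitizationRep_mul_apply, hv',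
      unitizationRep_inr]
  rw [Submodule.coe_norm, h3]
  calc _ ≤ ‖unitizationRep π P‖ * ‖π b v - T' v‖ := ContinuousLinearMap.le_opNorm _ _
    _ ≤ (‖unitizationRep π P‖ + 1) * ‖π b v - T' v‖ := by gcongr; linarith
    _ < (‖unitizationRep π P‖ + 1) * (ε / (‖unitizationRep π P‖ + 1)) := by gcongr
    _ = ε := by field_simp

/-- A continuous path of unitaries of the corner at `P` starting at `P`. -/
structure IsCornerPath (P : Unitization ℂ B) (z : unitInterval → Unitization ℂ B) : Prop where
  continuous : Continuous z
  mul_left : ∀ t, P * z t = z t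
  mul_right : ∀ t, z t * P = z t
  star_mul_self : ∀ t, star (z t) * z t = P
  mul_star_self : ∀ t, z t * star (z t) = P
  map_zero : z 0 = P

theorem IsUnitaryPath.isCornerPath {P : Unitization ℂ B} {hP : IsStarProjection P}
    {w : unitInterval → Unitization ℂ (unitizationCorner P hP)} (hw : IsUnitaryPath w) :
    IsCornerPath P fun t => unitizationCornerMap P hP (w t) where
  continuous := (map_continuous (unitizationCornerMap P hP)).comp hw.continuous
  mul_left t := by
    have := map_mul (unitizationCornerMap P hP) 1 (w t)
    rwa [one_mul, unitizationCornerMap_one, eq_comm] at this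
  mul_right t := by
    have := map_mul (unitizationCornerMap P hP) (w t) 1
    rwa [mul_one, unitizationCornerMap_one, eq_comm] at this
  star_mul_self t := by
    rw [← map_star, ← map_mul, Unitary.star_mul_self_of_mem (hw.mem_unitary t),
      unitizationCornerMap_one]
  mul_star_self t := by
    rw [← map_star, ← map_mul, Unitary.mul_star_self_of_mem (hw.mem_unitary t),
      unitizationCornerMap_one]
  map_zero := by rw [hw.map_zero, unitizationCornerMap_one]

/-- The two paths live in orthogonal corners, so all cross terms vanish and the squares add up to `P
+ Q = 1`. -/
theorem IsCornerPath.add {P Q : Unitization ℂ B} (hPQ : P * Q = 0) (hQP : Q * P = 0)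
    (hP : IsStarProjection P) (hQ : IsStarProjection Q)
    (h1 : P + Q = 1) {y z : unitInterval → Unitization ℂ B} (hy : IsCornerPath P y)
    (hz : IsCornerPath Q z) : IsUnitaryPath fun t => y t + z t where
  continuous := hy.continuous.add hz.continuous
  mem_unitary t := by
    have e1 : star (y t) * z t = 0 := by
      rw [← hy.mul_left t, ← hz.mul_left t, star_mul, hP.isSelfAdjoint.star_eq, mul_assoc,
        ← mul_assoc P, hPQ, zero_mul, mul_zero]
    have e2 : star (z t) * y t = 0 := by
      rw [← hy.mul_left t, ← hz.mul_left t, star_mul, hQ.isSelfAdjoint.star_eq, mul_assoc,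
        ← mul_assoc Q, hQP, zero_mul, mul_zero]
    have e3 : y t * star (z t) = 0 := by
      rw [← hy.mul_right t, ← hz.mul_right t, star_mul, hQ.isSelfAdjoint.star_eq, mul_assoc,
        ← mul_assoc P, hPQ, zero_mul, mul_zero]
    have e4 : z t * star (y t) = 0 := by
      rw [← hy.mul_right t, ← hz.mul_right t, star_mul, hP.isSelfAdjoint.star_eq, mul_assoc,
        ← mul_assoc Q, hQP, zero_mul, mul_zero]
    rw [Unitary.mem_iff, star_add]
    constructor
    · rw [add_mul, mul_add, mul_add, e1, e2, hy.star_mul_self, hz.star_mul_self, add_zero, zero_add,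
        h1]
    · rw [add_mul, mul_add, mul_add, e3, e4, hy.mul_star_self, hz.mul_star_self, add_zero, zero_add,
        h1]
  map_zero := by rw [hy.map_zero, hz.map_zero, h1]

theorem inner_real_smul_smul (c : ℝ) (T : H →L[ℂ] H) (v : H) :
    ⟪(c : ℂ) • v, T ((c : ℂ) • v)⟫_ℂ = (c ^ 2 : ℝ) * ⟪v, T v⟫_ℂ := by
  rw [map_smul, inner_smul_left, inner_smul_right, Complex.conj_ofReal]
  push_cast
  ring

/-- The relative property is applied to the corner at `P` acting densely on the range of `P`, where
`P` is the identity. The vectors will be components of unit vectors, so their common norm is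
arbitrary, possibly zero, and closeness is measured relative to `‖ξ‖²`. -/
theorem RelativeVectorPathProperty.exists_cornerPath {A : Type u} [NonUnitalCStarAlgebra A]
    {S : Set A} (hA : RelativeVectorPathProperty A S) (F : Finset A) {ε : ℝ} (hε : 0 < ε) :
    ∃ (G : Finset A) (δ : ℝ), 0 < δ ∧
    ∀ (B : Type u) [NonUnitalCStarAlgebra B] (P : Unitization ℂ B), IsStarProjection P →
      ∀ (ι : A →⋆ₙₐ[ℂ] B), (∀ x, P * (ι x : Unitization ℂ B) = ι x) →
      (∀ s ∈ S, (ι s : Unitization ℂ B) = P) →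
      ∀ (H : Type u) [NormedAddCommGroup H] [InnerProductSpace ℂ H] [CompleteSpace H]
      (π : B →⋆ₙₐ[ℂ] (H →L[ℂ] H)), IsDenseRep π → ∀ ξ η : H, unitizationRep π P ξ = ξ →
        unitizationRep π P η = η → ‖ξ‖ = ‖η‖ →
        (∀ x ∈ G, ‖⟪ξ, π (ι x) ξ⟫_ℂ - ⟪η, π (ι x) η⟫_ℂ‖ ≤ δ * ‖ξ‖ ^ 2) →
        ∃ z : unitInterval → Unitization ℂ B, IsCornerPath P z ∧ unitizationRep π (z 1) ξ = η ∧
          ∀ x ∈ F, ∀ t, ‖z t * (ι x : Unitization ℂ B) - (ι x : Unitization ℂ B) * z t‖ < ε := by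
  obtain ⟨G, δ, hδ, h⟩ := hA F ε hε
  -- The halving turns the non-strict relative bound into a strict one after normalisation.
  refine ⟨G, δ / 2, half_pos hδ, ?_⟩
  intro B _ P hP ι hPι hS H _ _ _ π hπ ξ η hξ hη hn hG
  have hιP : ∀ x, (ι x : Unitization ℂ B) * P = ι x := fun x => by
    have := congrArg star (hPι (star x))
    rwa [star_mul, hP.isSelfAdjoint.star_eq, ← Unitization.inr_star, map_star, star_star] at this
  by_cases h0 : ξ = 0
  · have hη0 : η = 0 := by rw [← norm_eq_zero, ← hn, h0, norm_zero]
    refine ⟨fun _ => P, ⟨continuous_const, fun _ => hP.isIdempotentElem, fun _ =>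
      hP.isIdempotentElem, fun _ => ?_, fun _ => ?_, rfl⟩, ?_, fun x _ t => ?_⟩
    · rw [hP.isSelfAdjoint.star_eq, hP.isIdempotentElem.eq]
    · rw [hP.isSelfAdjoint.star_eq, hP.isIdempotentElem.eq]
    · rw [h0, hη0, map_zero]
    · rw [hPι, hιP, sub_self, norm_zero]
      exact hε
  have hr : 0 < ‖ξ‖ := norm_pos_iff.mpr h0
  let ι' : A →⋆ₙₐ[ℂ] unitizationCorner P hP :=
    NonUnitalStarAlgHom.codRestrict ι _ fun x => ⟨hPι x, hιP x⟩
  have hS' : ∀ s ∈ S, ∀ b : unitizationCorner P hP, ι' s * b = b ∧ b * ι' s = b := by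
    refine fun s hs b => ⟨Subtype.ext ?_, Subtype.ext ?_⟩ <;>
      apply Unitization.inr_injective (R := ℂ)
    · change ((ι s * (b : B) : B) : Unitization ℂ B) = _
      rw [Unitization.inr_mul, hS s hs, b.2.1]
    · change (((b : B) * ι s : B) : Unitization ℂ B) = _
      rw [Unitization.inr_mul, hS s hs, b.2.2]
  let c : ℝ := ‖ξ‖⁻¹
  let K := repRange π P
  let ξ' : K := (c : ℂ) • ⟨ξ, mem_repRange.mpr hξ⟩
  let η' : K := (c : ℂ) • ⟨η, mem_repRange.mpr hη⟩
  have hc : ‖(c : ℂ)‖ = ‖ξ‖⁻¹ := by simp [c]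
  have hξ' : ‖ξ'‖ = 1 := by
    rw [norm_smul, hc, Submodule.coe_norm, inv_mul_cancel₀ hr.ne']
  have hη' : ‖η'‖ = 1 := by
    rw [norm_smul, hc, Submodule.coe_norm, ← hn, inv_mul_cancel₀ hr.ne']
  obtain ⟨w, hw, hw1, hwF⟩ := h _ ι' hS' K (cornerRep π P hP) (hπ.cornerRep P hP) ξ' η' hξ' hη'
    fun x hx => by
      change ‖⟪(c : ℂ) • ξ, π (ι x) ((c : ℂ) • ξ)⟫_ℂ - ⟪(c : ℂ) • η, π (ι x) ((c : ℂ) • η)⟫_ℂ‖ < δ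
      rw [inner_real_smul_smul, inner_real_smul_smul, ← mul_sub, norm_mul, Complex.norm_real,
        Real.norm_of_nonneg (by positivity)]
      calc _ ≤ c ^ 2 * (δ / 2 * ‖ξ‖ ^ 2) := by gcongr; exact hG x hx
        _ = δ / 2 := by simp only [c]; field_simp
        _ < δ := half_lt_self hδ
  refine ⟨_, hw.isCornerPath, ?_, fun x hx t => ?_⟩
  · have h1 : (unitizationRep (cornerRep π P hP) (w 1) ξ' : H) = η' := congrArg _ hw1
    rw [coe_unitizationRep_cornerRep] at h1
    change unitizationRep π (unitizationCornerMap P hP (w 1)) ((c : ℂ) • ξ) = (c : ℂ) • η at h1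
    rw [map_smul] at h1
    exact smul_right_injective _ (by simpa [c] using h0) h1
  · refine lt_of_le_of_lt ?_ (hwF x hx t)
    have h2 : ((ι x : B) : Unitization ℂ B) =
        unitizationCornerMap P hP (ι' x : Unitization ℂ (unitizationCorner P hP)) :=
      (unitizationCornerMap_inr P hP (ι' x)).symm
    rw [h2, ← map_mul, ← map_mul, ← map_sub]
    exact NonUnitalStarAlgHom.norm_apply_le _ _

end Gluing

/-! ### Matching the component norms of two nearby vectors. -/

section Rescaling

open scoped InnerProductSpace

/-- A block diagonal unitary preserves the norms of the components, whereas the profiles `(a, b)`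
and `(a', b')` of the two vectors are only close. Both are moved by at most `τ` to one profile `(α,
β)`. A component of the first vector with squared norm below `τ²/4` is dropped, since normalising it
would magnify errors without control; if none is, `(a', b')` serves. -/
theorem exists_common_profile {a b a' b' τ γ : ℝ} (ha : 0 ≤ a) (hb : 0 ≤ b) (ha' : 0 ≤ a')
    (hb' : 0 ≤ b') (h : a ^ 2 + b ^ 2 = 1) (h' : a' ^ 2 + b' ^ 2 = 1) (hτ : 0 < τ) (hτ1 : τ ≤ 1)
    (hγ : γ ≤ τ ^ 2 / 8) (hclose : |a ^ 2 - a' ^ 2| < γ) :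
    ∃ α β : ℝ, 0 ≤ α ∧ 0 ≤ β ∧ α ^ 2 + β ^ 2 = 1 ∧ (α ≠ 0 → τ ^ 2 / 4 ≤ a ^ 2) ∧
      (β ≠ 0 → τ ^ 2 / 4 ≤ b ^ 2) ∧ (α - a) ^ 2 + (β - b) ^ 2 ≤ τ ^ 2 ∧
      (α - a') ^ 2 + (β - b') ^ 2 ≤ τ ^ 2 := by
  obtain ⟨hl, hr⟩ := abs_lt.mp hclose
  have hττ : τ ^ 2 ≤ 1 := by nlinarith
  have key : ∀ x y : ℝ, 0 ≤ x → 0 ≤ y → x ^ 2 + y ^ 2 = 1 → x ^ 2 ≤ τ ^ 2 / 2 →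
      x ^ 2 + (1 - y) ^ 2 ≤ τ ^ 2 := by
    intro x y hx hy hxy hxτ
    have hy1 : y ≤ 1 := by nlinarith
    have h1 : 1 - y ≤ x ^ 2 := by nlinarith
    nlinarith
  by_cases h1 : a ^ 2 < τ ^ 2 / 4
  · refine ⟨0, 1, le_rfl, zero_le_one, by norm_num, fun h0 => absurd rfl h0, fun _ => by linarith,
      ?_, ?_⟩
    · have := key a b ha hb h (by linarith)
      linarith
    · have := key a' b' ha' hb' h' (by linarith)
      linarith
  by_cases h2 : b ^ 2 < τ ^ 2 / 4
  · refine ⟨1, 0, zero_le_one, le_rfl, by norm_num, fun _ => by linarith, fun h0 => absurd rfl h0,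
      ?_, ?_⟩
    · have := key b a hb ha (by linarith) (by linarith)
      linarith
    · have := key b' a' hb' ha' (by linarith) (by linarith)
      linarith
  · refine ⟨a', b', ha', hb', h', fun _ => by linarith, fun _ => by linarith, ?_, ?_⟩
    · have hd : ∀ x y : ℝ, 0 ≤ x → 0 ≤ y → |x ^ 2 - y ^ 2| < γ → (y - x) ^ 2 ≤ γ := by
        intro x y hx hy hxy
        have h3 : (y - x) ^ 2 ≤ |x ^ 2 - y ^ 2| := by
          have : x ^ 2 - y ^ 2 = (x - y) * (x + y) := by ring
          rw [this, abs_mul, abs_of_nonneg (add_nonneg hx hy)]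
          have h4 : |x - y| ≤ x + y := abs_sub_le_iff.mpr ⟨by linarith, by linarith⟩
          calc (y - x) ^ 2 = |x - y| * |x - y| := by rw [← sq, sq_abs]; ring
            _ ≤ _ := by gcongr
        linarith
      have h3 := hd a a' ha ha' hclose
      have h4 := hd b b' hb hb' (by
        have : b ^ 2 - b' ^ 2 = -(a ^ 2 - a' ^ 2) := by linarith
        rwa [this, abs_neg])
      nlinarith
    · rw [sub_self, sub_self]
      nlinarith

variable {H : Type*} [NormedAddCommGroup H] [InnerProductSpace ℂ H]

theorem norm_sq_smul_add_smul {x y : H} (hxy : ⟪x, y⟫_ℂ = 0) (c d : ℝ) :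
    ‖(c : ℂ) • x + (d : ℂ) • y‖ ^ 2 = (c * ‖x‖) ^ 2 + (d * ‖y‖) ^ 2 := by
  have h : ⟪(c : ℂ) • x, (d : ℂ) • y⟫_ℂ = 0 := by
    rw [inner_smul_left, inner_smul_right, hxy, mul_zero, mul_zero]
  rw [sq, norm_add_sq_eq_norm_sq_add_norm_sq_of_inner_eq_zero _ _ h,norm_smul, norm_smul, Complex.norm_real, Complex.norm_real, Real.norm_eq_abs,
    Real.norm_eq_abs]
  linear_combination ‖x‖ ^ 2 * abs_mul_abs_self c + ‖y‖ ^ 2 * abs_mul_abs_self d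

theorem norm_rescale {x : H} {α : ℝ} (hα : 0 ≤ α) (h : α ≠ 0 → x ≠ 0) :
    ‖((α / ‖x‖ : ℝ) : ℂ) • x‖ = α := by
  rw [norm_smul, Complex.norm_real, Real.norm_of_nonneg (by positivity)]
  by_cases h0 : α = 0
  · simp [h0]
  · exact div_mul_cancel₀ _ (norm_ne_zero_iff.mpr (h h0))

theorem norm_sub_rescale_sq {x y : H} (hxy : ⟪x, y⟫_ℂ = 0) {α β : ℝ} (hα : α ≠ 0 → x ≠ 0)
    (hβ : β ≠ 0 → y ≠ 0) :
    ‖x + y - (((α / ‖x‖ : ℝ) : ℂ) • x + ((β / ‖y‖ : ℝ) : ℂ) • y)‖ ^ 2 =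
      (α - ‖x‖) ^ 2 + (β - ‖y‖) ^ 2 := by
  have key : ∀ {z : H} {c : ℝ}, (c ≠ 0 → z ≠ 0) → ((1 - c / ‖z‖) * ‖z‖) ^ 2 = (c - ‖z‖) ^ 2 := by
    intro z c h
    by_cases hz : z = 0
    · have : c = 0 := by
        by_contra h0
        exact h h0 hz
      simp [hz, this]
    · have : ‖z‖ ≠ 0 := norm_ne_zero_iff.mpr hz
      field_simp
      ring
  rw [← key hα, ← key hβ, ← norm_sq_smul_add_smul hxy]
  congr 2
  push_cast
  module

/-- Normalising divides errors by `‖v‖² ≥ κ`. The error consists of `γ` from the inner products and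
`γm` from replacing `‖v‖` by `‖w‖` in the normalisation. -/
theorem norm_rescaled_inner_sub_le [CompleteSpace H] {T : H →L[ℂ] H} {m γ κ δ α : ℝ} (hT : ‖T‖ ≤ m) {v w : H}
    (hκ : 0 < κ) (hγ0 : 0 ≤ γ)
    (h : ‖⟪v, T v⟫_ℂ - ⟪w, T w⟫_ℂ‖ ≤ γ) (h' : |‖v‖ ^ 2 - ‖w‖ ^ 2| ≤ γ) (hα : α ≠ 0 → κ ≤ ‖v‖ ^ 2)
    (hγ : γ ≤ κ / 2) (hδ : γ * (1 + m) ≤ δ * κ) :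
    ‖⟪((α / ‖v‖ : ℝ) : ℂ) • v, T (((α / ‖v‖ : ℝ) : ℂ) • v)⟫_ℂ -
      ⟪((α / ‖w‖ : ℝ) : ℂ) • w, T (((α / ‖w‖ : ℝ) : ℂ) • w)⟫_ℂ‖ ≤ δ * α ^ 2 := by
  rw [inner_real_smul_smul, inner_real_smul_smul]
  by_cases h0 : α = 0
  · simp [h0]
  have hv := hα h0
  have hw : 0 < ‖w‖ ^ 2 := by
    have := (abs_le.mp h').2
    linarith
  set X := ⟪v, T v⟫_ℂ
  set Y := ⟪w, T w⟫_ℂ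
  have hv0 : 0 < ‖v‖ ^ 2 := hκ.trans_le hv
  have hY : ‖Y‖ ≤ m * ‖w‖ ^ 2 := by
    calc ‖Y‖ ≤ ‖w‖ * ‖T w‖ := norm_inner_le_norm _ _
      _ ≤ ‖w‖ * (m * ‖w‖) := by gcongr; exact T.le_of_opNorm_le hT w
      _ = _ := by ring
  have e : ((α / ‖v‖) ^ 2 : ℝ) * X - ((α / ‖w‖) ^ 2 : ℝ) * Y =
      ((α ^ 2 / ‖v‖ ^ 2 : ℝ) : ℂ) * ((X - Y) + ((‖w‖ ^ 2 - ‖v‖ ^ 2) / ‖w‖ ^ 2 : ℝ) * Y) := by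
    have hv1 : (‖v‖ : ℂ) ≠ 0 := by
      intro h3
      rw [Complex.ofReal_eq_zero] at h3
      simp [h3] at hv0
    have hw1 : (‖w‖ : ℂ) ≠ 0 := by
      intro h3
      rw [Complex.ofReal_eq_zero] at h3
      simp [h3] at hw
    push_cast
    field_simp
    ring
  rw [e, norm_mul, Complex.norm_real, Real.norm_of_nonneg (by positivity)]
  have h2 : ‖(((‖w‖ ^ 2 - ‖v‖ ^ 2) / ‖w‖ ^ 2 : ℝ) : ℂ) * Y‖ ≤ γ * m := by
    rw [norm_mul, Complex.norm_real, norm_div, Real.norm_of_nonneg hw.le, Real.norm_eq_abs,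
      abs_sub_comm]
    calc _ ≤ γ / ‖w‖ ^ 2 * (m * ‖w‖ ^ 2) := by gcongr
      _ = γ / ‖w‖ ^ 2 * ‖w‖ ^ 2 * m := by ring
      _ = _ := by rw [div_mul_cancel₀ _ hw.ne']
  calc _ ≤ α ^ 2 / ‖v‖ ^ 2 * (γ + γ * m) := by
        gcongr
        exact (norm_add_le _ _).trans (add_le_add h h2)
    _ ≤ α ^ 2 / ‖v‖ ^ 2 * (δ * κ) := by gcongr; linarith
    _ ≤ α ^ 2 / ‖v‖ ^ 2 * (δ * ‖v‖ ^ 2) := by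
        have : 0 ≤ δ := by
          have hm : 0 ≤ m := (norm_nonneg T).trans hT
          have h4 : 0 ≤ δ * κ := le_trans (by positivity) hδ
          exact nonneg_of_mul_nonneg_left h4 hκ
        gcongr
    _ = α ^ 2 / ‖v‖ ^ 2 * ‖v‖ ^ 2 * δ := by ring
    _ = _ := by rw [div_mul_cancel₀ _ hv0.ne', mul_comm]

end Rescaling

/-! ### The gluing theorem. -/

section GluingTheorem

open scoped InnerProductSpace CStarAlgebra ComplexOrder

variable {B : Type u} [NonUnitalCStarAlgebra B]
variable {H : Type u} [NormedAddCommGroup H] [InnerProductSpace ℂ H] [CompleteSpace H]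

theorem inner_rep_cut (π : B →⋆ₙₐ[ℂ] (H →L[ℂ] H)) {P : Unitization ℂ B} (hP : IsStarProjection P)
    {b : B} (hb : P * (b : Unitization ℂ B) = b) (hb' : (b : Unitization ℂ B) * P = b) (ξ : H) :
    ⟪unitizationRep π P ξ, π b (unitizationRep π P ξ)⟫_ℂ = ⟪ξ, π b ξ⟫_ℂ := by
  rw [inner_star_unitizationRep_left, hP.isSelfAdjoint.star_eq, ← unitizationRep_inr π b,
    ← unitizationRep_mul_apply, ← unitizationRep_mul_apply, hb, hb']

theorem inner_unitizationRep_self (π : B →⋆ₙₐ[ℂ] (H →L[ℂ] H)) {P : Unitization ℂ B}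
    (hP : IsStarProjection P) (ξ : H) :
    ⟪ξ, unitizationRep π P ξ⟫_ℂ = ((‖unitizationRep π P ξ‖ ^ 2 : ℝ) : ℂ) := by
  have h := inner_self_eq_norm_sq_to_K (𝕜 := ℂ) (unitizationRep π P ξ)
  rw [inner_star_unitizationRep_left, hP.isSelfAdjoint.star_eq, ← unitizationRep_mul_apply,
    hP.isIdempotentElem.eq] at h
  rw [h, Complex.ofReal_pow]
  rfl

/-- The constant is `12` from `IsDenseRep.exists_path_of_norm_sub_le`, doubled by
`norm_commutator_le`. -/
theorem exists_small_path {π : B →⋆ₙₐ[ℂ] (H →L[ℂ] H)} (hπ : IsDenseRep π) {ξ ζ : H}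
    (hξ : ‖ξ‖ = 1) (hζ : ‖ζ‖ = 1) {τ : ℝ} (hτ : 0 ≤ τ) (hτ1 : τ ≤ 1) (hd : ‖ξ - ζ‖ ^ 2 ≤ τ ^ 2) :
    ∃ u : unitInterval → Unitization ℂ B, IsUnitaryPath u ∧ unitizationRep π (u 1) ξ = ζ ∧
      ∀ t (x : Unitization ℂ B), ‖u t * x - x * u t‖ ≤ 24 * τ * ‖x‖ := by
  have hd' := abs_le_of_sq_le_sq hd hτ
  rw [abs_of_nonneg (norm_nonneg _)] at hd'
  obtain ⟨u, hu, hu1, hun⟩ := hπ.exists_path_of_norm_sub_le hξ hζ (hd'.trans hτ1)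
  refine ⟨u, hu, hu1, fun t x => (norm_commutator_le _ _).trans ?_⟩
  have := hun t
  exact mul_le_mul_of_nonneg_right (by linarith) (norm_nonneg _)

/-- With `P = ι(e)` and `Q = 1 - P`, short paths move `ξ` and `η` to vectors with a common profile
of `P`- and `Q`-components. The properties of `A₁` and `A₂` join these components inside the two
corners. Each corner path commutes exactly with the image of the other summand. -/
theorem VectorPathProperty.of_decomposition {A A₁ A₂ : Type u} [NonUnitalCStarAlgebra A]
    [NonUnitalCStarAlgebra A₁] [NonUnitalCStarAlgebra A₂] {S : Set A₁}
    (hA₁ : RelativeVectorPathProperty A₁ S) (hA₂ : VectorPathProperty A₂) {e : A}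
    (he : IsStarProjection e) (σ₁ : A₁ →⋆ₙₐ[ℂ] A) (σ₂ : A₂ →⋆ₙₐ[ℂ] A) (hS : ∀ s ∈ S, σ₁ s = e)
    (h₁ : ∀ x, e * σ₁ x = σ₁ x) (h₂ : ∀ x, e * σ₂ x = 0) (hsum : ∀ x, ∃ x₁ x₂, σ₁ x₁ + σ₂ x₂ = x) :
    VectorPathProperty A := by
  classical
  choose p₁ p₂ hp using hsum
  intro F ε hε
  obtain ⟨G₁, δ₁, hδ₁, hG₁⟩ := hA₁.exists_cornerPath (F.image p₁) (ε := ε / 6) (by positivity)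
  obtain ⟨G₂, δ₂, hδ₂, hG₂⟩ :=
    (hA₂.relative ∅).exists_cornerPath (F.image p₂) (ε := ε / 6) (by positivity)
  let M : ℝ := 1 + ∑ x ∈ F, ‖x‖
  have hM0 : 0 ≤ ∑ x ∈ F, ‖x‖ := Finset.sum_nonneg fun x _ => norm_nonneg x
  have hM : ∀ x ∈ F, ‖x‖ ≤ M := fun x hx => by
    have := Finset.single_le_sum (fun x _ => norm_nonneg x) hx
    simp only [M]
    linarith
  have hMpos : 0 < M := by simp only [M]; linarith
  -- Chosen so that each of the two short paths costs at most `24τM ≤ ε/6` in commutators.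
  let τ : ℝ := min 1 (ε / (144 * M))
  have hτ : 0 < τ := lt_min one_pos (by positivity)
  have hτ1 : τ ≤ 1 := min_le_left _ _
  have hτM : 24 * τ * M ≤ ε / 6 := by
    have : τ ≤ ε / (144 * M) := min_le_right _ _
    calc 24 * τ * M ≤ 24 * (ε / (144 * M)) * M := by gcongr
      _ = ε / 6 := by field_simp; norm_num
  let m : ℝ := ∑ x ∈ G₁, ‖x‖ + ∑ x ∈ G₂, ‖x‖
  have hm1 : 0 ≤ ∑ x ∈ G₁, ‖x‖ := Finset.sum_nonneg fun x _ => norm_nonneg x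
  have hm2 : 0 ≤ ∑ x ∈ G₂, ‖x‖ := Finset.sum_nonneg fun x _ => norm_nonneg x
  have hG₁m : ∀ x ∈ G₁, ‖x‖ ≤ m := fun x hx =>
    (Finset.single_le_sum (fun x _ => norm_nonneg x) hx).trans (le_add_of_nonneg_right hm2)
  have hG₂m : ∀ x ∈ G₂, ‖x‖ ≤ m := fun x hx =>
    (Finset.single_le_sum (fun x _ => norm_nonneg x) hx).trans (le_add_of_nonneg_left hm1)
  have hm : 0 ≤ m := add_nonneg hm1 hm2
  let κ : ℝ := τ ^ 2 / 4
  have hκ : 0 < κ := by positivity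
  -- The first bound keeps the components of `η` nonzero wherever those of `ξ` are retained. The
  -- second gives closeness within `δ₁` and `δ₂` after rescaling.
  let γ : ℝ := min (κ / 2) (min δ₁ δ₂ * κ / (1 + m))
  have hγ : 0 < γ := lt_min (by positivity) (by have := lt_min hδ₁ hδ₂; positivity)
  have hγκ : γ ≤ κ / 2 := min_le_left _ _
  have hγm : γ * (1 + m) ≤ min δ₁ δ₂ * κ := by
    rw [← le_div_iff₀ (by positivity)]
    exact min_le_right _ _
  have hγ₁ : γ * (1 + m) ≤ δ₁ * κ := hγm.trans (by gcongr; exact min_le_left _ _)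
  have hγ₂ : γ * (1 + m) ≤ δ₂ * κ := hγm.trans (by gcongr; exact min_le_right _ _)
  -- Testing on `e` compares `‖Pξ‖²` with `‖Pη‖²`.
  refine ⟨insert e (G₁.image σ₁ ∪ G₂.image σ₂), γ, hγ, ?_⟩
  intro B _ ι H _ _ _ π hπ ξ η hξ hη hclose
  have hce := hclose e (Finset.mem_insert_self _ _)
  have hc₁ : ∀ x ∈ G₁, _ := fun x hx => hclose (σ₁ x)
    (Finset.mem_insert_of_mem (Finset.mem_union_left _ (Finset.mem_image_of_mem _ hx)))
  have hc₂ : ∀ x ∈ G₂, _ := fun x hx => hclose (σ₂ x)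
    (Finset.mem_insert_of_mem (Finset.mem_union_right _ (Finset.mem_image_of_mem _ hx)))
  obtain ⟨P, hPe⟩ : ∃ P : Unitization ℂ B, P = (ι e : B) := ⟨_, rfl⟩
  have hP : IsStarProjection P := by
    refine ⟨?_, ?_⟩
    · change P * P = P
      rw [hPe, ← Unitization.inr_mul, ← map_mul, he.isIdempotentElem.eq]
    · change star P = P
      rw [hPe, ← Unitization.inr_star, ← map_star, he.isSelfAdjoint.star_eq]
  obtain ⟨Q, hQe⟩ : ∃ Q : Unitization ℂ B, Q = 1 - P := ⟨_, rfl⟩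
  have hQ : IsStarProjection Q := hQe ▸ hP.one_sub
  have hPP := hP.isIdempotentElem.eq
  have hPQ : P * Q = 0 := by rw [hQe, mul_sub, mul_one, hPP, sub_self]
  have hQP : Q * P = 0 := by rw [hQe, sub_mul, one_mul, hPP, sub_self]
  have hPQ1 : P + Q = 1 := by rw [hQe, add_sub_cancel]
  have hι₁ : ∀ x, P * ((ι.comp σ₁ x : B) : Unitization ℂ B) = ((ι.comp σ₁ x : B) : _) := fun x => by
    rw [hPe, ← Unitization.inr_mul, NonUnitalStarAlgHom.comp_apply, ← map_mul, h₁]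
  have hι₂' : ∀ x, P * ((ι.comp σ₂ x : B) : Unitization ℂ B) = 0 := fun x => by
    rw [hPe, ← Unitization.inr_mul, NonUnitalStarAlgHom.comp_apply, ← map_mul, h₂, map_zero,
      Unitization.inr_zero]
  have hι₂ : ∀ x, Q * ((ι.comp σ₂ x : B) : Unitization ℂ B) = ((ι.comp σ₂ x : B) : _) := fun x => by
    rw [hQe, sub_mul, hι₂', one_mul, sub_zero]
  have hstar : ∀ {R : Unitization ℂ B} (hR : IsStarProjection R) {D : Type u}
      [NonUnitalCStarAlgebra D] (f : D →⋆ₙₐ[ℂ] B)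
      (_ : ∀ x, R * ((f x : B) : Unitization ℂ B) = ((f x : B) : Unitization ℂ B)) (x : D),
      ((f x : B) : Unitization ℂ B) * R = ((f x : B) : Unitization ℂ B) := by
    intro R hR D _ f hf x
    have := congrArg star (hf (star x))
    rwa [star_mul, hR.isSelfAdjoint.star_eq, ← Unitization.inr_star, map_star, star_star] at this
  have hι₁' := hstar hP _ hι₁
  have hι₂'' := hstar hQ _ hι₂
  have hSP : ∀ s ∈ S, ((ι.comp σ₁ s : B) : Unitization ℂ B) = P := fun s hs => by
    rw [NonUnitalStarAlgHom.comp_apply, hS s hs, hPe]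
  have hdec : ∀ v : H, unitizationRep π P v + unitizationRep π Q v = v := fun v => by
    rw [← add_apply, ← map_add, hPQ1, map_one]
    rfl
  have horth : ∀ v : H, ⟪unitizationRep π P v, unitizationRep π Q v⟫_ℂ = 0 := fun v => by
    rw [inner_star_unitizationRep_left, hP.isSelfAdjoint.star_eq, ← unitizationRep_mul_apply, hPQ,
      map_zero]
    exact inner_zero_right _
  have hpyth : ∀ v : H, ‖v‖ = 1 → ‖unitizationRep π P v‖ ^ 2 + ‖unitizationRep π Q v‖ ^ 2 = 1 := by
    intro v hv
    have := norm_sq_smul_add_smul (horth v) 1 1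
    simp only [Complex.ofReal_one, one_smul, hdec, hv, one_mul, one_pow] at this
    exact this.symm
  have hprofP : |‖unitizationRep π P ξ‖ ^ 2 - ‖unitizationRep π P η‖ ^ 2| < γ := by
    rw [← unitizationRep_inr π, ← hPe, inner_unitizationRep_self π hP,
      inner_unitizationRep_self π hP, ← Complex.ofReal_sub, Complex.norm_real,
      Real.norm_eq_abs] at hce
    exact hce
  have hprofQ : |‖unitizationRep π Q ξ‖ ^ 2 - ‖unitizationRep π Q η‖ ^ 2| < γ := by
    have h1 := hpyth ξ hξ
    have h2 := hpyth η hη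
    have h3 : ‖unitizationRep π Q ξ‖ ^ 2 - ‖unitizationRep π Q η‖ ^ 2 =
        -(‖unitizationRep π P ξ‖ ^ 2 - ‖unitizationRep π P η‖ ^ 2) := by linarith
    rwa [h3, abs_neg]
  obtain ⟨α, β, hα, hβ, hαβ, hακ, hβκ, hdξ, hdη⟩ := exists_common_profile (norm_nonneg _)
    (norm_nonneg _) (norm_nonneg _) (norm_nonneg _) (hpyth ξ hξ) (hpyth η hη) hτ hτ1
    (γ := γ) (hγκ.trans (by simp only [κ]; linarith)) hprofP
  have hne : ∀ {c : ℝ} {v w : H}, (c ≠ 0 → κ ≤ ‖v‖ ^ 2) → |‖v‖ ^ 2 - ‖w‖ ^ 2| < γ →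
      (c ≠ 0 → v ≠ 0) ∧ (c ≠ 0 → w ≠ 0) := by
    intro c v w hv hvw
    refine ⟨fun hc h0 => ?_, fun hc h0 => ?_⟩
    · have := hv hc
      rw [h0, norm_zero] at this
      linarith
    · have h4 := hv hc
      have h5 := (abs_lt.mp hvw).2
      rw [h0, norm_zero] at h5
      linarith
  obtain ⟨hPξ, hPη⟩ := hne hακ hprofP
  obtain ⟨hQξ, hQη⟩ := hne hβκ hprofQ
  let r : ℝ → H → H := fun c v => ((c / ‖v‖ : ℝ) : ℂ) • v
  have hr : ∀ (R : Unitization ℂ B), IsStarProjection R → ∀ c v,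
      unitizationRep π R (r c (unitizationRep π R v)) = r c (unitizationRep π R v) := by
    intro R hR c v
    simp only [r]
    rw [map_smul, ← unitizationRep_mul_apply, hR.isIdempotentElem.eq]
  have hunit : ∀ v : H, (α ≠ 0 → unitizationRep π P v ≠ 0) → (β ≠ 0 → unitizationRep π Q v ≠ 0) →
      ‖r α (unitizationRep π P v) + r β (unitizationRep π Q v)‖ = 1 := by
    intro v h1 h2
    have h3 : ‖r α (unitizationRep π P v) + r β (unitizationRep π Q v)‖ ^ 2 = 1 := by
      rw [norm_sq_smul_add_smul (horth v)]
      have h4 := norm_rescale hα h1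
      have h5 := norm_rescale hβ h2
      rw [norm_smul, Complex.norm_real, Real.norm_of_nonneg (by positivity)] at h4 h5
      rw [h4, h5, hαβ]
    exact (pow_eq_one_iff_of_nonneg (norm_nonneg _) two_ne_zero).mp h3
  have hdist : ∀ v : H, (α ≠ 0 → unitizationRep π P v ≠ 0) → (β ≠ 0 → unitizationRep π Q v ≠ 0) →
      ‖v - (r α (unitizationRep π P v) + r β (unitizationRep π Q v))‖ ^ 2 =
        (α - ‖unitizationRep π P v‖) ^ 2 + (β - ‖unitizationRep π Q v‖) ^ 2 := by
    intro v h1 h2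
    have := norm_sub_rescale_sq (horth v) h1 h2
    rwa [hdec] at this
  have hop : ∀ {D : Type u} [NonUnitalCStarAlgebra D] (f : D →⋆ₙₐ[ℂ] B) (x : D), ‖π (f x)‖ ≤ ‖x‖ :=
    fun f x => (NonUnitalStarAlgHom.norm_apply_le _ _).trans (NonUnitalStarAlgHom.norm_apply_le _ _)
  obtain ⟨y, hy, hy1, hyF⟩ := hG₁ B P hP (ι.comp σ₁) hι₁ hSP H π hπ (r α (unitizationRep π P ξ))
    (r α (unitizationRep π P η)) (hr P hP _ _) (hr P hP _ _)
    ((norm_rescale hα hPξ).trans (norm_rescale hα hPη).symm) fun x hx => by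
      rw [norm_rescale hα hPξ]
      refine norm_rescaled_inner_sub_le ((hop _ x).trans (hG₁m x hx)) hκ hγ.le ?_ hprofP.le hακ hγκ
        hγ₁
      rw [inner_rep_cut π hP (hι₁ x) (hι₁' x), inner_rep_cut π hP (hι₁ x) (hι₁' x)]
      exact (hc₁ x hx).le
  obtain ⟨z, hz, hz1, hzF⟩ := hG₂ B Q hQ (ι.comp σ₂) hι₂ (fun s hs => absurd hs (by simp)) H π hπ
    (r β (unitizationRep π Q ξ)) (r β (unitizationRep π Q η)) (hr Q hQ _ _) (hr Q hQ _ _)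
    ((norm_rescale hβ hQξ).trans (norm_rescale hβ hQη).symm) fun x hx => by
      rw [norm_rescale hβ hQξ]
      refine norm_rescaled_inner_sub_le ((hop _ x).trans (hG₂m x hx)) hκ hγ.le ?_ hprofQ.le hβκ hγκ
        hγ₂
      rw [inner_rep_cut π hQ (hι₂ x) (hι₂'' x), inner_rep_cut π hQ (hι₂ x) (hι₂'' x)]
      exact (hc₂ x hx).le
  have hu := hy.add hPQ hQP hP hQ hPQ1 hz
  obtain ⟨v, hv, hv1, hvn⟩ := exists_small_path hπ hξ (hunit ξ hPξ hQξ) hτ.le hτ1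
    (by rw [hdist ξ hPξ hQξ]; exact hdξ)
  obtain ⟨w, hw, hw1, hwn⟩ := exists_small_path hπ (hunit η hPη hQη) hη hτ.le hτ1
    (by rw [norm_sub_rev, hdist η hPη hQη]; exact hdη)
  -- `v` moves `ξ` to its rescaling, `y + z` moves this to the rescaling of `η`, and `w` moves that
  -- to `η`. The four paths `v`, `y`, `z`, `w` cost at most `ε/6` each.
  refine ⟨_, hw.mul (hu.mul hv), ?_, fun x hx t => ?_⟩
  · rw [unitizationRep_mul_apply, unitizationRep_mul_apply, hv1, ← hw1]
    congr 1
    have hyQ : unitizationRep π (y 1) (r β (unitizationRep π Q ξ)) = 0 := by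
      have h0 : unitizationRep π P (r β (unitizationRep π Q ξ)) = 0 := by
        rw [← hr Q hQ, ← unitizationRep_mul_apply, hPQ, map_zero]
        rfl
      rw [← hy.mul_right, unitizationRep_mul_apply, h0, map_zero]
    have hzP : unitizationRep π (z 1) (r α (unitizationRep π P ξ)) = 0 := by
      have h0 : unitizationRep π Q (r α (unitizationRep π P ξ)) = 0 := by
        rw [← hr P hP, ← unitizationRep_mul_apply, hQP, map_zero]
        rfl
      rw [← hz.mul_right, unitizationRep_mul_apply, h0, map_zero]
    rw [map_add (unitizationRep π) (y 1), add_apply, map_add, map_add, hyQ, hzP, hy1, hz1, add_zero, zero_add]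
  · have hxn : ‖((ι x : B) : Unitization ℂ B)‖ ≤ M := by
      rw [Unitization.norm_inr]
      exact (NonUnitalStarAlgHom.norm_apply_le _ _).trans (hM x hx)
    have hb : ∀ s : Unitization ℂ B, s * (ι x : Unitization ℂ B) - (ι x : Unitization ℂ B) * s =
        s * ((ι.comp σ₁ (p₁ x) : B) : Unitization ℂ B) -
          ((ι.comp σ₁ (p₁ x) : B) : Unitization ℂ B) * s +
        (s * ((ι.comp σ₂ (p₂ x) : B) : Unitization ℂ B) -
          ((ι.comp σ₂ (p₂ x) : B) : Unitization ℂ B) * s) := by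
      intro s
      nth_rewrite 1 2 [← hp x]
      rw [map_add, Unitization.inr_add]
      simp only [NonUnitalStarAlgHom.comp_apply]
      noncomm_ring
    have hy2 : y t * ((ι.comp σ₂ (p₂ x) : B) : Unitization ℂ B) -
        ((ι.comp σ₂ (p₂ x) : B) : Unitization ℂ B) * y t = 0 := by
      rw [← hι₂ (p₂ x), ← hy.mul_right t, mul_assoc, ← mul_assoc P Q, hPQ, hι₂ (p₂ x),
        ← hι₂'' (p₂ x), hy.mul_right t, ← hy.mul_left t, mul_assoc _ Q, ← mul_assoc Q P, hQP]
      simp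
    have hz2 : z t * ((ι.comp σ₁ (p₁ x) : B) : Unitization ℂ B) -
        ((ι.comp σ₁ (p₁ x) : B) : Unitization ℂ B) * z t = 0 := by
      rw [← hι₁ (p₁ x), ← hz.mul_right t, mul_assoc, ← mul_assoc Q P, hQP, hι₁ (p₁ x),
        ← hι₁' (p₁ x), hz.mul_right t, ← hz.mul_left t, mul_assoc _ P, ← mul_assoc P Q, hPQ]
      simp
    have hyz : ‖(y t + z t) * (ι x : Unitization ℂ B) - (ι x : Unitization ℂ B) * (y t + z t)‖ <
        ε / 6 + ε / 6 := by
      rw [add_mul, mul_add, add_sub_add_comm, hb (y t), hb (z t), hy2, hz2, add_zero, zero_add]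
      exact (norm_add_le _ _).trans_lt (add_lt_add (hyF _ (Finset.mem_image_of_mem _ hx) t)
        (hzF _ (Finset.mem_image_of_mem _ hx) t))
    have hv2 : _ ≤ ε / 6 := (hvn t (ι x : Unitization ℂ B)).trans
      (le_trans (by gcongr) hτM)
    have hw2 : _ ≤ ε / 6 := (hwn t (ι x : Unitization ℂ B)).trans
      (le_trans (by gcongr) hτM)
    have e1 := norm_commutator_mul_le (x := (ι x : Unitization ℂ B)) (hw.mem_unitary t)
      ((hu.mul hv).mem_unitary t)
    have e2 := norm_commutator_mul_le (x := (ι x : Unitization ℂ B)) (hu.mem_unitary t)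
      (hv.mem_unitary t)
    linarith

end GluingTheorem

/-! ### Zero algebras, unital reduction, direct sums and unitizations. -/

section Sums

open scoped InnerProductSpace CStarAlgebra ComplexOrder

/-- There is nothing to commute with, so any path between the vectors will do. This case serves the
complement of `ι(e)` in the reduction to unital homomorphisms. -/
theorem VectorPathProperty.of_subsingleton (A : Type u) [NonUnitalCStarAlgebra A] [Subsingleton A] :
    VectorPathProperty A := by
  intro F ε hε
  refine ⟨∅, 1, one_pos, ?_⟩
  intro B _ ι H _ _ _ π hπ ξ η hξ hη _
  obtain ⟨u, hu, hu1⟩ := hπ.exists_path hξ hη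
  refine ⟨u, hu, hu1, fun x _ t => ?_⟩
  rw [Subsingleton.elim x 0, map_zero, Unitization.inr_zero, mul_zero, zero_mul, sub_zero,
    norm_zero]
  exact hε

instance corner.subsingleton_zero (A : Type u) [NonUnitalCStarAlgebra A] :
    Subsingleton (corner (0 : A) (IsStarProjection.zero A)) :=
  ⟨fun x y => Subtype.ext (by
    rw [← (mem_corner_iff _).mp x.2, ← (mem_corner_iff _).mp y.2]
    simp)⟩

/-- It suffices to treat homomorphisms which are unital. -/
theorem RelativeVectorPathProperty.vectorPathProperty {A : Type u} [NonUnitalCStarAlgebra A] {e : A}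
    (hA : RelativeVectorPathProperty A {e}) (he : IsStarProjection e) (hid : ∀ x, e * x = x) :
    VectorPathProperty A :=
  -- The corner at `0` is a zero algebra in the right universe; it imposes no condition below `1 -
  -- ι(e)`.
  .of_decomposition (A₂ := corner (0 : A) (IsStarProjection.zero A)) hA (.of_subsingleton _) he
    (NonUnitalStarAlgHom.id ℂ A) 0 (fun _ hs => hs) hid (fun _ => mul_zero e)
    (fun x => ⟨x, 0, add_zero x⟩)

theorem VectorPathProperty.prod {A₁ A₂ : Type u} [CStarAlgebra A₁] [CStarAlgebra A₂]
    (h₁ : VectorPathProperty A₁) (h₂ : VectorPathProperty A₂) : VectorPathProperty (A₁ × A₂) :=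
  .of_decomposition (h₁.relative ∅) h₂ (e := (1, 0))
    ⟨Prod.ext (mul_one _) (mul_zero _), Prod.ext (star_one _) (star_zero _)⟩
    (NonUnitalStarAlgHom.inl ℂ A₁ A₂) (NonUnitalStarAlgHom.inr ℂ A₁ A₂)
    (fun _ hs => absurd hs (Set.notMem_empty _)) (fun _ => Prod.ext (one_mul _) (mul_zero _))
    (fun _ => Prod.ext (mul_zero _) (zero_mul _))
    (fun x => ⟨x.1, x.2, Prod.ext (add_zero _) (zero_add _)⟩)

/-- After reduction to unital homomorphisms `ι(1)` is the identity of `B`, which commutes with the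
whole unitization. Scalar parts therefore drop out of the commutators, and `A` controls the rest. -/
theorem VectorPathProperty.unitization {A : Type u} [NonUnitalCStarAlgebra A]
    (hA : VectorPathProperty A) : VectorPathProperty (Unitization ℂ A) := by
  classical
  refine RelativeVectorPathProperty.vectorPathProperty (e := 1) ?_ (IsStarProjection.one _) one_mul
  intro F ε hε
  obtain ⟨G, δ, hδ, h⟩ := hA (F.image fun x => x.snd) ε hε
  refine ⟨G.image (↑), δ, hδ, ?_⟩
  intro B _ ι h1 H _ _ _ π hπ ξ η hξ hη hG
  obtain ⟨u, hu, hu1, huF⟩ := h B (ι.comp (Unitization.inrNonUnitalStarAlgHom ℂ A)) H π hπ ξ η hξ hη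
    fun x hx => hG _ (Finset.mem_image_of_mem _ hx)
  refine ⟨u, hu, hu1, fun x hx t => ?_⟩
  have hc := mul_inr_eq_inr_mul_of_identity (h1 1 rfl) (u t)
  have hx' : ι x = x.fst • ι 1 + ι (x.snd : Unitization ℂ A) := by
    rw [← map_smul, ← map_add]
    congr 1
    apply Unitization.ext <;> simp
  have e : u t * (ι x : Unitization ℂ B) - (ι x : Unitization ℂ B) * u t =
      u t * (ι (x.snd : Unitization ℂ A) : Unitization ℂ B) -
        (ι (x.snd : Unitization ℂ A) : Unitization ℂ B) * u t := by
    rw [hx', Unitization.inr_add, Unitization.inr_smul, mul_add, add_mul, mul_smul_comm,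
      smul_mul_assoc, hc, add_sub_add_left_eq_sub]
  rw [e]
  exact huF _ (Finset.mem_image_of_mem (fun x : Unitization ℂ A => x.snd) hx) t

end Sums

/-! ### Complete positivity of compressions. -/

section MatrixPositivity

open scoped InnerProductSpace CStarAlgebra ComplexOrder

/-- An injective ⋆-homomorphism of C⋆-algebras reflects positivity. -/
theorem exists_star_mul_self_of_map {C D : Type*} [NonUnitalCStarAlgebra C]
    [NonUnitalCStarAlgebra D] (f : C →⋆ₙₐ[ℂ] D) (hf : Function.Injective f) {z : C} {y : D}
    (h : f z = star y * y) : ∃ w, z = star w * w := by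
  let _ : PartialOrder C := CStarAlgebra.spectralOrder C
  have _ : StarOrderedRing C := CStarAlgebra.spectralOrderedRing C
  let _ : PartialOrder D := CStarAlgebra.spectralOrder D
  have _ : StarOrderedRing D := CStarAlgebra.spectralOrderedRing D
  have hpos : 0 ≤ f z := h ▸ star_mul_self_nonneg y
  have hsa : IsSelfAdjoint z := by
    apply hf
    rw [map_star]
    exact hpos.isSelfAdjoint
  have hfz : IsSelfAdjoint (f z) := hpos.isSelfAdjoint
  -- Functional calculus commutes with `f`, and `|t| = t` on the quasispectrum of the positive
  -- element `f z`.
  have habs : cfcₙ (fun t : ℝ => |t|) z = z := by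
    apply hf
    rw [NonUnitalStarAlgHom.map_cfcₙ (S := ℂ) f (fun t : ℝ => |t|) z]
    conv_rhs => rw [← cfcₙ_id ℝ (f z)]
    refine cfcₙ_congr fun t ht => ?_
    exact abs_of_nonneg (quasispectrum_nonneg_of_nonneg (f z) hpos t ht)
  refine CStarAlgebra.nonneg_iff_eq_star_mul_self.mp ?_
  rw [← habs]
  exact cfcₙ_nonneg fun t _ => abs_nonneg t

/-- A Gram matrix with entries in a C⋆-subalgebra is a sum of squares in the subalgebra. -/
theorem exists_gram_factorization {C D : Type*} [NonUnitalCStarAlgebra C] [NonUnitalCStarAlgebra D]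
    (f : C →⋆ₙₐ[ℂ] D) (hf : Function.Injective f) {n : Type*} [Fintype n] {z : n → n → C} {x : n → D}
    (h : ∀ i j, f (z i j) = star (x i) * x j) :
    ∃ w : n → n → C, ∀ i j, z i j = ∑ k, star (w k i) * w k j := by
  classical
  let _ : PartialOrder C := CStarAlgebra.spectralOrder C
  have _ : StarOrderedRing C := CStarAlgebra.spectralOrderedRing C
  let _ : PartialOrder D := CStarAlgebra.spectralOrder D
  have _ : StarOrderedRing D := CStarAlgebra.spectralOrderedRing D
  rcases isEmpty_or_nonempty n with hn | ⟨⟨k₀⟩⟩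
  · exact ⟨fun i => hn.elim i, fun i => hn.elim i⟩
  let F : CStarMatrix n n C →⋆ₙₐ[ℂ] CStarMatrix n n D := CStarMatrix.mapₙₐ f
  have hF : Function.Injective F := fun M N hMN => by
    ext i j
    exact hf (congrFun (congrFun hMN i) j)
  -- The square matrix with row `k₀` equal to `x` and zeros elsewhere, so that `R⋆R` is the Gram
  -- matrix of `x`.
  let R : CStarMatrix n n D := CStarMatrix.ofMatrix fun k j => if k = k₀ then x j else 0
  have hRa : ∀ k j, R k j = if k = k₀ then x j else 0 := fun _ _ => rfl
  have hR : F (CStarMatrix.ofMatrix z) = star R * R := by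
    ext i j
    change f (z i j) = _
    rw [h, CStarMatrix.mul_apply, Finset.sum_eq_single k₀]
    · rw [CStarMatrix.star_apply, hRa, hRa, if_pos rfl, if_pos rfl]
    · intro k _ hk
      rw [hRa, if_neg hk, mul_zero]
    · simp
  obtain ⟨W, hW⟩ := exists_star_mul_self_of_map F hF hR
  refine ⟨fun k j => W k j, fun i j => ?_⟩
  have := congrFun (congrFun hW i) j
  rw [CStarMatrix.mul_apply] at this
  exact this

variable {H : Type*} [NormedAddCommGroup H] [InnerProductSpace ℂ H] [CompleteSpace H]

/-- The factorisation inside `C` survives `ρ` and turns the double sum into a sum of squared norms.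
This is the positivity needed for the dilation kernel. -/
theorem sum_inner_gram_nonneg {C D : Type*} [NonUnitalCStarAlgebra C] [NonUnitalCStarAlgebra D]
    (f : C →⋆ₙₐ[ℂ] D) (hf : Function.Injective f) (ρ : C →⋆ₙₐ[ℂ] (H →L[ℂ] H)) {n : Type*}
    (s : Finset n) {z : n → n → C} {x : n → D} (h : ∀ i j, f (z i j) = star (x i) * x j)
    (v : n → H) : 0 ≤ ∑ i ∈ s, ∑ j ∈ s, ⟪v i, ρ (z i j) (v j)⟫_ℂ := by
  obtain ⟨w, hw⟩ := exists_gram_factorization f hf (n := s) (z := fun i j => z i j)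
    (x := fun i => x i) fun i j => h i j
  have e : ∑ i ∈ s, ∑ j ∈ s, ⟪v i, ρ (z i j) (v j)⟫_ℂ =
      ∑ k : s, ⟪∑ i : s, ρ (w k i) (v i), ∑ j : s, ρ (w k j) (v j)⟫_ℂ := by
    simp_rw [← Finset.sum_coe_sort s, sum_inner, inner_sum]
    symm
    rw [Finset.sum_comm]
    refine Finset.sum_congr rfl fun i _ => ?_
    rw [Finset.sum_comm]
    refine Finset.sum_congr rfl fun j _ => ?_
    rw [hw i j, map_sum, sum_apply, inner_sum]
    refine Finset.sum_congr rfl fun k _ => ?_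
    rw [map_mul, map_star, ContinuousLinearMap.star_eq_adjoint, FunLike.coe_mul_eq_comp,
      Function.comp_apply, ContinuousLinearMap.adjoint_inner_right]
  rw [e]
  refine Finset.sum_nonneg fun k _ => ?_
  rw [inner_self_eq_norm_sq_to_K (𝕜 := ℂ)]
  have h0 := Complex.zero_le_real.mpr (norm_nonneg (∑ i, ρ (w k i) (v i)))
  exact pow_nonneg h0 2

end MatrixPositivity

/-! ### Stinespring dilation of a compression. -/

section Dilation

open scoped InnerProductSpace CStarAlgebra ComplexOrder

variable {D N : Type u} [CStarAlgebra D] [NonUnitalCStarAlgebra N]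
variable {H : Type u} [NormedAddCommGroup H] [InnerProductSpace ℂ H] [CompleteSpace H]

theorem map_star_of_compression {f : N →⋆ₙₐ[ℂ] D} (hf : Function.Injective f) {E : D}
    (hE : IsStarProjection E) {cut : D →ₗ[ℂ] N} (hcut : ∀ x, f (cut x) = E * x * E) (x : D) :
    cut (star x) = star (cut x) := by
  apply hf
  rw [map_star f, hcut, hcut, star_mul, star_mul, hE.isSelfAdjoint.star_eq, mul_assoc]

/-- The Hilbert space of the Stinespring dilation of a compression, with its canonical maps. -/
theorem exists_dilation_space {f : N →⋆ₙₐ[ℂ] D} (hf : Function.Injective f) {E : D}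
    (hE : IsStarProjection E) {cut : D →ₗ[ℂ] N} (hcut : ∀ x, f (cut x) = E * x * E)
    (ρ : N →⋆ₙₐ[ℂ] (H →L[ℂ] H)) :
    ∃ (K : Type u) (_ : NormedAddCommGroup K) (_ : InnerProductSpace ℂ K) (_ : CompleteSpace K)
      (k : D → H →L[ℂ] K), (∀ a b v w, ⟪k a v, k b w⟫_ℂ = ⟪v, ρ (cut (star a * b)) w⟫_ℂ) ∧
      (Submodule.span ℂ {y | ∃ a v, k a v = y}).topologicalClosure = ⊤ := by
  have hstar := map_star_of_compression hf hE hcut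
  -- A positive operator-valued kernel indexed by `D` itself. Its reproducing kernel space plays the
  -- role of the separated completion of `D ⊗ H`.
  let M : Matrix D D (H →L[ℂ] H) := .of fun a b => ρ (cut (star a * b))
  have hflip : ∀ a b v w, ⟪M b a v, w⟫_ℂ = ⟪v, ρ (cut (star a * b)) w⟫_ℂ := by
    intro a b v w
    change ⟪ρ (cut (star b * a)) v, w⟫_ℂ = _
    rw [inner_rep_left, ← hstar, star_mul, star_star]
  have hM : M.PosSemidef := by
    have htfae : M.PosSemidef ↔ M.IsHermitian ∧ ∀ v : D →₀ H,
        0 ≤ RCLike.re (v.sum fun x w => v.sum fun x' w' => ⟪M x' x w, w'⟫_ℂ) :=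
      RKHS.posSemidef_tfae.out 0 2
    refine htfae.mpr ⟨?_, fun v => ?_⟩
    · ext1 a b
      change star (ρ (cut (star b * a))) = ρ (cut (star a * b))
      rw [← map_star, ← hstar, star_mul, star_star]
    · have h := sum_inner_gram_nonneg f hf ρ v.support (z := fun a b => cut (star a * b))
        (x := fun a => a * E) (fun a b => by
          rw [hcut, star_mul, hE.isSelfAdjoint.star_eq]
          simp only [mul_assoc]) v
      simp only [hflip]
      exact (Complex.nonneg_iff.mp h).1
  have : Fact M.PosSemidef := ⟨hM⟩
  refine ⟨RKHS.OfKernel M, inferInstance, inferInstance, inferInstance,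
    fun a => RKHS.kerFun (RKHS.OfKernel M) a, fun a b v w => ?_, ?_⟩
  · rw [← RKHS.kernel_inner, RKHS.OfKernel.kernel_ofKernel, hflip]
  · exact RKHS.kerFun_dense (𝕜 := ℂ) (RKHS.OfKernel M)

/-- The Stinespring dilation of a compression followed by a representation. -/
theorem exists_dilation {f : N →⋆ₙₐ[ℂ] D} (hf : Function.Injective f) {E : D}
    (hE : IsStarProjection E) {cut : D →ₗ[ℂ] N} (hcut : ∀ x, f (cut x) = E * x * E)
    (ρ : N →⋆ₙₐ[ℂ] (H →L[ℂ] H)) (hρ : ∀ v, ρ (cut 1) v = v) :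
    ∃ (K : Type u) (_ : NormedAddCommGroup K) (_ : InnerProductSpace ℂ K) (_ : CompleteSpace K)
      (σ : D →⋆ₙₐ[ℂ] (K →L[ℂ] K)) (V : H →L[ℂ] K), (∀ v, V.adjoint (V v) = v) ∧
      (∀ x, σ E (V x) = V x) ∧ (∀ y, V (V.adjoint y) = σ E y) ∧
      (∀ a v, V.adjoint (σ a (V v)) = ρ (cut a) v) ∧
      (Submodule.span ℂ {y | ∃ a v, σ a (V v) = y}).topologicalClosure = ⊤ := by
  have hstar := map_star_of_compression hf hE hcut
  obtain ⟨K, _, _, _, k, hk, hdense⟩ := exists_dilation_space hf hE hcut ρ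
  -- On formal sums, `S c` is left multiplication by `c` followed by the canonical map to `K`.
  let S : D → (D →₀ H) →ₗ[ℂ] K := fun c => Finsupp.lsum ℂ fun a => (k (c * a) : H →ₗ[ℂ] K)
  have hSsingle : ∀ c a v, S c (Finsupp.single a v) = k (c * a) v := fun c a v => by
    simp [S]
  have hS1 : DenseRange (S 1) := by
    have h1 : ((Submodule.span ℂ {y | ∃ a v, k a v = y}).topologicalClosure : Set K) = Set.univ := by
      rw [hdense]
      rfl
    have h2 : Submodule.span ℂ {y | ∃ a v, k a v = y} ≤ LinearMap.range (S 1) := by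
      rw [Submodule.span_le]
      rintro _ ⟨a, v, rfl⟩
      exact ⟨Finsupp.single a v, by rw [hSsingle, one_mul]⟩
    rw [Submodule.topologicalClosure_coe] at h1
    rw [DenseRange, dense_iff_closure_eq, ← univ_subset_iff, ← h1]
    exact closure_mono h2
  let Q : (D →₀ H) → D → ℂ := fun g m =>
    ∑ a ∈ g.support, ∑ b ∈ g.support, ⟪g a, ρ (cut (star a * m * b)) (g b)⟫_ℂ
  have hQsub : ∀ g m m', Q g (m - m') = Q g m - Q g m' := by
    intro g m m'
    simp only [Q, mul_sub, sub_mul, map_sub, sub_apply, inner_sub_right, Finset.sum_sub_distrib]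
  have hQsmul : ∀ g (c : ℂ) m, Q g (c • m) = c * Q g m := by
    intro g c m
    simp only [Q, mul_smul_comm, smul_mul_assoc, map_smul, smul_apply, inner_smul_right,
      Finset.mul_sum]
  have hSQ : ∀ c g, ((‖S c g‖ ^ 2 : ℝ) : ℂ) = Q g (star c * c) := by
    intro c g
    rw [Complex.ofReal_pow]
    refine (inner_self_eq_norm_sq_to_K (𝕜 := ℂ) (S c g)).symm.trans ?_
    have h1 : S c g = ∑ a ∈ g.support, k (c * a) (g a) := by
      simp [S, Finsupp.sum]
    rw [h1, sum_inner]
    refine Finset.sum_congr rfl fun a _ => ?_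
    rw [inner_sum]
    refine Finset.sum_congr rfl fun b _ => ?_
    rw [hk, star_mul]
    simp only [mul_assoc]
  have hbound : ∀ c g, ‖S c g‖ ≤ ‖c‖ * ‖S 1 g‖ := by
    intro c g
    let _ : PartialOrder D := CStarAlgebra.spectralOrder D
    have _ : StarOrderedRing D := CStarAlgebra.spectralOrderedRing D
    -- Writing this element as `d⋆d` gives `‖S c g‖² + ‖S d g‖² = ‖c‖²‖S 1 g‖²`, so multiplication
    -- by `c` is well defined and bounded on `K`.
    have h1 : (0 : D) ≤ algebraMap ℝ D (‖c‖ ^ 2) - star c * c :=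
      sub_nonneg.mpr CStarAlgebra.star_mul_le_algebraMap_norm_sq
    obtain ⟨d, hd⟩ := CStarAlgebra.nonneg_iff_eq_star_mul_self.mp h1
    have h2 : algebraMap ℝ D (‖c‖ ^ 2) = ((‖c‖ ^ 2 : ℝ) : ℂ) • (star (1 : D) * 1) := by
      rw [star_one, mul_one, Algebra.algebraMap_eq_smul_one, Complex.coe_smul]
    have h3 : ((‖S d g‖ ^ 2 : ℝ) : ℂ) = ((‖c‖ ^ 2 * ‖S 1 g‖ ^ 2 - ‖S c g‖ ^ 2 : ℝ) : ℂ) := by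
      rw [hSQ, ← hd, h2, hQsub, hQsmul, ← hSQ, ← hSQ]
      push_cast
      ring
    rw [Complex.ofReal_inj] at h3
    have h4 : ‖S c g‖ ^ 2 ≤ (‖c‖ * ‖S 1 g‖) ^ 2 := by
      rw [mul_pow]
      linarith [sq_nonneg ‖S d g‖]
    exact (sq_le_sq₀ (norm_nonneg _) (by positivity)).mp h4
  let T : D → K →L[ℂ] K := fun c => (S c).extendOfNorm (S 1)
  have hT : ∀ c a v, T c (k a v) = k (c * a) v := by
    intro c a v
    have h1 := LinearMap.extendOfNorm_eq hS1 ⟨‖c‖, hbound c⟩ (Finsupp.single a v)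
    rwa [hSsingle, hSsingle, one_mul] at h1
  have hind : ∀ p : K → Prop, IsClosed {y | p y} → p 0 → (∀ x y, p x → p y → p (x + y)) →
      (∀ a v, p (k a v)) → ∀ y, p y := by
    intro p hp h0 hadd hk y
    refine hS1.induction_on y hp fun g => ?_
    induction g using Finsupp.induction_linear with
    | zero => rwa [map_zero]
    | add g g' hg hg' =>
      rw [map_add]
      exact hadd _ _ hg hg'
    | single a v =>
      rw [hSsingle, one_mul]
      exact hk a v
  have hext : ∀ X Y : K →L[ℂ] K, (∀ a v, X (k a v) = Y (k a v)) → X = Y := by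
    intro X Y hXY
    ext y
    refine hind (fun y => X y = Y y) (isClosed_eq X.continuous Y.continuous) (by simp)
      (fun x y hx hy => ?_) hXY y
    rw [map_add, map_add, hx, hy]
  have hinner : ∀ x y : K, (∀ a v, ⟪k a v, x⟫_ℂ = ⟪k a v, y⟫_ℂ) → x = y := by
    intro x y hxy
    refine ext_inner_left ℂ (hind _ (isClosed_eq (by fun_prop) (by fun_prop)) (by simp)
      (fun z w hz hw => ?_) hxy)
    rw [inner_add_left, inner_add_left, hz, hw]
  have hkadd : ∀ a b v, k (a + b) v = k a v + k b v := fun a b v => hinner _ _ fun c w => by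
    rw [inner_add_right, hk, hk, hk, mul_add, map_add, map_add, add_apply, inner_add_right]
  have hksmul : ∀ (c : ℂ) a v, k (c • a) v = c • k a v := fun c a v => hinner _ _ fun d w => by
    rw [inner_smul_right, hk, hk, mul_smul_comm, map_smul, map_smul, smul_apply, inner_smul_right]
  let σ : D →⋆ₙₐ[ℂ] (K →L[ℂ] K) :=
    { toFun := T
      map_smul' := fun c a => hext _ _ fun b v => by
        change T (c • a) (k b v) = c • T a (k b v)
        rw [hT, hT, smul_mul_assoc, hksmul]
      map_zero' := hext _ _ fun b v => by
        rw [hT, zero_mul, ← zero_smul ℂ (0 : D), hksmul, zero_smul]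
        rfl
      map_add' := fun a b => hext _ _ fun c v => by
        rw [add_apply, hT, hT, hT, add_mul, hkadd]
      map_mul' := fun a b => hext _ _ fun c v => by
        rw [FunLike.coe_mul_eq_comp, Function.comp_apply, hT, hT, hT, mul_assoc]
      map_star' := fun a => by
        rw [ContinuousLinearMap.star_eq_adjoint]
        refine hext _ _ fun b v => hinner _ _ fun c w => ?_
        rw [ContinuousLinearMap.adjoint_inner_right, hT, hT, hk, hk, star_mul, mul_assoc] }
  have hσ : ∀ c a v, σ c (k a v) = k (c * a) v := hT
  have hEE := hE.isIdempotentElem.eq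
  have hEE' : ∀ x, E * (E * x) = E * x := fun x => by rw [← mul_assoc, hEE]
  -- The compression is multiplicative across `E`; this is what identifies `σ(E)` with the
  -- projection `VV⋆`.
  have hcutE : ∀ a b, cut (a * E * b) = cut (a * E) * cut (E * b) := fun a b => by
    apply hf
    rw [map_mul f, hcut, hcut, hcut]
    simp only [mul_assoc, hEE']
  have hcutE1 : ∀ a, cut (a * E) = cut a := fun a => by
    apply hf
    rw [hcut, hcut]
    simp only [mul_assoc, hEE]
  have hcutE2 : ∀ a, cut (E * a) = cut a := fun a => by
    apply hf
    rw [hcut, hcut]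
    simp only [← mul_assoc, hEE]
  have hV : ∀ a v, (k 1).adjoint (k a v) = ρ (cut a) v := fun a v => by
    refine ext_inner_left ℂ fun w => ?_
    rw [ContinuousLinearMap.adjoint_inner_right, hk, star_one, one_mul]
  have hE1 : ∀ a v, k (E * a) v = k 1 (ρ (cut a) v) := fun a v => hinner _ _ fun b w => by
    rw [hk, hk, mul_one, ← mul_assoc, hcutE, hcutE1, hcutE2, map_mul]
    rfl
  refine ⟨K, inferInstance, inferInstance, inferInstance, σ, k 1, fun v => ?_, fun v => ?_,
    fun y => ?_, fun a v => ?_, ?_⟩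
  · rw [hV, hρ]
  · rw [hσ, hE1, hρ]
  · have h1 : (k 1).comp (k 1).adjoint = σ E := hext _ _ fun b v => by
      rw [ContinuousLinearMap.comp_apply, hσ, hV, hE1]
    exact congrArg (fun X => X y) h1
  · rw [hσ, mul_one, hV]
  · rw [← hdense]
    congr 2
    ext y
    simp only [hσ, mul_one]

end Dilation

/-! ### States separate the elements of a C⋆-algebra. -/

section States

open scoped InnerProductSpace CStarAlgebra ComplexOrder

/-- For positive `z`, the estimate `‖z + it‖² ≤ ‖z‖² + t²` for all real `t` leaves no room for an
imaginary part of `g z`. Contractivity at `‖z‖ - z`, whose norm is at most `‖z‖`, gives the sign of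
the real part. -/
theorem nonneg_of_norm_le_one_of_map_one {D : Type*} [CStarAlgebra D] {g : D →L[ℂ] ℂ}
    (hg : ‖g‖ ≤ 1) (hg1 : g 1 = 1) (y : D) : 0 ≤ g (star y * y) := by
  let _ : PartialOrder D := CStarAlgebra.spectralOrder D
  have _ : StarOrderedRing D := CStarAlgebra.spectralOrderedRing D
  have hle : ∀ x, ‖g x‖ ≤ ‖x‖ := fun x =>
    (g.le_opNorm x).trans (mul_le_of_le_one_left (norm_nonneg _) hg)
  set z := star y * y with hz
  have hz0 : 0 ≤ z := star_mul_self_nonneg y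
  have hzs : star z = z := hz0.isSelfAdjoint
  have him : (g z).im = 0 := by
    have key : ∀ t : ℝ, 2 * (g z).im * t ≤ ‖z‖ ^ 2 := by
      intro t
      have h1 : ‖z + ((t : ℂ) * Complex.I) • (1 : D)‖ ^ 2 ≤ ‖z‖ ^ 2 + t ^ 2 := by
        have e : star (z + ((t : ℂ) * Complex.I) • (1 : D)) * (z + ((t : ℂ) * Complex.I) • (1 : D)) =
            z * z + ((t : ℂ) ^ 2) • (1 : D) := by
          rw [star_add, hzs, star_smul, star_one, add_mul, mul_add, mul_add]
          simp only [smul_mul_assoc, mul_smul_comm, one_mul, mul_one, star_mul', smul_smul]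
          simp only [Complex.star_def, Complex.conj_ofReal, Complex.conj_I]
          have h2 : (t : ℂ) * Complex.I * ((t : ℂ) * -Complex.I) = (t : ℂ) ^ 2 := by
            linear_combination (-(t : ℂ) ^ 2) * Complex.I_sq
          rw [h2]
          module
        rw [sq, ← CStarRing.norm_star_mul_self, e]
        refine (norm_add_le _ _).trans (add_le_add ((norm_mul_le _ _).trans (sq _).symm.le) ?_)
        rw [norm_smul]
        have h3 : ‖(1 : D)‖ ≤ 1 := by
          have h4 := CStarRing.norm_star_mul_self (x := (1 : D))
          rw [star_one, mul_one] at h4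
          nlinarith [norm_nonneg (1 : D)]
        calc ‖(t : ℂ) ^ 2‖ * ‖(1 : D)‖ ≤ ‖(t : ℂ) ^ 2‖ * 1 := by gcongr
          _ = t ^ 2 := by simp
      have h2 : ((g z).im + t) ^ 2 ≤ ‖g (z + ((t : ℂ) * Complex.I) • (1 : D))‖ ^ 2 := by
        rw [map_add, map_smul, hg1, Complex.sq_norm, Complex.normSq_apply]
        simp
        nlinarith
      have h3 : ‖g (z + ((t : ℂ) * Complex.I) • (1 : D))‖ ^ 2 ≤ _ :=
        pow_le_pow_left₀ (norm_nonneg _) (hle _) 2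
      nlinarith [sq_nonneg (g z).im]
    by_contra h0
    have h1 := key ((‖z‖ ^ 2 + 1) / (2 * (g z).im))
    rw [mul_div_cancel₀ _ (mul_ne_zero two_ne_zero h0)] at h1
    linarith
  have hre : 0 ≤ (g z).re := by
    have h1 : ‖algebraMap ℝ D ‖z‖ - z‖ ≤ ‖z‖ := by
      rw [CStarAlgebra.norm_le_iff_le_algebraMap _ (norm_nonneg _)
        (sub_nonneg.mpr (IsSelfAdjoint.le_algebraMap_norm_self hz0.isSelfAdjoint))]
      exact sub_le_self _ hz0
    have h2 := (hle _).trans h1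
    have h3 : g (algebraMap ℝ D ‖z‖) = (‖z‖ : ℂ) := by
      rw [Algebra.algebraMap_eq_smul_one, ← Complex.coe_smul, map_smul, hg1, smul_eq_mul, mul_one]
    rw [map_sub, h3] at h2
    have h4 := (Complex.re_le_norm _).trans h2
    simp at h4
    exact h4
  exact Complex.nonneg_iff.mpr ⟨hre, him.symm⟩

variable {B : Type u} [NonUnitalCStarAlgebra B]

/-- The states of a C⋆-algebra separate its elements. -/
theorem exists_state_ne_zero {b : B} (hb : b ≠ 0) : ∃ ω : stateSet B, ω.1 (star b * b) ≠ 0 := by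
  let D := Unitization ℂ B
  let _ : PartialOrder D := CStarAlgebra.spectralOrder D
  have _ : StarOrderedRing D := CStarAlgebra.spectralOrderedRing D
  obtain ⟨X, hX⟩ : ∃ X : D, X = ((star b * b : B) : Unitization ℂ B) := ⟨_, rfl⟩
  have hXpos : 0 ≤ X := by
    rw [hX, Unitization.inr_mul, Unitization.inr_star]
    exact star_mul_self_nonneg _
  have hXn : ‖X‖ = ‖star b * b‖ := by rw [hX, Unitization.norm_inr]
  have hn : 0 < ‖star b * b‖ := by
    rw [CStarRing.norm_star_mul_self]
    have := norm_pos_iff.mpr hb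
    positivity
  have hadd : 1 + ‖X‖ ≤ ‖1 + X‖ := by
    have h1 : ‖X‖ ∈ spectrum ℝ X := CStarAlgebra.norm_mem_spectrum_of_nonneg hXpos
    have h2 : 1 + ‖X‖ ∈ spectrum ℝ (1 + X) := by
      have := spectrum.add_mem_add_iff (R := ℝ) (r := ‖X‖) (s := 1) (a := X)
      rw [map_one] at this
      rw [add_comm ‖X‖] at this
      exact this.mpr h1
    have h3 := spectrum.norm_le_norm_of_mem h2
    rwa [Real.norm_of_nonneg (by positivity)] at h3
  -- Since `‖1 + X‖ ≥ 1 + ‖X‖`, a functional norming `1 + X` must satisfy `g(1) = 1` and `Re g(X) =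
  -- ‖X‖`. It is then positive, and its restriction to `B` still has norm one, as seen at `b⋆b`.
  obtain ⟨g, hg, hgX⟩ := exists_dual_vector'' ℂ (1 + X)
  have hle : ∀ x, ‖g x‖ ≤ ‖x‖ := fun x =>
    (g.le_opNorm x).trans (mul_le_of_le_one_left (norm_nonneg _) hg)
  have h1 : ‖g 1‖ ≤ 1 := (hle 1).trans norm_one.le
  have h2 := hle X
  have hre : (g 1).re + (g X).re = ‖1 + X‖ := by
    have := congrArg Complex.re hgX
    simpa using this
  have h3 := Complex.re_le_norm (g 1)
  have h4 := Complex.re_le_norm (g X)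
  have hre1 : (g 1).re = 1 := by linarith
  have hreX : (g X).re = ‖X‖ := by linarith
  have hg1 : g 1 = 1 := by
    have h5 : ‖g 1‖ ^ 2 ≤ 1 := by nlinarith [norm_nonneg (g 1)]
    rw [Complex.sq_norm, Complex.normSq_apply, hre1] at h5
    have h6 : (g 1).im = 0 := by nlinarith
    exact Complex.ext hre1 h6
  let φ : B →L[ℂ] ℂ := LinearMap.mkContinuous
    ((g : D →ₗ[ℂ] ℂ) ∘ₗ Unitization.inrHom ℂ ℂ B) 1 fun x => by
      rw [one_mul, ← Unitization.norm_inr (𝕜 := ℂ) (a := x)]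
      exact hle _
  have hφ : ∀ x, φ x = g (x : Unitization ℂ B) := fun _ => rfl
  have hφX : φ (star b * b) = g X := by rw [hφ, hX]
  refine ⟨⟨φ, fun a => ?_, le_antisymm (LinearMap.mkContinuous_norm_le _ zero_le_one _) ?_⟩, ?_⟩
  · rw [hφ, Unitization.inr_mul, Unitization.inr_star]
    exact nonneg_of_norm_le_one_of_map_one hg hg1 _
  · have h5 := φ.le_opNorm (star b * b)
    rw [hφX] at h5
    rw [hreX, hXn] at h4
    exact le_of_mul_le_mul_right (by linarith) hn
  · change φ (star b * b) ≠ 0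
    rw [hφX]
    intro h0
    rw [h0, Complex.zero_re] at hreX
    linarith

end States

/-! ### Dilating a representation of `eAe` to one of `A`. -/

section CornerDilation

open scoped InnerProductSpace CStarAlgebra ComplexOrder

variable {A : Type u} [NonUnitalCStarAlgebra A] {e : A} (he : IsStarProjection e)

/-- The compression `x ↦ e x e` onto a corner. -/
def cornerCut : A →ₗ[ℂ] corner e he where
  toFun x := ⟨e * x * e, x, rfl⟩
  map_add' x y := Subtype.ext (by simp [mul_add, add_mul])
  map_smul' c x := Subtype.ext (by simp [mul_smul_comm, smul_mul_assoc])

theorem coe_cornerCut (x : A) : (cornerCut he x : A) = e * x * e := rfl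

/-- The identity of a corner. -/
def cornerUnit : corner e he :=
  ⟨e, (mem_corner_iff he).mpr (by rw [he.isIdempotentElem.eq, he.isIdempotentElem.eq])⟩

theorem coe_cornerUnit : (cornerUnit he : A) = e := rfl

theorem cornerCut_coe (x : corner e he) : cornerCut he (x : A) = x :=
  Subtype.ext ((mem_corner_iff he).mp x.2)

theorem cornerUnit_mul (x : corner e he) : cornerUnit he * x = x := by
  apply Subtype.ext
  change e * (x : A) = x
  rw [← (mem_corner_iff he).mp x.2, ← mul_assoc, ← mul_assoc, he.isIdempotentElem.eq]

theorem isStarProjection_cornerUnit : IsStarProjection (cornerUnit he) :=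
  ⟨Subtype.ext he.isIdempotentElem, Subtype.ext he.isSelfAdjoint⟩

variable {H K : Type u} [NormedAddCommGroup H] [InnerProductSpace ℂ H] [CompleteSpace H]
  [NormedAddCommGroup K] [InnerProductSpace ℂ K] [CompleteSpace K]

/-- The dilation is made over the unitization of `A`, with the compression extended by `1 ↦ e`.
Because `σ(e)V = V`, one has `σ(a)V = σ(ae)V` with `ae ∈ A`, so `A` alone already generates the
space. -/
theorem exists_corner_dilation (ρ : corner e he →⋆ₙₐ[ℂ] (H →L[ℂ] H))
    (hρ : ∀ v, ρ (cornerUnit he) v = v) :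
    ∃ (K : Type u) (_ : NormedAddCommGroup K) (_ : InnerProductSpace ℂ K) (_ : CompleteSpace K)
      (σ : A →⋆ₙₐ[ℂ] (K →L[ℂ] K)) (V : H →L[ℂ] K), (∀ v, V.adjoint (V v) = v) ∧
      (∀ y, V (V.adjoint y) = σ e y) ∧
      (∀ a v, V.adjoint (σ a (V v)) = ρ (cornerCut he a) v) ∧
      (Submodule.span ℂ {y | ∃ a v, σ a (V v) = y}).topologicalClosure = ⊤ := by
  let cut : Unitization ℂ A →ₗ[ℂ] corner e he :=
    { toFun := fun w => w.fst • cornerUnit he + cornerCut he w.snd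
      map_add' := fun v w => by
        rw [Unitization.fst_add, Unitization.snd_add, add_smul, map_add]
        abel
      map_smul' := fun c w => by
        rw [Unitization.fst_smul, Unitization.snd_smul, map_smul, smul_add, smul_smul]
        rfl }
  have hcut_inr : ∀ a : A, cut (a : Unitization ℂ A) = cornerCut he a := fun a => by
    change (0 : ℂ) • cornerUnit he + cornerCut he a = _
    rw [zero_smul, zero_add]
  have hcut_one : cut 1 = cornerUnit he := by
    change (1 : ℂ) • cornerUnit he + cornerCut he 0 = _
    rw [one_smul, map_zero, add_zero]
  let f : corner e he →⋆ₙₐ[ℂ] Unitization ℂ A :=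
    (Unitization.inrNonUnitalStarAlgHom ℂ A).comp (NonUnitalStarSubalgebraClass.subtype (corner e he))
  have hfE : IsStarProjection ((e : A) : Unitization ℂ A) :=
    ⟨by rw [IsIdempotentElem, ← Unitization.inr_mul, he.isIdempotentElem.eq],
      by rw [IsSelfAdjoint, ← Unitization.inr_star, he.isSelfAdjoint.star_eq]⟩
  have hf : Function.Injective f := fun x y hxy =>
    Subtype.ext (Unitization.inr_injective (R := ℂ) hxy)
  have hcut : ∀ x, f (cut x) = (e : Unitization ℂ A) * x * (e : Unitization ℂ A) := by
    intro x
    change (((x.fst • e + e * x.snd * e : A)) : Unitization ℂ A) = _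
    apply Unitization.ext
    · simp
    · simp [add_mul]
      rw [smul_mul_assoc, he.isIdempotentElem.eq]
  obtain ⟨K, _, _, _, σ, V, h1, h2, h3, h4, h5⟩ :=
    exists_dilation hf hfE hcut ρ (fun v => by rw [hcut_one, hρ])
  refine ⟨K, inferInstance, inferInstance, inferInstance,
    σ.comp (Unitization.inrNonUnitalStarAlgHom ℂ A), V, h1, h3, fun a v => ?_, ?_⟩
  · rw [← hcut_inr]
    exact h4 _ v
  · rw [← h5]
    congr 2
    ext y
    constructor
    · rintro ⟨a, v, rfl⟩
      exact ⟨_, v, rfl⟩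
    · rintro ⟨a, v, rfl⟩
      refine ⟨a.fst • e + a.snd * e, v, ?_⟩
      have h6 : ((a.fst • e + a.snd * e : A) : Unitization ℂ A) = a * (e : Unitization ℂ A) := by
        apply Unitization.ext <;> simp
      change σ ((a.fst • e + a.snd * e : A) : Unitization ℂ A) (V v) = _
      rw [h6, map_mul]
      exact congrArg _ (h2 v)

/-- Conjugation `T ↦ V T V⋆` by an isometry. -/
noncomputable def isometryConj (V : H →L[ℂ] K) (hV : ∀ v, V.adjoint (V v) = v) :
    (H →L[ℂ] H) →⋆ₙₐ[ℂ] (K →L[ℂ] K) where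
  toFun T := V ∘L T ∘L V.adjoint
  map_smul' c T := by ext; simp
  map_zero' := by ext; simp
  map_add' S T := by ext; simp
  map_mul' S T := by ext; simp [hV]
  map_star' T := by
    simp [ContinuousLinearMap.star_eq_adjoint, ContinuousLinearMap.adjoint_comp,
      ContinuousLinearMap.comp_assoc]

/-- When `π b` approximates `x ↦ ⟪ξ, x⟫v` at `ξ` and `Tξ`, one gets `Tv ≈ Tπ(b)ξ = π(b)Tξ ≈ ⟪ξ,
Tξ⟫v`. -/
theorem IsDenseRep.commutant_eq_smul {B : Type u} [NonUnitalCStarAlgebra B]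
    {π : B →⋆ₙₐ[ℂ] (H →L[ℂ] H)} (hπ : IsDenseRep π) {ξ : H} (hξ : ‖ξ‖ = 1) {T : H →L[ℂ] H}
    (hT : ∀ b v, T (π b v) = π b (T v)) (v : H) : T v = ⟪ξ, T ξ⟫_ℂ • v := by
  classical
  rw [← sub_eq_zero, ← norm_le_zero_iff]
  refine le_of_forall_pos_le_add fun ε hε => ?_
  obtain ⟨b, hb⟩ := hπ {ξ, T ξ} ((innerSL ℂ ξ).smulRight v) (ε / (‖T‖ + 1)) (by positivity)
  have h1 := hb ξ (by simp)
  have h2 := hb (T ξ) (by simp)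
  simp only [ContinuousLinearMap.smulRight_apply, innerSL_apply_apply] at h1 h2
  rw [inner_self_eq_norm_sq_to_K, hξ] at h1
  simp only [Complex.ofReal_one, one_pow, one_smul, Complex.coe_algebraMap] at h1
  have h3 : T v - ⟪ξ, T ξ⟫_ℂ • v = (π b (T ξ) - ⟪ξ, T ξ⟫_ℂ • v) - T (π b ξ - v) := by
    rw [map_sub, hT]
    abel
  rw [h3, zero_add]
  calc _ ≤ ‖π b (T ξ) - ⟪ξ, T ξ⟫_ℂ • v‖ + ‖T‖ * ‖π b ξ - v‖ :=
        (norm_sub_le _ _).trans (add_le_add le_rfl (T.le_opNorm _))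
    _ ≤ ε / (‖T‖ + 1) + ‖T‖ * (ε / (‖T‖ + 1)) := by gcongr
    _ = ε := by field_simp; ring

end CornerDilation

/-! ### A common algebra in which `B` is the corner at `e`. -/

section Amalgam

open scoped InnerProductSpace CStarAlgebra ComplexOrder

/-- The elements which, together with their adjoints, map a subspace into itself. -/
def leftNormalizer {C : Type u} [NonUnitalCStarAlgebra C] (X : Submodule ℂ C) :
    NonUnitalStarSubalgebra ℂ C where
  carrier := {x | ∀ y ∈ X, x * y ∈ X ∧ star x * y ∈ X}
  add_mem' {a b} ha hb y hy := by
    rw [star_add, add_mul, add_mul]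
    exact ⟨add_mem (ha y hy).1 (hb y hy).1, add_mem (ha y hy).2 (hb y hy).2⟩
  zero_mem' y _ := by simp
  mul_mem' {a b} ha hb y hy := by
    rw [star_mul, mul_assoc, mul_assoc]
    exact ⟨(ha _ (hb y hy).1).1, (hb _ (ha y hy).2).2⟩
  smul_mem' c a ha y hy := by
    rw [star_smul, smul_mul_assoc, smul_mul_assoc]
    exact ⟨X.smul_mem _ (ha y hy).1, X.smul_mem _ (ha y hy).2⟩
  star_mem' {a} ha y hy := by
    rw [star_star]
    exact (ha y hy).symm

theorem isClosed_leftNormalizer {C : Type u} [NonUnitalCStarAlgebra C] {X : Submodule ℂ C}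
    (hX : IsClosed (X : Set C)) : IsClosed (leftNormalizer X : Set C) := by
  have : (leftNormalizer X : Set C) = ⋂ y ∈ X, {x | x * y ∈ X ∧ star x * y ∈ X} := by
    ext x
    simp only [mem_iInter]
    rfl
  rw [this]
  exact isClosed_biInter fun y _ => (hX.preimage (continuous_mul_const y)).inter
    (hX.preimage (continuous_star.mul continuous_const))

theorem mul_mem_topologicalClosure_span {C : Type u} [NonUnitalCStarAlgebra C] {S : Set C}
    {Y : Submodule ℂ C} (hY : IsClosed (Y : Set C)) {x : C} (h : ∀ y ∈ S, x * y ∈ Y) {y : C}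
    (hy : y ∈ (Submodule.span ℂ S).topologicalClosure) : x * y ∈ Y := by
  have h1 : (Submodule.span ℂ S).topologicalClosure ≤ Y.comap (LinearMap.mulLeft ℂ x) :=
    Submodule.topologicalClosure_minimal _ (Submodule.span_le.mpr h)
      (hY.preimage (continuous_const_mul x))
  exact h1 hy

variable {A B C : Type u} [NonUnitalCStarAlgebra A] [NonUnitalCStarAlgebra B]
  [NonUnitalCStarAlgebra C] {e : A} {he : IsStarProjection e} {ι : corner e he →⋆ₙₐ[ℂ] B}

/-- A C⋆-algebra containing compatible copies of `A` and `B` has a C⋆-subalgebra containing both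
copies in which the copy of `B` is the corner at `e`. -/
theorem exists_subalgebra_of_corner (hι : ∀ b, ι (cornerUnit he) * b = b ∧ b * ι (cornerUnit he) = b)
    (σ : A →⋆ₙₐ[ℂ] C) (j : B →⋆ₙₐ[ℂ] C) (hj : Function.Injective j)
    (hjσ : ∀ x : corner e he, j (ι x) = σ x) :
    ∃ D : NonUnitalStarSubalgebra ℂ C, IsClosed (D : Set C) ∧ (∀ a, σ a ∈ D) ∧ (∀ b, j b ∈ D) ∧
      ∀ z ∈ D, ∃ b, j b = σ e * z * σ e := by
  let S : Set C := {y | ∃ a b, σ a * j b = y}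
  -- `D` consists of the elements that preserve `X` together with their adjoints. As `σ(e)X` lies in
  -- the closed set `j(B)` and `σ(e) ∈ X`, it follows that `σ(e)Dσ(e) ⊆ j(B)`.
  let X := (Submodule.span ℂ S).topologicalClosure
  have hX : IsClosed (X : Set C) := Submodule.isClosed_topologicalClosure _
  have hSX : S ⊆ X := Submodule.subset_span.trans (Submodule.le_topologicalClosure _)
  have hje : j (ι (cornerUnit he)) = σ e := hjσ _
  have hej : ∀ b, σ e * j b = j b := fun b => by rw [← hje, ← map_mul, (hι b).1]
  have hje' : ∀ b, j b * σ e = j b := fun b => by rw [← hje, ← map_mul, (hι b).2]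
  have heaj : ∀ a b, σ e * (σ a * j b) = j (ι (cornerCut he a) * b) := fun a b => by
    rw [map_mul, hjσ, coe_cornerCut, map_mul, map_mul, mul_assoc, mul_assoc, hej]
  have hjX : ∀ b, j b ∈ X := fun b => hSX ⟨e, b, hej b⟩
  have hσm : ∀ a, ∀ y ∈ X, σ a * y ∈ X := fun a y hy =>
    mul_mem_topologicalClosure_span hX (by
      rintro _ ⟨a', b, rfl⟩
      exact hSX ⟨a * a', b, by rw [map_mul, mul_assoc]⟩) hy
  have hjm : ∀ b, ∀ y ∈ X, j b * y ∈ X := fun b y hy =>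
    mul_mem_topologicalClosure_span hX (by
      rintro _ ⟨a', b', rfl⟩
      rw [← hje' b, mul_assoc, heaj, ← map_mul]
      exact hjX _) hy
  refine ⟨leftNormalizer X, isClosed_leftNormalizer hX, fun a y hy => ⟨hσm a y hy, ?_⟩,
    fun b y hy => ⟨hjm b y hy, ?_⟩, fun z hz => ?_⟩
  · rw [← map_star]
    exact hσm _ y hy
  · rw [← map_star]
    exact hjm _ y hy
  · have hR : IsClosed (LinearMap.range (j : B →ₗ[ℂ] C) : Set C) :=
      (NonUnitalStarAlgHom.isometry j hj).isClosedEmbedding.isClosed_range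
    have h1 : z * σ e ∈ X := (hz (σ e) (by rw [← hje]; exact hjX _)).1
    obtain ⟨b, hb⟩ := mul_mem_topologicalClosure_span (x := σ e) hR (by
      rintro _ ⟨a, b, rfl⟩
      exact ⟨_, (heaj a b).symm⟩) h1
    exact ⟨b, hb.trans (mul_assoc _ _ _).symm⟩

variable {H : Type u} [NormedAddCommGroup H] [InnerProductSpace ℂ H] [CompleteSpace H]

/-- Every representation of `B` extends to compatible representations of `A` and `B`. -/
theorem exists_corner_extension (ρ : B →⋆ₙₐ[ℂ] (H →L[ℂ] H))
    (hρ : ∀ v, ρ (ι (cornerUnit he)) v = v) :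
    ∃ (K : Type u) (_ : NormedAddCommGroup K) (_ : InnerProductSpace ℂ K) (_ : CompleteSpace K)
      (σ : A →⋆ₙₐ[ℂ] (K →L[ℂ] K)) (j : B →⋆ₙₐ[ℂ] (K →L[ℂ] K)) (V : H →L[ℂ] K),
      (∀ x : corner e he, j (ι x) = σ x) ∧ (∀ v, V.adjoint (V v) = v) ∧
      (∀ y, V (V.adjoint y) = σ e y) ∧ (∀ b v, j b (V v) = V (ρ b v)) ∧
      (Submodule.span ℂ {y | ∃ a v, σ a (V v) = y}).topologicalClosure = ⊤ := by
  obtain ⟨K, _, _, _, σ, V, h1, h2, h3, h4⟩ := exists_corner_dilation he (ρ.comp ι) hρ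
  -- `B` acts as `Vρ(b)V⋆`. This matches `σ` on the corner because `σ(x) = σ(e)σ(x)σ(e)` there and
  -- `σ(e) = VV⋆`.
  refine ⟨K, inferInstance, inferInstance, inferInstance, σ, (isometryConj V h1).comp ρ, V,
    fun x => ?_, h1, h2, fun b v => ?_, h4⟩
  · ext y
    have h5 : σ (x : A) y = σ e (σ (x : A) (σ e y)) := by
      conv_lhs => rw [← (mem_corner_iff he).mp x.2, map_mul, map_mul]
      rfl
    rw [h5, ← h2 y, ← h2, h3, cornerCut_coe]
    rfl
  · exact congrArg (fun w => V (ρ b w)) (h1 v)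

/-- An operator commuting with `Φ(D)` compresses to one commuting with `π(B)`, hence to a scalar. It
also commutes with `VV⋆`, so it is that scalar on the range of `V`, and then everywhere by
cyclicity. -/
theorem isDenseRep_of_corner {D : Type u} [NonUnitalCStarAlgebra D]
    {σ : A →⋆ₙₐ[ℂ] D} {j : B →⋆ₙₐ[ℂ] D} {π : B →⋆ₙₐ[ℂ] (H →L[ℂ] H)} (hπ : IsDenseRep π) {ξ : H}
    (hξ : ‖ξ‖ = 1) {K : Type u} [NormedAddCommGroup K] [InnerProductSpace ℂ K] [CompleteSpace K]
    {Φ : D →⋆ₙₐ[ℂ] (K →L[ℂ] K)} {V : H →L[ℂ] K} (hV : ∀ v, V.adjoint (V v) = v)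
    (hVe : ∀ y, V (V.adjoint y) = Φ (σ e) y) (hjV : ∀ b v, Φ (j b) (V v) = V (π b v))
    (hdense : (Submodule.span ℂ {y | ∃ a v, Φ (σ a) (V v) = y}).topologicalClosure = ⊤) :
    IsDenseRep Φ := by
  have hind : ∀ Y : Submodule ℂ K, IsClosed (Y : Set K) → (∀ a v, Φ (σ a) (V v) ∈ Y) →
      ∀ y, y ∈ Y := by
    intro Y hY h y
    have h1 := Submodule.topologicalClosure_minimal (Submodule.span ℂ {y | ∃ a v, Φ (σ a) (V v) = y})
      (Submodule.span_le.mpr (by rintro _ ⟨a, v, rfl⟩; exact h a v)) hY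
    rw [hdense] at h1
    exact h1 trivial
  have hjV' : ∀ b y, V.adjoint (Φ (j b) y) = π b (V.adjoint y) := by
    intro b y
    refine ext_inner_left ℂ fun w => ?_
    rw [ContinuousLinearMap.adjoint_inner_right, inner_rep_right, ← map_star, hjV,
      ← ContinuousLinearMap.adjoint_inner_right, inner_rep_right]
  refine isDenseRep_of_commutant (fun T hT => ?_) (fun y hy => ?_)
  · have hT' : ∀ d y, T (Φ d y) = Φ d (T y) := fun d y => congrArg (fun X => X y) (hT d)
    have h1 := hπ.commutant_eq_smul hξ (T := V.adjoint ∘L T ∘L V) fun b v => by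
      simp only [ContinuousLinearMap.comp_apply]
      rw [← hjV, hT', hjV']
    set c := ⟪ξ, (V.adjoint ∘L T ∘L V) ξ⟫_ℂ
    have h2 : ∀ v, T (V v) = c • V v := fun v => by
      rw [← map_smul, ← h1 v]
      simp only [ContinuousLinearMap.comp_apply]
      rw [hVe, ← hT', ← hVe, hV]
    refine ⟨c, fun y => ?_⟩
    have h3 := hind (LinearMap.ker ((T - c • (1 : K →L[ℂ] K) : K →L[ℂ] K) : K →ₗ[ℂ] K))
      (T - c • (1 : K →L[ℂ] K)).isClosed_ker (fun a v => by
        change T (Φ (σ a) (V v)) - c • Φ (σ a) (V v) = 0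
        rw [hT', h2, map_smul, sub_self]) y
    exact sub_eq_zero.mp h3
  · have h1 := hind (LinearMap.ker (innerSL ℂ y : K →ₗ[ℂ] ℂ)) (innerSL ℂ y).isClosed_ker
      (fun a v => by
        change ⟪y, Φ (σ a) (V v)⟫_ℂ = 0
        rw [inner_rep_right, hy, inner_zero_left]) y
    exact inner_self_eq_zero.mp h1

end Amalgam

/-! ### Faithfulness of the amalgam. -/

section Amalgam

open scoped InnerProductSpace CStarAlgebra ComplexOrder

variable {A B : Type u} [NonUnitalCStarAlgebra A] [NonUnitalCStarAlgebra B]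

theorem exists_rep_ne_zero {b : B} (hb : b ≠ 0) :
    ∃ (H : Type u) (_ : NormedAddCommGroup H) (_ : InnerProductSpace ℂ H) (_ : CompleteSpace H)
      (ρ : B →⋆ₙₐ[ℂ] (H →L[ℂ] H)), ρ b ≠ 0 ∧
      ∀ p : B, (∀ x, p * x = x) → ∀ v, ρ p v = v := by
  let _ : PartialOrder B := CStarAlgebra.spectralOrder B
  have _ : StarOrderedRing B := CStarAlgebra.spectralOrderedRing B
  obtain ⟨ω, hω⟩ := exists_state_ne_zero hb
  obtain ⟨ξ, -, hξω, hdense⟩ := exists_gns_vector ω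
  refine ⟨(stateToPositive ω).GNS, inferInstance, inferInstance, inferInstance,
    (stateToPositive ω).gnsNonUnitalStarAlgHom, fun h0 => hω ?_, fun p hp v => ?_⟩
  · rw [← hξω, vectorFunctional_apply, inner_rep_star_mul_self, h0]
    simp
  · refine hdense.induction_on v (isClosed_eq (ContinuousLinearMap.continuous _) continuous_id)
      fun a => ?_
    conv_rhs => rw [← hp a, map_mul]
    rfl

variable {e : A} {he : IsStarProjection e} {ι : corner e he →⋆ₙₐ[ℂ] B}

/-- For each nonzero `b` some representation of `B` does not kill it and extends compatibly to `A`;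
the product over all such `b` is faithful on `B`. -/
theorem exists_faithful_extension
    (hι : ∀ b, ι (cornerUnit he) * b = b ∧ b * ι (cornerUnit he) = b) :
    ∃ (C : Type u) (_ : NonUnitalCStarAlgebra C) (σ : A →⋆ₙₐ[ℂ] C) (j : B →⋆ₙₐ[ℂ] C),
      Function.Injective j ∧ ∀ x : corner e he, j (ι x) = σ x := by
  have h : ∀ b : {b : B // b ≠ 0}, ∃ (C : Type u) (_ : NonUnitalCStarAlgebra C) (σ : A →⋆ₙₐ[ℂ] C)
      (j : B →⋆ₙₐ[ℂ] C), j b ≠ 0 ∧ ∀ x : corner e he, j (ι x) = σ x := by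
    rintro ⟨b, hb⟩
    obtain ⟨H, _, _, _, ρ, hρb, hρ⟩ := exists_rep_ne_zero hb
    obtain ⟨K, _, _, _, σ, j, V, h1, h2, h3, h4, h5⟩ :=
      exists_corner_extension ρ (hρ _ fun x => (hι x).1)
    refine ⟨K →L[ℂ] K, inferInstance, σ, j, fun h0 => hρb ?_, h1⟩
    ext v
    rw [← h2 (ρ b v), ← h4]
    change V.adjoint (j b (V v)) = 0
    rw [h0]
    exact map_zero _
  choose C _ σ j hj hjσ using h
  refine ⟨lp C ⊤, inferInstance, starHomLpLift σ, starHomLpLift j, ?_, fun x => ?_⟩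
  · rw [injective_iff_map_eq_zero]
    intro b hb
    by_contra hb0
    exact hj ⟨b, hb0⟩ (congrArg (fun s : lp C ⊤ => s ⟨b, hb0⟩) hb)
  · ext i
    exact hjσ i x

/-- A unital extension of a corner `eAe` is the corner at `e` of an extension of `A`, compatibly
with dense representations. -/
theorem exists_corner_amalgam
    (hι : ∀ b, ι (cornerUnit he) * b = b ∧ b * ι (cornerUnit he) = b)
    {H : Type u} [NormedAddCommGroup H] [InnerProductSpace ℂ H] [CompleteSpace H]
    {π : B →⋆ₙₐ[ℂ] (H →L[ℂ] H)} (hπ : IsDenseRep π) {ξ : H} (hξ : ‖ξ‖ = 1) :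
    ∃ (D : Type u) (_ : NonUnitalCStarAlgebra D) (σ : A →⋆ₙₐ[ℂ] D) (j : B →⋆ₙₐ[ℂ] D)
      (K : Type u) (_ : NormedAddCommGroup K) (_ : InnerProductSpace ℂ K) (_ : CompleteSpace K)
      (Φ : D →⋆ₙₐ[ℂ] (K →L[ℂ] K)) (V : H →L[ℂ] K), Function.Injective j ∧
      (∀ x : corner e he, j (ι x) = σ x) ∧ (∀ z, ∃ b, j b = σ e * z * σ e) ∧ IsDenseRep Φ ∧
      (∀ v, V.adjoint (V v) = v) ∧ (∀ b v, Φ (j b) (V v) = V (π b v)) := by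
  have hπ1 : ∀ v, π (ι (cornerUnit he)) v = v := fun v => by
    refine (hπ.denseRange_apply hξ).induction_on v
      (isClosed_eq (ContinuousLinearMap.continuous _) continuous_id) fun a => ?_
    conv_rhs => rw [← (hι a).1, map_mul]
    rfl
  obtain ⟨C, _, σ₀, j₀, hj₀, hjσ₀⟩ := exists_faithful_extension hι
  obtain ⟨K, _, _, _, σ₁, j₁, V, hjσ₁, hV, hVe, hjV, hdense⟩ := exists_corner_extension π hπ1
  -- `π` need not be faithful, so two coordinates are used: the first makes `j` injective and the
  -- second carries the representation extending `π`.
  obtain ⟨D, hD, hσD, hjD, hcut⟩ := exists_subalgebra_of_corner hι (σ₀.prod σ₁) (j₀.prod j₁)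
    (fun a b hab => hj₀ (congrArg Prod.fst hab)) (fun x => Prod.ext (hjσ₀ x) (hjσ₁ x))
  have _ : IsClosed (D : Set (C × (K →L[ℂ] K))) := hD
  let Φ : D →⋆ₙₐ[ℂ] (K →L[ℂ] K) :=
    (NonUnitalStarAlgHom.snd ℂ C (K →L[ℂ] K)).comp (NonUnitalStarSubalgebraClass.subtype D)
  let σ := NonUnitalStarAlgHom.codRestrict (σ₀.prod σ₁) D hσD
  let j := NonUnitalStarAlgHom.codRestrict (j₀.prod j₁) D hjD
  refine ⟨D, inferInstance, σ, j, K, inferInstance, inferInstance, inferInstance, Φ, V,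
    fun a b hab => hj₀ ?_, fun x => ?_, fun z => ?_,
    isDenseRep_of_corner (σ := σ) (j := j) hπ hξ hV hVe hjV hdense, hV, hjV⟩
  · exact congrArg (fun z : D => (z : C × (K →L[ℂ] K)).1) hab
  · exact Subtype.ext (Prod.ext (hjσ₀ x) (hjσ₁ x))
  · obtain ⟨b, hb⟩ := hcut z z.2
    exact ⟨b, Subtype.ext hb⟩

end Amalgam

/-! ### Polar decomposition of almost unitary paths. -/

section Polar

open scoped CStarAlgebra

variable {C : Type*} [CStarAlgebra C]

theorem IsSelfAdjoint.abs_sub_one_le_of_mem_spectrum {a : C} (ha : IsSelfAdjoint a) {x : ℝ}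
    (hx : x ∈ spectrum ℝ a) : |x - 1| ≤ ‖a - 1‖ := by
  have h3 : cfc (fun x : ℝ => x - 1) a = a - 1 := by
    rw [cfc_sub (fun x : ℝ => x) (fun _ => 1) a, cfc_id' ℝ a, cfc_const_one ℝ a]
  have h4 := norm_apply_le_norm_cfc (fun x : ℝ => x - 1) a hx
  rwa [h3] at h4

theorem continuousOn_inv_sqrt : ContinuousOn (fun x : ℝ => (√x)⁻¹) (Icc (1 / 2) (3 / 2)) :=
  Real.continuous_sqrt.continuousOn.inv₀ fun _ hx =>
    (Real.sqrt_pos.mpr (one_half_pos.trans_le hx.1)).ne'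

/-- The square root and the inverse square root of an element close to `1`. -/
theorem IsSelfAdjoint.exists_sqrt {a : C} (ha : IsSelfAdjoint a)
    (hspec : spectrum ℝ a ⊆ Icc (1 / 2) (3 / 2)) :
    ∃ r, r * cfc (fun x : ℝ => (√x)⁻¹) a = 1 ∧ cfc (fun x : ℝ => (√x)⁻¹) a * r = 1 ∧
      r * r = a ∧ ‖1 - r‖ ≤ ‖a - 1‖ := by
  have hc := continuousOn_inv_sqrt.mono hspec
  have hq : ContinuousOn (fun x : ℝ => √x) (spectrum ℝ a) := Real.continuous_sqrt.continuousOn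
  have hpos : ∀ x ∈ spectrum ℝ a, 0 < x := fun x hx => one_half_pos.trans_le (hspec hx).1
  have hrs : cfc (fun x : ℝ => √x) a * cfc (fun x : ℝ => (√x)⁻¹) a = 1 := by
    rw [← cfc_mul _ _ a hq hc, ← cfc_const_one ℝ a]
    exact cfc_congr fun x hx => mul_inv_cancel₀ (Real.sqrt_pos.mpr (hpos x hx)).ne'
  refine ⟨cfc (fun x : ℝ => √x) a, hrs, (cfc_commute_cfc _ _ a).eq.trans hrs, ?_, ?_⟩
  · rw [← cfc_mul _ _ a hq hq]
    conv_rhs => rw [← cfc_id' ℝ a]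
    exact cfc_congr fun x hx => Real.mul_self_sqrt (hpos x hx).le
  · have h4 : 1 - cfc (fun x : ℝ => √x) a = cfc (fun x : ℝ => 1 - √x) a := by
      rw [cfc_sub (fun _ => (1 : ℝ)) (fun x : ℝ => √x) a continuousOn_const hq, cfc_const_one ℝ a]
    rw [h4]
    refine norm_cfc_le (norm_nonneg _) fun x hx => ?_
    have h5 : 1 - x = (1 - √x) * (1 + √x) := by
      linear_combination Real.sq_sqrt (hpos x hx).le
    have h6 := ha.abs_sub_one_le_of_mem_spectrum hx
    rw [abs_sub_comm, h5, abs_mul] at h6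
    refine le_trans (le_mul_of_one_le_right (abs_nonneg _) ?_) h6
    rw [abs_of_nonneg (by positivity)]
    linarith [Real.sqrt_nonneg x]

/-- A path of almost unitary elements is close to a path of unitaries, by polar decomposition. -/
theorem exists_isUnitaryPath_near {w : unitInterval → C}
    (hw : Continuous w) (hw0 : w 0 = 1) {κ : ℝ} (hκ : κ ≤ 1 / 2)
    (h1 : ∀ t, ‖star (w t) * w t - 1‖ ≤ κ) (h2 : ∀ t, ‖w t * star (w t) - 1‖ ≤ κ) :
    ∃ v : unitInterval → C, IsUnitaryPath v ∧ ∀ t, ‖v t - w t‖ ≤ κ := by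
  have hsa : ∀ t, IsSelfAdjoint (star (w t) * w t) := fun t => .star_mul_self _
  -- One compact interval for all `t` makes the inverse square root depend continuously on `t`.
  have hspec : ∀ t, spectrum ℝ (star (w t) * w t) ⊆ Icc (1 / 2) (3 / 2) := by
    intro t x hx
    have := abs_le.mp (((hsa t).abs_sub_one_le_of_mem_spectrum hx).trans (h1 t))
    constructor <;> linarith
  let s : unitInterval → C := fun t => cfc (fun x : ℝ => (√x)⁻¹) (star (w t) * w t)
  have hs : ∀ t, IsSelfAdjoint (s t) := fun t => cfc_predicate _ _
  choose r hrs hsr hrr hr using fun t => (hsa t).exists_sqrt (hspec t)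
  have hunit : ∀ x : C, ‖x - 1‖ ≤ κ → IsUnit x := by
    intro x hx
    have h3 := isUnit_one_sub_of_norm_lt_one (x := 1 - x)
      (by rw [norm_sub_rev]; linarith)
    rwa [sub_sub_cancel] at h3
  -- Both one-sided estimates are needed here: invertibility upgrades the isometry `w (w⋆w)^(-1/2)`
  -- to a unitary.
  have hwu : ∀ t, IsUnit (w t) := by
    intro t
    obtain ⟨y, hy⟩ := (hunit _ (h1 t)).exists_left_inv
    obtain ⟨z, hz⟩ := (hunit _ (h2 t)).exists_right_inv
    exact isUnit_iff_exists_and_exists.mpr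
      ⟨⟨star (w t) * z, by rw [← mul_assoc, hz]⟩, ⟨y * star (w t), by rw [mul_assoc, hy]⟩⟩
  have hv : ∀ t, w t * s t ∈ unitary C := by
    intro t
    have h3 : star (w t * s t) * (w t * s t) = 1 := by
      calc _ = s t * (star (w t) * w t) * s t := by
            rw [star_mul, (hs t).star_eq]
            simp only [mul_assoc]
        _ = (s t * r t) * (r t * s t) := by
            rw [← hrr]
            simp only [mul_assoc]
        _ = 1 := by rw [hsr, hrs, mul_one]
    obtain ⟨y, hy⟩ := ((hwu t).mul (isUnit_iff_exists_and_exists.mpr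
      ⟨⟨r t, hsr t⟩, ⟨r t, hrs t⟩⟩)).exists_right_inv
    have h4 : y = star (w t * s t) := by
      rw [← one_mul y, ← h3, mul_assoc, hy, mul_one]
    rw [Unitary.mem_iff]
    exact ⟨h3, h4 ▸ hy⟩
  refine ⟨fun t => w t * s t, ⟨?_, hv, ?_⟩, fun t => ?_⟩
  · exact hw.mul (Continuous.cfc' isCompact_Icc _ (hw.star.mul hw) hspec continuousOn_inv_sqrt hsa)
  · have h3 : s 0 = cfc (fun x : ℝ => (√x)⁻¹) (1 : C) := by simp only [s, hw0, star_one, mul_one]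
    change w 0 * s 0 = 1
    rw [hw0, h3, one_mul, cfc_apply_one]
    simp
  · have h3 : w t * s t - w t = w t * s t * (1 - r t) := by
      have h4 : w t * s t * r t = w t := by rw [mul_assoc, hsr, mul_one]
      rw [mul_sub, h4, mul_one]
    rw [h3]
    calc _ ≤ 1 * κ := (norm_mul_le _ _).trans (mul_le_mul (norm_le_one_of_mem_unitary (hv t))
          ((hr t).trans (h1 t)) (norm_nonneg _) zero_le_one)
      _ = κ := one_mul κ

end Polar

/-! ### The property passes to corners. -/

section CornerProperty

open scoped InnerProductSpace CStarAlgebra ComplexOrder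

section Compression

variable {C : Type*} [CStarAlgebra C] {E u : C}

theorem norm_mul_mul_le_of_norm_le_one {x y z : C} (hx : ‖x‖ ≤ 1) (hz : ‖z‖ ≤ 1) :
    ‖x * y * z‖ ≤ ‖y‖ := by
  calc _ ≤ ‖x‖ * ‖y‖ * ‖z‖ := (norm_mul_le _ _).trans (by gcongr; exact norm_mul_le _ _)
    _ ≤ 1 * ‖y‖ * 1 := by gcongr
    _ = ‖y‖ := by rw [one_mul, mul_one]

/-- The difference equals `E u⋆ (Eu - uE) E`. -/
theorem norm_star_mul_compression_sub_le (hE : IsStarProjection E) (hu : u ∈ unitary C) :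
    ‖star (E * u * E) * (E * u * E) - E‖ ≤ ‖u * E - E * u‖ := by
  have hEE := hE.isIdempotentElem.eq
  have hEE' : ∀ x, E * (E * x) = E * x := fun x => by rw [← mul_assoc, hEE]
  have h1 : star (E * u * E) * (E * u * E) - E = E * star u * (E * u - u * E) * E := by
    have h2 : star u * (u * E) = E := by
      rw [← mul_assoc, Unitary.star_mul_self_of_mem hu, one_mul]
    simp only [star_mul, hE.isSelfAdjoint.star_eq, mul_sub, sub_mul, mul_assoc, hEE', hEE, h2]
  rw [h1, norm_sub_rev (u * E)]
  exact norm_mul_mul_le_of_norm_le_one ((norm_mul_le _ _).trans (mul_le_one₀ (hE.norm_le _)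
    (norm_nonneg _) (norm_le_one_of_mem_unitary (Unitary.star_mem hu)))) (hE.norm_le _)

theorem norm_compression_mul_sub_le {X : C} (hE : IsStarProjection E) (h1 : E * X = X)
    (h2 : X * E = X) : ‖E * u * E * X - X * (E * u * E)‖ ≤ ‖u * X - X * u‖ := by
  have h3 : E * u * E * X - X * (E * u * E) = E * (u * X - X * u) * E := by
    simp only [mul_sub, sub_mul, mul_assoc, h1, h2]
    simp only [← mul_assoc, h1, h2]
  rw [h3]
  exact norm_mul_mul_le_of_norm_le_one (hE.norm_le _) (hE.norm_le _)

end Compression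

theorem exists_inr_eq_inr_mul_mul {D : Type*} [NonUnitalCStarAlgebra D] (x y : D)
    (u : Unitization ℂ D) :
    ∃ z : D, (z : Unitization ℂ D) = (x : Unitization ℂ D) * u * (y : Unitization ℂ D) := by
  refine ⟨((x : Unitization ℂ D) * u * (y : Unitization ℂ D)).snd, ?_⟩
  apply Unitization.ext <;> simp

variable {A B D : Type u} [NonUnitalCStarAlgebra A] [NonUnitalCStarAlgebra B]
  [NonUnitalCStarAlgebra D] {e : A} {he : IsStarProjection e} {ι : corner e he →⋆ₙₐ[ℂ] B}

/-- A unitary path almost commuting with a projection gives a unitary path in its corner. -/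
theorem exists_isUnitaryPath_of_compression
    (hι : ∀ b, ι (cornerUnit he) * b = b ∧ b * ι (cornerUnit he) = b)
    {σ : A →⋆ₙₐ[ℂ] D} {j : B →⋆ₙₐ[ℂ] D} (hj : Function.Injective j)
    (hjσ : ∀ x : corner e he, j (ι x) = σ x) (hcut : ∀ z, ∃ b, j b = σ e * z * σ e)
    {u : unitInterval → Unitization ℂ D} (hu : IsUnitaryPath u) {κ : ℝ} (hκ : κ ≤ 1 / 2)
    (hue : ∀ t, ‖u t * (σ e : Unitization ℂ D) - (σ e : Unitization ℂ D) * u t‖ ≤ κ) :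
    ∃ (b : B) (v : unitInterval → Unitization ℂ B), IsUnitaryPath v ∧
      (j b : Unitization ℂ D) = (σ e : Unitization ℂ D) * u 1 * (σ e : Unitization ℂ D) ∧
      ‖v 1 - (b + (1 - (ι (cornerUnit he) : Unitization ℂ B)))‖ ≤ κ ∧
      ∀ t (x : corner e he), ‖v t * (ι x : Unitization ℂ B) - (ι x : Unitization ℂ B) * v t‖ ≤
        ‖u t * (σ x : Unitization ℂ D) - (σ x : Unitization ℂ D) * u t‖ + 2 * κ * ‖x‖ := by
  set p := ι (cornerUnit he) with hp
  have hE : IsStarProjection (σ e : Unitization ℂ D) := by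
    constructor
    · rw [IsIdempotentElem, ← Unitization.inr_mul, ← map_mul, he.isIdempotentElem.eq]
    · rw [IsSelfAdjoint, ← Unitization.inr_star, ← map_star, he.isSelfAdjoint.star_eq]
  have hjp : j p = σ e := hjσ _
  have hps : star p = p := by
    rw [hp, ← map_star, (isStarProjection_cornerUnit he).isSelfAdjoint.star_eq]
  have hb : ∀ t, ∃ b, (j b : Unitization ℂ D) =
      (σ e : Unitization ℂ D) * u t * (σ e : Unitization ℂ D) := by
    intro t
    obtain ⟨z, hz⟩ := exists_inr_eq_inr_mul_mul (σ e) (σ e) (u t)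
    obtain ⟨b, hb⟩ := hcut z
    refine ⟨b, ?_⟩
    rw [hb, Unitization.inr_mul, Unitization.inr_mul, hz]
    have hEE := hE.isIdempotentElem.eq
    simp only [mul_assoc, hEE]
    simp only [← mul_assoc, hEE]
  choose b hb using hb
  have hiso : Isometry fun y : B => (j y : Unitization ℂ D) :=
    (Unitization.isometry_inr (𝕜 := ℂ)).comp (NonUnitalStarAlgHom.isometry j hj)
  have hnorm : ∀ y : B, ‖(y : Unitization ℂ B)‖ = ‖(j y : Unitization ℂ D)‖ := fun y => by
    rw [Unitization.norm_inr, Unitization.norm_inr, NonUnitalStarAlgHom.norm_map j hj]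
  have hbcont : Continuous b := by
    rw [hiso.isEmbedding.continuous_iff]
    have h1 : (fun y : B => (j y : Unitization ℂ D)) ∘ b =
        fun t => (σ e : Unitization ℂ D) * u t * (σ e : Unitization ℂ D) := funext hb
    rw [h1]
    exact (continuous_const.mul hu.continuous).mul continuous_const
  have hb0 : b 0 = p := by
    apply hiso.injective
    change (j (b 0) : Unitization ℂ D) = (j p : Unitization ℂ D)
    rw [hb, hu.map_zero, mul_one, hE.isIdempotentElem.eq, hjp]
  -- The compressed path completed by `1 - p`, so that it starts at `1` and is almost unitary in the
  -- unitization of `B`.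
  let w : unitInterval → Unitization ℂ B := fun t => (b t : Unitization ℂ B) + (1 - p)
  have hw : Continuous w :=
    ((Unitization.isometry_inr (𝕜 := ℂ)).continuous.comp hbcont).add continuous_const
  have hw0 : w 0 = 1 := by
    change (b 0 : Unitization ℂ B) + (1 - p) = 1
    rw [hb0]
    abel
  have hinr : ∀ y z : B, ((y : Unitization ℂ B) + (1 - p)) * ((z : Unitization ℂ B) + (1 - p)) =
      ((y * z : B) : Unitization ℂ B) + (1 - p) := by
    intro y z
    have h1 : (y : Unitization ℂ B) * p = y := by rw [← Unitization.inr_mul, (hι y).2]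
    have h2 : (p : Unitization ℂ B) * z = z := by rw [← Unitization.inr_mul, (hι z).1]
    have h3 : (p : Unitization ℂ B) * p = p := by rw [← Unitization.inr_mul, (hι p).1]
    rw [Unitization.inr_mul]
    simp only [add_mul, mul_add, sub_mul, mul_sub, one_mul, mul_one, h1, h2, h3]
    abel
  have hwstar : ∀ t, star (w t) = ((star (b t) : B) : Unitization ℂ B) + (1 - p) := by
    intro t
    change star ((b t : Unitization ℂ B) + (1 - p)) = _
    rw [star_add, star_sub, star_one, ← Unitization.inr_star, ← Unitization.inr_star, hps]
  have hsub : ∀ y : B, (y : Unitization ℂ B) + (1 - p) - 1 = ((y - p : B) : Unitization ℂ B) := by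
    intro y
    rw [Unitization.inr_sub]
    abel
  obtain ⟨v, hv, hvw⟩ := exists_isUnitaryPath_near hw hw0 hκ (fun t => by
    rw [hwstar, hinr, hsub, hnorm, map_sub, map_mul, map_star, Unitization.inr_sub,
      Unitization.inr_mul, Unitization.inr_star, hb, hjp]
    exact (norm_star_mul_compression_sub_le hE (hu.mem_unitary t)).trans (hue t)) (fun t => by
    rw [hwstar, hinr, hsub, hnorm, map_sub, map_mul, map_star, Unitization.inr_sub,
      Unitization.inr_mul, Unitization.inr_star, hb, hjp]
    have h1 := norm_star_mul_compression_sub_le hE (Unitary.star_mem (hu.mem_unitary t))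
    have h2 : star ((σ e : Unitization ℂ D) * u t * (σ e : Unitization ℂ D)) =
        (σ e : Unitization ℂ D) * star (u t) * (σ e : Unitization ℂ D) := by
      rw [star_mul, star_mul, hE.isSelfAdjoint.star_eq, mul_assoc]
    rw [← h2, star_star] at h1
    refine h1.trans ?_
    have h3 : star (u t) * (σ e : Unitization ℂ D) - (σ e : Unitization ℂ D) * star (u t) =
        star ((σ e : Unitization ℂ D) * u t - u t * (σ e : Unitization ℂ D)) := by
      rw [star_sub, star_mul, star_mul, hE.isSelfAdjoint.star_eq]
    rw [h3, norm_star, norm_sub_rev]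
    exact hue t)
  refine ⟨b 1, v, hv, hb 1, hvw 1, fun t x => ?_⟩
  have h1 : v t * (ι x : Unitization ℂ B) - (ι x : Unitization ℂ B) * v t =
      (((b t * ι x - ι x * b t : B)) : Unitization ℂ B) +
        ((v t - w t) * (ι x : Unitization ℂ B) - (ι x : Unitization ℂ B) * (v t - w t)) := by
    have h2 : (ι x : Unitization ℂ B) * p = ι x := by rw [← Unitization.inr_mul, (hι _).2]
    have h3 : (p : Unitization ℂ B) * ι x = ι x := by rw [← Unitization.inr_mul, (hι _).1]
    simp only [w, Unitization.inr_sub, Unitization.inr_mul, add_mul, mul_add, sub_mul, mul_sub,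
      one_mul, mul_one, h2, h3]
    abel
  rw [h1]
  refine (norm_add_le _ _).trans (add_le_add ?_ ?_)
  · rw [hnorm, map_sub, map_mul, map_mul, hjσ, Unitization.inr_sub, Unitization.inr_mul,
      Unitization.inr_mul, hb]
    refine norm_compression_mul_sub_le hE ?_ ?_ <;>
      rw [← Unitization.inr_mul, ← map_mul, ← (mem_corner_iff he).mp x.2]
    · rw [← mul_assoc, ← mul_assoc, he.isIdempotentElem.eq]
    · rw [mul_assoc, he.isIdempotentElem.eq]
  · have h2 : ‖(ι x : Unitization ℂ B)‖ ≤ ‖x‖ := by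
      rw [Unitization.norm_inr]
      exact NonUnitalStarAlgHom.norm_apply_le _ _
    calc _ ≤ ‖v t - w t‖ * ‖(ι x : Unitization ℂ B)‖ + ‖(ι x : Unitization ℂ B)‖ * ‖v t - w t‖ :=
          (norm_sub_le _ _).trans (add_le_add (norm_mul_le _ _) (norm_mul_le _ _))
      _ ≤ κ * ‖x‖ + ‖x‖ * κ := by
        have := hvw t
        gcongr
        exact (norm_nonneg _).trans this
      _ = 2 * κ * ‖x‖ := by ring

/-- For unital `ι`, the state of `A` at `Vξ` is the state of `eAe` at `ξ` composed with `x ↦ exe`,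
so testing on the compressions of `G` suffices. The path given by `A` is compressed to `B`, made
unitary, and then misses `η` by at most `κ`; a short path closes the gap. -/
theorem VectorPathProperty.corner (hA : VectorPathProperty A) (e : A) (he : IsStarProjection e) :
    VectorPathProperty (corner e he) := by
  classical
  refine RelativeVectorPathProperty.vectorPathProperty (e := cornerUnit he) ?_
    (isStarProjection_cornerUnit he) (cornerUnit_mul he)
  intro F ε hε
  let M : ℝ := ∑ x ∈ F, ‖x‖
  have hM : ∀ x ∈ F, ‖x‖ ≤ M := fun x hx =>
    Finset.single_le_sum (f := fun x => ‖x‖) (fun _ _ => norm_nonneg _) hx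
  have hM0 : 0 ≤ M := Finset.sum_nonneg fun _ _ => norm_nonneg _
  -- The commutator is below `24κM` from the endpoint correction plus `κ + 2κM` from the compressed
  -- path; `1/2` is the limit for polar decomposition.
  let κ : ℝ := min (1 / 2) (ε / (1 + 26 * M))
  have hκ : 0 < κ := by positivity
  have hκ2 : κ ≤ 1 / 2 := min_le_left _ _
  have hκε : κ * (1 + 26 * M) ≤ ε := by
    rw [← le_div_iff₀ (by positivity)]
    exact min_le_right _ _
  -- Including `e` makes the path almost commute with the projection by which it is compressed.
  obtain ⟨G, δ, hδ, h⟩ := hA (insert e (F.image (↑))) κ hκ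
  refine ⟨G.image (cornerCut he), δ, hδ, ?_⟩
  intro B _ ι hι H _ _ _ π hπ ξ η hξ hη hG
  replace hι := hι _ rfl
  obtain ⟨D, _, σ, j, K, _, _, _, Φ, V, hj, hjσ, hcut, hΦ, hV, hjV⟩ :=
    exists_corner_amalgam hι hπ hξ
  have hVinner : ∀ v w, ⟪V v, V w⟫_ℂ = ⟪v, w⟫_ℂ := fun v w => by
    rw [← ContinuousLinearMap.adjoint_inner_right, hV]
  have hVnorm : ∀ v, ‖V v‖ = ‖v‖ := fun v => by
    rw [← sq_eq_sq₀ (norm_nonneg _) (norm_nonneg _), ← inner_self_eq_norm_sq (𝕜 := ℂ), hVinner,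
      inner_self_eq_norm_sq]
  have hπ1 : ∀ v, π (ι (cornerUnit he)) v = v := fun v => by
    refine (hπ.denseRange_apply hξ).induction_on v
      (isClosed_eq (ContinuousLinearMap.continuous _) continuous_id) fun a => ?_
    conv_rhs => rw [← (hι a).1, map_mul]
    rfl
  have hΦe : ∀ v, Φ (σ e) (V v) = V v := fun v => by
    rw [← coe_cornerUnit he, ← hjσ, hjV, hπ1]
  have hes : star (σ e) = σ e := by rw [← map_star, he.isSelfAdjoint.star_eq]
  have hcomp : ∀ x v, ⟪V v, Φ (σ x) (V v)⟫_ℂ = ⟪v, π (ι (cornerCut he x)) v⟫_ℂ := fun x v => by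
    rw [← hVinner, ← hjV, hjσ, coe_cornerCut, map_mul, map_mul, map_mul, map_mul]
    change _ = ⟪V v, Φ (σ e) (Φ (σ x) (Φ (σ e) (V v)))⟫_ℂ
    rw [inner_rep_right Φ (σ e), hes, hΦe]
  obtain ⟨u, hu, hu1, huF⟩ := h D σ K Φ hΦ (V ξ) (V η) (by rw [hVnorm, hξ]) (by rw [hVnorm, hη])
    fun x hx => by
      rw [hcomp, hcomp]
      exact hG _ (Finset.mem_image_of_mem _ hx)
  obtain ⟨b, v, hv, hb, hvb, hvF⟩ := exists_isUnitaryPath_of_compression hι hj hjσ hcut hu hκ2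
    fun t => (huF e (Finset.mem_insert_self _ _) t).le
  have hbη : π b ξ = η := by
    rw [← hV (π b ξ), ← hjV, ← unitizationRep_inr Φ, hb, unitizationRep_mul_apply,
      unitizationRep_mul_apply, unitizationRep_inr, hΦe, hu1, hΦe, hV]
  have hvη : ‖unitizationRep π (v 1) ξ - η‖ ≤ κ := by
    have h1 : unitizationRep π (v 1) ξ - η =
        unitizationRep π (v 1 - (b + (1 - (ι (cornerUnit he) : Unitization ℂ B)))) ξ := by
      simp only [map_sub, map_add, map_one, sub_apply, add_apply, unitizationRep_inr, hbη, hπ1]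
      simp
    rw [h1]
    refine (ContinuousLinearMap.le_opNorm _ _).trans ?_
    rw [hξ, mul_one]
    exact (NonUnitalStarAlgHom.norm_apply_le (unitizationRep π) _).trans hvb
  obtain ⟨s, hs, hs1, hsF⟩ := exists_small_path hπ
    ((norm_unitizationRep_of_mem_unitary (hv.mem_unitary 1) ξ).trans hξ) hη hκ.le (by linarith)
    (pow_le_pow_left₀ (norm_nonneg _) hvη 2)
  refine ⟨_, hs.mul hv, ?_, fun x hx t => ?_⟩
  · rw [unitizationRep_mul_apply, hs1]
  · refine (norm_commutator_mul_le (hs.mem_unitary t) (hv.mem_unitary t)).trans_lt ?_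
    have h1 := hsF t (ι x : Unitization ℂ B)
    have h2 := hvF t x
    have h3 := huF x (Finset.mem_insert_of_mem (Finset.mem_image_of_mem _ hx)) t
    have h4 : ‖(ι x : Unitization ℂ B)‖ ≤ ‖x‖ := by
      rw [Unitization.norm_inr]
      exact NonUnitalStarAlgHom.norm_apply_le _ _
    have h5 : κ * ‖(ι x : Unitization ℂ B)‖ ≤ κ * M := by
      gcongr
      exact h4.trans (hM x hx)
    have h6 : κ * ‖x‖ ≤ κ * M := by
      gcongr
      exact hM x hx
    linarith

end CornerProperty

/-! ### The five permanence statements. -/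

theorem mainTheorem10 :
    (∀ (A : Type u) [NonUnitalCStarAlgebra A],
      ¬ HasIdentity A → PureStatePathProperty A → PureStatePathProperty (Unitization ℂ A)) ∧
    (∀ (A₁ A₂ : Type u) [CStarAlgebra A₁] [CStarAlgebra A₂],
      PureStatePathProperty A₁ → PureStatePathProperty A₂ → PureStatePathProperty (A₁ × A₂)) ∧
    (∀ (A : Type u) [NonUnitalCStarAlgebra A] (e : A) (he : IsStarProjection e),
      PureStatePathProperty A → PureStatePathProperty (corner e he)) ∧
    (∀ (A : Type u) [NonUnitalCStarAlgebra A] (I : ClosedIdeal A),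
      PureStatePathProperty A → PureStatePathProperty I.Quotient) ∧
    (∀ (A : ℕ → Type u) [∀ n, NonUnitalCStarAlgebra (A n)]
      (φ : ∀ n, A n →⋆ₙₐ[ℂ] A (n + 1)),
      (∀ n, PureStatePathProperty (A n)) → PureStatePathProperty (inductiveLimit φ)) := by
  exact ⟨fun _ _ _ hA => hA.vectorPathProperty.unitization.pureStatePathProperty,
    fun _ _ _ _ h₁ h₂ => (h₁.vectorPathProperty.prod h₂.vectorPathProperty).pureStatePathProperty,
    fun _ _ e he hA => (hA.vectorPathProperty.corner e he).pureStatePathProperty,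
    fun _ _ I hA => (hA.vectorPathProperty.quotient I).pureStatePathProperty,
    fun _ _ φ hA =>
      (VectorPathProperty.inductiveLimit φ fun n =>
        (hA n).vectorPathProperty).pureStatePathProperty⟩
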